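/- Let $N\in\{4,5\}$, let $\eta=(\eta_{\alpha\beta})_{1\le\alpha,\beta\le N}$ be an arbitrary nondegenerate symmetric real matrix with inverse $(\eta^{\alpha\beta})$, and fix $p\in\{2,\dots,N\}$. For a function $f=f(t^2,\dots,t^N)$ put $F_{1\beta\gamma}=\eta_{\beta\gamma}$ and $F_{ijk}=f_{ijk}=\partial^3 f/\partial t^i\partial t^j\partial t^k$ for $i,j,k\ge2$, with $F_{\alpha\beta\gamma}$ totally symmetric. The WDVV system is $S_{\alpha\beta\gamma\nu}:=\eta^{\lambda\mu}(F_{\lambda\alpha\beta}F_{\mu\gamma\nu}-F_{\lambda\alpha\nu}F_{\mu\gamma\beta})=0$ for all $1\le\alpha,\beta,\gamma,\nu\le N$. For an unordered pair $I=(i,m)$, $2\le i\le m\le N$, write $u^I_\lambda=f_{\lambda im}$ and $u^I=u^I_p$; there are $n=N(N-1)/2$ variables $u^I$. The $u^I$ are called parametric; the third derivatives $f_{ijk}$ with $i,j,k\ne p$ are called principal. The subsystem $S_L=\{S_{pa\mu b}=0\mid \mu\neq p,\ 2\le a<b\le N\}$ is linear in the principal derivatives; let $U\subset\mathbb R^n$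 be the set of all $u$ for which $S_L$ has exactly one solution for the principal derivatives. Then: 1. There are a nonzero polynomial $Q(u)$ with $U=\{Q\ne0\}$ and rational functions $G^{ijk}$ of $u$ with denominator $Q$ such that, for third-order jets with $u\in U$, the subsystem $S_L$ and the full WDVV system are each equivalent to the system of $\binom N3$ equations $$f_{ijk}=G^{ijk}(f_{plm}),\qquad i\le j\le k,\quad i,j,k\in\{2,\dots,N\}\setminus\{p\}.\qquad(*)$$ In particular, a $C^4$ function $f$ on an open set with $(f_{plm})\in U$ everywhere satisfies the WDVV system if and only if it satisfies $(*)$. 2. The system $(*)$ is orthonomic: there is a ranking of derivatives (a strict total order on multi-indices, compatible with differentiation) in which the principal third derivatives rank above the parametric ones, and each equation is solved for a principal derivative, with a right-hand side that involves only lower-ranked, non-principal derivatives. It is passive: after all derivatives have been expressed by means of $(*)$ and its differential consequences through the parametric derivatives $\partial_p^k u^I$, $k\ge0$, all integrability conditions $\partial^\alpha G^{\sigma}=\partial^\beta G^{\tau}$ (where $\sigma,\tau$ are multi-indices of principal third derivatives and $\alpha+\sigma=\beta+\tau$) are satisfied identically over $U$. 3. Let $V^I_\lambda(u)$ denote $u^I_\lambda$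 expressed through $u=(u^J)$ by means of $(*)$. Restricted to the first prolongation $S_{\alpha\beta\gamma\nu}=0$, $\partial_\lambda S_{\alpha\beta\gamma\nu}=0$ of the WDVV system (in the space of sesquiholonomic jets of order four over $u\in U$, that is, with the first derivatives $(f_{ijk})_\lambda$ of the third-order coordinates taken as independent), the equations $(u^I_\mu)_\lambda=(u^I_\lambda)_\mu$, $\lambda,\mu\in\{2,\dots,N\}$, $I=1,\dots,n$, are equivalent to the $N-2$ first-order systems of conservation laws $$(u^I)_\lambda=\bigl(V^I_\lambda(u)\bigr)_p,\qquad I=1,\dots,n,\qquad \lambda\in\{2,\dots,N\}\setminus\{p\},$$ whose fluxes all depend on the same variables $u^J$; the further conditions $(u^I_\lambda)_\mu=(u^I_\mu)_\lambda$, $\lambda,\mu\neq p$, are then satisfied identically. In particular, for every $C^4$ solution $f$ of the WDVV system with $(f_{plm})\in U$, the functions $u^I=f_{pI}$ satisfy these systems. 4. These $N-2$ systems commute: with $x=t^p$, the Jacobi brackets of the generalized vector fields $(V^I_\lambda)_x\,\partial/\partial u^I$ and $(V^I_\mu)_x\,\partial/\partial u^I$ vanish over $U$. They are all Hamiltonian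 with respect to one and the same third-order Hamiltonian operator $A^{IJ}=D_x\circ(g^{IJ}(u)D_x+c^{IJ}_K(u)u^K_x)\circ D_x$, with coefficients smooth on $U$ and $(g^{IJ})$ symmetric and nondegenerate: the bracket defined by $A$ is skew-symmetric and satisfies the Jacobi identity, and each system has the form $u^I_t=A^{IJ}\,\delta H/\delta u^J$, where $H=\int h(x,b,b_x)\,dx$ has a smooth density in the potentials $b$, $b^I_x=u^I$ (so $H$ may be nonlocal in $u$). -/

import Mathlib

open scoped ContDiff

noncomputable section

namespace WDVV

/-! ### Jets and the WDVV equations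

`r = N - 1` is the number of the independent variables `t², …, t^N` of the unknown `f`.
An index `i : Fin r` stands for `t^{i+2}`, an index `α : Fin (r + 1)` for `t^{α+1}`, so that
`0 : Fin (r + 1)` is the distinguished variable `t¹` and `i.succ` is the variable of `i`. -/

/-- The derivative coordinates `f_σ`, `|σ| = k`, of a function of `r` variables;
multi-indices are unordered `k`-tuples. -/
abbrev Jet (r k : ℕ) : Type := Sym (Fin r) k → ℝ

/-- The third derivatives `F_{αβγ}` of the potential
`F = (cubic part in t¹ prescribed by η) + f`: `F_{1βγ} = η_{βγ}` and `F_{ijk} = f_{ijk}`. -/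
def thirdDeriv {r : ℕ} (η : Matrix (Fin (r + 1)) (Fin (r + 1)) ℝ) (f : Jet r 3)
    (α β γ : Fin (r + 1)) : ℝ :=
  Fin.cases (η β γ)
    (fun i => Fin.cases (η i.succ γ)
      (fun j => Fin.cases (η i.succ j.succ)
        (fun k => f (i ::ₛ j ::ₛ k ::ₛ Sym.nil)) γ) β) α

/-- `S_{αβγν} = η^{λμ} (F_{λαβ} F_{μγν} - F_{λαν} F_{μγβ})`. -/
def S {r : ℕ} (η : Matrix (Fin (r + 1)) (Fin (r + 1)) ℝ) (f : Jet r 3)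
    (α β γ ν : Fin (r + 1)) : ℝ :=
  ∑ l, ∑ m, η⁻¹ l m *
    (thirdDeriv η f l α β * thirdDeriv η f m γ ν - thirdDeriv η f l α ν * thirdDeriv η f m γ β)

/-- The full WDVV system, as a subset of the space of third-order jets. -/
def IsWDVV {r : ℕ} (η : Matrix (Fin (r + 1)) (Fin (r + 1)) ℝ) (f : Jet r 3) : Prop :=
  ∀ α β γ ν, S η f α β γ ν = 0

/-- The subsystem `S_{p a μ b} = 0`, `μ ≠ p`, `2 ≤ a < b ≤ N`, which is linear in the
`t^p`-free derivatives. -/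
def IsLinearWDVV {r : ℕ} (η : Matrix (Fin (r + 1)) (Fin (r + 1)) ℝ) (p : Fin r)
    (f : Jet r 3) : Prop :=
  ∀ μ a b : Fin r, μ ≠ p → a < b → S η f p.succ a.succ μ.succ b.succ = 0

/-- The multi-indices of the principal (that is, `t^p`-free) third derivatives. -/
def principal {r : ℕ} (p : Fin r) : Set (Sym (Fin r) 3) := {τ | p ∉ τ}

/-- The parametric third derivatives `u^I = u^I_p = f_{pI}`, where `I` is an unordered pair. -/
def param {r : ℕ} (p : Fin r) (f : Jet r 3) : Jet r 2 := fun I => f (p ::ₛ I)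

/-- The third-order jet with given parametric and principal derivatives. -/
def joinJet {r : ℕ} (p : Fin r) (u : Jet r 2) (g : principal p → ℝ) : Jet r 3 :=
  fun τ => if h : p ∈ τ then u (τ.erase p h) else g ⟨τ, h⟩

/-- The values of the parametric derivatives at which the linear subsystem can be solved
uniquely for the principal derivatives. -/
def regularLocus {r : ℕ} (η : Matrix (Fin (r + 1)) (Fin (r + 1)) ℝ) (p : Fin r) :
    Set (Jet r 2) :=
  {u | ∃! g : principal p → ℝ, IsLinearWDVV η p (joinJet p u g)}

/-- The system `f_τ = G^τ(f_{pI})`, one equation for each principal derivative. -/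
def IsReduced {r : ℕ} (p : Fin r) (G : principal p → Jet r 2 → ℝ) (f : Jet r 3) : Prop :=
  ∀ τ : principal p, f τ = G τ (param p f)

/-! ### Orthonomic and passive systems -/

/-- A ranking of the derivatives of one unknown function: a strict total order on all
multi-indices which is compatible with differentiation. -/
structure IsRanking {r : ℕ} (lt : Multiset (Fin r) → Multiset (Fin r) → Prop) : Prop where
  irrefl : ∀ σ, ¬ lt σ σ
  trans : ∀ ρ σ τ, lt ρ σ → lt σ τ → lt ρ τ
  total : ∀ σ τ, lt σ τ ∨ σ = τ ∨ lt τ σ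
  lt_cons : ∀ i σ, lt σ (i ::ₘ σ)
  cons_lt_cons : ∀ i σ τ, lt σ τ → lt (i ::ₘ σ) (i ::ₘ τ)

/-- The system `f_τ = R^τ`, `τ ∈ P`, is orthonomic: the right-hand side of each equation
involves only derivatives that are ranked lower than `f_τ` and are not principal. -/
def IsOrthonomic {r : ℕ} (lt : Multiset (Fin r) → Multiset (Fin r) → Prop)
    (P : Set (Sym (Fin r) 3)) (R : P → Jet r 3 → ℝ) : Prop :=
  ∀ τ : P, DependsOn (R τ)
    {σ | σ ∉ P ∧ lt (σ : Multiset (Fin r)) ((τ : Sym (Fin r) 3) : Multiset (Fin r))}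

/-- All third derivatives `u^I_l = f_{lI}` as functions of the parametric ones; for `l ≠ p`
these are the fluxes of the `l`-th first-order system, and `u^I_p = u^I`. -/
def flux {r : ℕ} (p : Fin r) (G : principal p → Jet r 2 → ℝ) (l : Fin r)
    (I : Sym (Fin r) 2) (u : Jet r 2) : ℝ :=
  joinJet p u (fun τ => G τ u) (l ::ₛ I)

/-- Infinite jets of vector functions `u = (u^i)` of the single variable `x`:
`z k i` is the `k`-th `x`-derivative of `u^i`. -/
abbrev InfJet (ι : Type) : Type := ℕ → ι → ℝ

/-- The total derivative `D_x = ∑ u^i_{k+1} ∂/∂u^i_k`. -/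
def Dx {ι : Type} (g : InfJet ι → ℝ) (z : InfJet ι) : ℝ :=
  lineDeriv ℝ g z (fun k => z (k + 1))

/-- The action on functions of the (prolonged) generalized vector field
`(V^i)_x ∂/∂u^i`, that is of `∑ D_x^k((V^i)_x) ∂/∂u^i_k`. -/
def evol {ι : Type} (V : ι → (ι → ℝ) → ℝ) (g : InfJet ι → ℝ) (z : InfJet ι) : ℝ :=
  lineDeriv ℝ g z (fun k i => (Dx^[k + 1] (fun y => V i (y 0))) z)

/-- The total derivative with respect to `t^l` restricted to the reduced system and its
differential consequences. The parametric derivatives of order at least `3` are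
`z k I = f_{p⋯p I}` (with `k + 1` letters `p`); every other derivative is replaced by its
expression through them: `∂_l f_{p⋯p I} = D_x^{k+1} (f_{lI})` with `x = t^p`. -/
def restrictedD {r : ℕ} (p : Fin r) (G : principal p → Jet r 2 → ℝ) (l : Fin r) :
    (InfJet (Sym (Fin r) 2) → ℝ) → InfJet (Sym (Fin r) 2) → ℝ :=
  evol (flux p G l)

/-- Passivity on `U`: whenever the derivatives `∂_a` of the equation for `f_σ` and `∂_b` of the
equation for `f_τ` have the same left-hand side, their right-hand sides coincide identically
in the parametric derivatives. -/
def IsPassive {r : ℕ} (p : Fin r) (G : principal p → Jet r 2 → ℝ) (U : Set (Jet r 2)) : Prop :=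
  ∀ (a b : List (Fin r)) (σ τ : principal p),
    (a : Multiset (Fin r)) + ((σ : Sym (Fin r) 3) : Multiset (Fin r)) =
      (b : Multiset (Fin r)) + ((τ : Sym (Fin r) 3) : Multiset (Fin r)) →
    ∀ z : InfJet (Sym (Fin r) 2), z 0 ∈ U →
      a.foldr (restrictedD p G) (fun y => G σ (y 0)) z =
        b.foldr (restrictedD p G) (fun y => G τ (y 0)) z

/-! ### The first prolongation

A point of the sesquiholonomic jet space of order four consists (besides lower-order
coordinates) of a third-order jet `f` and of `h l τ = (f_τ)_l`. -/

/-- `(f, h)` lies on the WDVV system and on its total derivatives `∂_l S_{αβγν} = 0`. -/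
def IsProlonged {r : ℕ} (η : Matrix (Fin (r + 1)) (Fin (r + 1)) ℝ) (f : Jet r 3)
    (h : Fin r → Jet r 3) : Prop :=
  IsWDVV η f ∧ ∀ l α β γ ν, lineDeriv ℝ (fun f' => S η f' α β γ ν) f (h l) = 0

/-- The equations `(u^I_m)_l = (u^I_l)_m` that cut out the holonomic jets. -/
def IsHolonomic {r : ℕ} (h : Fin r → Jet r 3) : Prop :=
  ∀ (l m : Fin r) (I : Sym (Fin r) 2), h l (m ::ₛ I) = h m (l ::ₛ I)

/-- The first-order systems `(u^I)_l = (u^I_l(u))_p`, `l ≠ p`, with `(u^I)_l = h l (p ::ₛ I)`. -/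
def SatisfiesSystems {r : ℕ} (p : Fin r) (G : principal p → Jet r 2 → ℝ) (f : Jet r 3)
    (h : Fin r → Jet r 3) : Prop :=
  ∀ l, l ≠ p → ∀ I : Sym (Fin r) 2,
    h l (p ::ₛ I) = fderiv ℝ (flux p G l I) (param p f) (param p (h p))

/-! ### Commuting and Hamiltonian systems of conservation laws `u^i_t = (V^i(u))_x` -/

/-- The Jacobi bracket of `(V^i)_x ∂/∂u^i` and `(W^i)_x ∂/∂u^i` vanishes over `U`. -/
def FlowsCommute {ι : Type} (U : Set (ι → ℝ)) (V W : ι → (ι → ℝ) → ℝ) : Prop :=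
  ∀ z : InfJet ι, z 0 ∈ U → ∀ i,
    evol V (Dx (fun y => W i (y 0))) z = evol W (Dx (fun y => V i (y 0))) z

/-- The operator `A^{ij} = D_x ∘ (g^{ij} D_x + c^{ij}_k u^k_x) ∘ D_x` at `u`, applied to `w`. -/
def thirdOrderOp {ι : Type} [Fintype ι] (g : (ι → ℝ) → Matrix ι ι ℝ)
    (c : (ι → ℝ) → ι → ι → ι → ℝ) (u w : ℝ → ι → ℝ) (x : ℝ) (i : ι) : ℝ :=
  deriv (fun y => ∑ j, (g (u y) i j * deriv (deriv fun s => w s j) y +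
    (∑ k, c (u y) i j k * deriv (fun s => u s k) y) * deriv (fun s => w s j) y)) x

/-- The bracket at `u` of the functionals `∫ ∑ aᵢ uⁱ dx` and `∫ ∑ bᵢ uⁱ dx`, whose variational
derivatives are `a` and `b`. -/
def bracket {ι : Type} [Fintype ι] (g : (ι → ℝ) → Matrix ι ι ℝ)
    (c : (ι → ℝ) → ι → ι → ι → ℝ) (a b u : ℝ → ι → ℝ) : ℝ :=
  ∫ x, ∑ i, a x i * thirdOrderOp g c u b x i

/-- Smooth compactly supported covector-valued functions. -/
def IsTest {ι : Type} [Fintype ι] (a : ℝ → ι → ℝ) : Prop :=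
  ContDiff ℝ ∞ a ∧ HasCompactSupport a

/-- The operator with coefficients `g`, `c` is Hamiltonian over `U`: its bracket is
skew-symmetric and satisfies the Jacobi identity. In the latter `{{a, b}, d}` is the derivative
of `{a, b}` along the field `A d`. For nonlinear functionals the second variations cancel
by skew-symmetry, so that the Jacobi identity depends only on the values `a`, `b`, `d` of the
variational derivatives: it is the vanishing, on arbitrary test covectors, of the Schouten
bracket of the operator with itself. -/
def IsHamiltonianOp {ι : Type} [Fintype ι] (U : Set (ι → ℝ)) (g : (ι → ℝ) → Matrix ι ι ℝ)
    (c : (ι → ℝ) → ι → ι → ι → ℝ) : Prop :=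
  ∀ u : ℝ → ι → ℝ, ContDiff ℝ ∞ u → (∀ x, u x ∈ U) →
    (∀ a b, IsTest a → IsTest b → bracket g c a b u = - bracket g c b a u) ∧
    ∀ a b d, IsTest a → IsTest b → IsTest d → ∃ j₁ j₂ j₃ : ℝ,
      HasDerivAt (fun ε : ℝ => bracket g c a b (fun x => u x + ε • thirdOrderOp g c u d x)) j₁ 0 ∧
      HasDerivAt (fun ε : ℝ => bracket g c b d (fun x => u x + ε • thirdOrderOp g c u a x)) j₂ 0 ∧
      HasDerivAt (fun ε : ℝ => bracket g c d a (fun x => u x + ε • thirdOrderOp g c u b x)) j₃ 0 ∧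
      j₁ + j₂ + j₃ = 0

/-- The variational derivative `δH/δbⁱ` at `b` of `H = ∫ h(x, b, b_x) dx`. -/
def varDeriv {ι : Type} [Fintype ι] [DecidableEq ι] (h : ℝ × (ι → ℝ) × (ι → ℝ) → ℝ)
    (b : ℝ → ι → ℝ) (x : ℝ) (i : ι) : ℝ :=
  fderiv ℝ h (x, b x, deriv b x) (0, Pi.single i 1, 0) -
    deriv (fun y => fderiv ℝ h (y, b y, deriv b y) (0, 0, Pi.single i 1)) x

/-- The system `u^i_t = (V^i(u))_x` has the form `u^i_t = A^{ij} δH/δu^j`. The functional `H` is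
allowed to be nonlocal in `u`: it has a density `h(x, b, b_x)` in the potentials `b`, `u = b_x`,
so that `w = δH/δu` is determined by `D_x w = -δH/δb`. -/
def IsHamiltonianSystem {ι : Type} [Fintype ι] [DecidableEq ι] (U : Set (ι → ℝ))
    (g : (ι → ℝ) → Matrix ι ι ℝ) (c : (ι → ℝ) → ι → ι → ι → ℝ)
    (V : ι → (ι → ℝ) → ℝ) : Prop :=
  ∃ h : ℝ × (ι → ℝ) × (ι → ℝ) → ℝ, ContDiff ℝ ∞ h ∧
    ∀ b : ℝ → ι → ℝ, ContDiff ℝ ∞ b → (∀ x, deriv b x ∈ U) →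
      ∀ w : ℝ → ι → ℝ, (∀ x i, HasDerivAt (fun y => w y i) (- varDeriv h b x i) x) →
        ∀ x i, deriv (fun y => V i (deriv b y)) x = thirdOrderOp g c (deriv b) w x i

/-! ### Functions -/

/-- The partial derivative with respect to the `i`-th variable. -/
def pd {r : ℕ} (i : Fin r) (f : (Fin r → ℝ) → ℝ) (t : Fin r → ℝ) : ℝ :=
  fderiv ℝ f t (Pi.single i 1)

/-- The third derivatives of `f` at `t` (for a `C³` function the order of the
differentiations does not matter). -/
def jet3 {r : ℕ} (f : (Fin r → ℝ) → ℝ) (t : Fin r → ℝ) : Jet r 3 :=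
  fun τ => (τ : Multiset (Fin r)).toList.foldr pd f t

end WDVV

end

open scoped ContDiff

noncomputable section

namespace WDVV

/-! ### Multiplication operators -/

variable {r : ℕ}

/-! Put C_γ = η⁻¹F_γ, where F_γ = (F_{γαβ}). Then S_{αβγν} is the (β,ν) entry of η[C_α, C_γ], so
WDVV says that the C_γ commute. Moreover C_1 = 1, each C_γ is self-adjoint for η, and C_γ e₀ = e_γ.
The linear subsystem says that all C_m commute with L = C_p, and L depends on u only.

If e₀ is cyclic for L, an operator commuting with L is determined by its value on e₀
(`eq_zero_of_commute_cyclic`). So C_m must be the polynomial in L that maps e₀ to e_m. Polynomials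
in L are self-adjoint and commute with one another, which gives a symmetric tensor and the full WDVV
system at once. The denominator Q is the determinant of the Krylov matrix (e₀, Le₀, L²e₀, …). If it
vanishes, a complex left eigenvector ξ of L annihilates the Krylov space, and adding the real or
imaginary part of the cubic form (ξ·t)³ to f breaks uniqueness (`mem_regularLocus_iff`). Finally Q ≠
0 as a polynomial, because e₀, e_p extend to a basis whose η-Gram matrix is Hankel; the operator
shifting this basis is an admissible cyclic L.

Write E u for the part of L linear in u. The operators E x kill e₀, so over U the map x ↦ [E x, L]
is injective. Hence an identity between derivatives of the fluxes may be checked after taking the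
commutator with L, where it follows from the differentiated relations [C_a, C_b] = 0. This gives
commuting Jacobians of the fluxes (`lineDeriv_flux_comm`), therefore commuting evolutionary fields
and passivity, and the same argument on the first prolongation gives the equivalence with the
first-order systems.

By a dimension count x ↦ [E x, L] maps onto the skew-adjoint operators, on which the trace form is
nondegenerate, so g_{ij} = tr([E_i, L][E_j, L]) is a nondegenerate covariant metric. For a covector
w let ζ = g⁻¹w_x and X_w = [Eζ, L]; here g⁻¹ is the contravariant metric. The coefficients c are
such that ξ = (g⁻¹D_x + cu_x)w_x satisfies [Eξ, L] = D_x X_w (`lie_midCurve`). The bracket density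
of a and b is then, up to total derivatives, −tr(X_a D_x X_b), which gives skew symmetry; the Jacobi
identity of the bracket reduces to that of the commutator under the trace. With M = xL₀ + E b, so
that M_x = L, and C the constant part of C_l, the cubic Hamiltonian tr([M, L][C, M])/3 gives X_w =
−[C, M]; hence [Eξ, L] = −[C, L]. That is the relation [C_l, L] = 0 for the flux V_l. -/

/-- The matrix with vanishing zeroth row and column whose other entries are `u_{ij}`. -/
def symMat {R : Type*} [Zero R] (u : Sym (Fin r) 2 → R) : Matrix (Fin (r + 1)) (Fin (r + 1)) R :=
  fun α β => Fin.cases 0 (fun i => Fin.cases 0 (fun j => u (i ::ₛ j ::ₛ Sym.nil)) β) α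

section symMat

variable {R : Type*} [Zero R] (u : Sym (Fin r) 2 → R)

@[simp] theorem symMat_zero_left (β : Fin (r + 1)) : symMat u 0 β = 0 := rfl

@[simp] theorem symMat_zero_right (α : Fin (r + 1)) : symMat u α 0 = 0 := by
  cases α using Fin.cases <;> rfl

@[simp] theorem symMat_succ (i j : Fin r) :
    symMat u i.succ j.succ = u (i ::ₛ j ::ₛ Sym.nil) := rfl

theorem symMat_comm (α β : Fin (r + 1)) : symMat u α β = symMat u β α := by
  cases α using Fin.cases <;> cases β using Fin.cases <;> simp
  rw [Sym.cons_swap]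

theorem transpose_symMat : (symMat u).transpose = symMat u := by
  ext α β
  exact symMat_comm u β α

end symMat

/-- The symmetric operator-valued linear coordinate `u ↦ η⁻¹ u`. -/
def symOp (η : Matrix (Fin (r + 1)) (Fin (r + 1)) ℝ) :
    Jet r 2 →ₗ[ℝ] Matrix (Fin (r + 1)) (Fin (r + 1)) ℝ where
  toFun u := η⁻¹ * symMat u
  map_add' u v := by
    rw [← mul_add]
    congr 1
    ext α β
    cases α using Fin.cases <;> cases β using Fin.cases <;> simp
  map_smul' a u := by
    rw [RingHom.id_apply, ← mul_smul_comm]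
    congr 1
    ext α β
    cases α using Fin.cases <;> cases β using Fin.cases <;> simp

variable (η : Matrix (Fin (r + 1)) (Fin (r + 1)) ℝ)

theorem symOp_apply (u : Jet r 2) : symOp η u = η⁻¹ * symMat u := rfl

/-- The part of `F_l = (F_{lαβ})` which is prescribed by `η`. -/
def baseMat (l : Fin r) : Matrix (Fin (r + 1)) (Fin (r + 1)) ℝ :=
  Matrix.of (thirdDeriv η 0 l.succ)

/-- The operator `C_γ = η⁻¹ F_γ` of multiplication by the `γ`-th basis vector. -/
def mulOp (f : Jet r 3) (γ : Fin (r + 1)) : Matrix (Fin (r + 1)) (Fin (r + 1)) ℝ :=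
  η⁻¹ * Matrix.of (thirdDeriv η f γ)

/-- The operator of multiplication by the `l`-th basis vector as a function of `f_{lI}`. -/
def sliceOp (l : Fin r) (u : Jet r 2) : Matrix (Fin (r + 1)) (Fin (r + 1)) ℝ :=
  η⁻¹ * baseMat η l + symOp η u

theorem thirdDeriv_succ (f : Jet r 3) (l : Fin r) :
    Matrix.of (thirdDeriv η f l.succ) = baseMat η l + symMat (param l f) := by
  ext α β
  cases α using Fin.cases <;> cases β using Fin.cases <;> simp [baseMat, thirdDeriv, param]

theorem mulOp_succ (f : Jet r 3) (l : Fin r) :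
    mulOp η f l.succ = sliceOp η l (param l f) := by
  rw [mulOp, thirdDeriv_succ, mul_add]
  rfl

/-! ### WDVV as commutativity of the multiplication operators -/

variable {η}

theorem eta_comm (hsymm : η.IsSymm) (α β : Fin (r + 1)) : η α β = η β α := hsymm.apply β α

theorem thirdDeriv_swap (hsymm : η.IsSymm) (f : Jet r 3) (α β γ : Fin (r + 1)) :
    thirdDeriv η f α β γ = thirdDeriv η f β α γ := by
  cases α using Fin.cases <;> cases β using Fin.cases <;> cases γ using Fin.cases <;>
    simp only [thirdDeriv, Fin.cases_zero, Fin.cases_succ]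
  · exact eta_comm hsymm _ _
  · rw [Sym.cons_swap]

theorem thirdDeriv_swap_right (hsymm : η.IsSymm) (f : Jet r 3) (α β γ : Fin (r + 1)) :
    thirdDeriv η f α β γ = thirdDeriv η f α γ β := by
  cases α using Fin.cases <;> cases β using Fin.cases <;> cases γ using Fin.cases <;>
    simp only [thirdDeriv, Fin.cases_zero, Fin.cases_succ]
  all_goals first | exact eta_comm hsymm _ _ | skip
  rw [Sym.cons_swap _ _ Sym.nil]

theorem transpose_thirdDeriv (hsymm : η.IsSymm) (f : Jet r 3) (γ : Fin (r + 1)) :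
    (Matrix.of (thirdDeriv η f γ)).transpose = Matrix.of (thirdDeriv η f γ) := by
  ext α β
  exact thirdDeriv_swap_right hsymm f γ β α

theorem inv_symm (hsymm : η.IsSymm) : η⁻¹.transpose = η⁻¹ := by
  rw [Matrix.transpose_nonsing_inv, hsymm.eq]

theorem S_eq (hsymm : η.IsSymm) (f : Jet r 3) (α β γ ν : Fin (r + 1)) :
    S η f α β γ ν =
      (Matrix.of (thirdDeriv η f α) * η⁻¹ * Matrix.of (thirdDeriv η f γ) -
        Matrix.of (thirdDeriv η f γ) * η⁻¹ * Matrix.of (thirdDeriv η f α)) β ν := by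
  have h : ∀ l m, η⁻¹ l m = η⁻¹ m l := fun l m => congrFun₂ (inv_symm hsymm) m l
  simp only [S, mul_sub, Finset.sum_sub_distrib, Matrix.sub_apply, Matrix.mul_apply,
    Matrix.of_apply, Finset.sum_mul]
  congr 1
  · rw [Finset.sum_comm]
    refine Finset.sum_congr rfl fun l _ => Finset.sum_congr rfl fun m _ => ?_
    rw [thirdDeriv_swap hsymm f m α β, thirdDeriv_swap_right hsymm f α m β,
      thirdDeriv_swap hsymm f l γ ν]
    ring
  · refine Finset.sum_congr rfl fun l _ => Finset.sum_congr rfl fun m _ => ?_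
    rw [thirdDeriv_swap hsymm f l α ν, thirdDeriv_swap hsymm f m γ β,
      thirdDeriv_swap_right hsymm f γ m β, h l m]
    ring

theorem eta_mul_inv (hdet : η.det ≠ 0) : η * η⁻¹ = 1 :=
  Matrix.mul_nonsing_inv _ (isUnit_iff_ne_zero.2 hdet)

theorem eta_inv_mul (hdet : η.det ≠ 0) : η⁻¹ * η = 1 :=
  Matrix.nonsing_inv_mul _ (isUnit_iff_ne_zero.2 hdet)

theorem eta_mul_mulOp (hdet : η.det ≠ 0) (f : Jet r 3) (γ : Fin (r + 1)) :
    η * mulOp η f γ = Matrix.of (thirdDeriv η f γ) := by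
  rw [mulOp, ← mul_assoc, eta_mul_inv hdet, one_mul]

theorem S_eq_lie (hsymm : η.IsSymm) (hdet : η.det ≠ 0) (f : Jet r 3) (α β γ ν : Fin (r + 1)) :
    S η f α β γ ν = (η * ⁅mulOp η f α, mulOp η f γ⁆) β ν := by
  rw [S_eq hsymm, Ring.lie_def, mul_sub, ← mul_assoc, ← mul_assoc, eta_mul_mulOp hdet,
    eta_mul_mulOp hdet, mulOp, mulOp, mul_assoc, mul_assoc]

theorem mulOp_zero (hdet : η.det ≠ 0) (f : Jet r 3) : mulOp η f 0 = 1 := by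
  rw [mulOp]
  exact eta_inv_mul hdet

/-- The first basis vector is the unit: F_{γβ1} = η_{γβ} gives C_γ e₀ = e_γ. This normalisation
fixes each operator once it is known to commute with a cyclic one. -/
theorem mulOp_apply_zero (hsymm : η.IsSymm) (hdet : η.det ≠ 0) (f : Jet r 3) (γ α : Fin (r + 1)) :
    mulOp η f γ α 0 = (1 : Matrix _ _ ℝ) α γ := by
  rw [← eta_inv_mul hdet, mulOp, Matrix.mul_apply, Matrix.mul_apply]
  refine Finset.sum_congr rfl fun β _ => ?_
  rw [Matrix.of_apply, thirdDeriv_swap_right hsymm, thirdDeriv_swap hsymm, eta_comm hsymm β γ]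
  rfl

theorem eta_mul_cancel (hdet : η.det ≠ 0) {A B : Matrix (Fin (r + 1)) (Fin (r + 1)) ℝ}
    (h : η * A = η * B) :
    A = B := by
  rw [← one_mul A, ← eta_inv_mul hdet, mul_assoc, h, ← mul_assoc,
    eta_inv_mul hdet, one_mul]

theorem isWDVV_iff (hsymm : η.IsSymm) (hdet : η.det ≠ 0) (f : Jet r 3) :
    IsWDVV η f ↔ ∀ α γ, ⁅mulOp η f α, mulOp η f γ⁆ = 0 := by
  refine ⟨fun h α γ => eta_mul_cancel hdet ?_, fun h α β γ ν => ?_⟩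
  · ext β ν
    rw [← S_eq_lie hsymm hdet, h, mul_zero, Matrix.zero_apply]
  · rw [S_eq_lie hsymm hdet, h, mul_zero, Matrix.zero_apply]

/-- Row 0 of F_α η⁻¹ is the α-th unit row, so row 0 of η C_α C_γ consists of the F_{αγν}, which are
symmetric in α and γ. -/
theorem S_zero_left (hsymm : η.IsSymm) (hdet : η.det ≠ 0) (f : Jet r 3) (α γ ν : Fin (r + 1)) :
    S η f α 0 γ ν = 0 := by
  have h : ∀ α γ, (η * (mulOp η f α * mulOp η f γ)) 0 ν = thirdDeriv η f α γ ν := by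
    intro α γ
    rw [← mul_assoc, eta_mul_mulOp hdet, mulOp, ← mul_assoc]
    have : ∀ β, (Matrix.of (thirdDeriv η f α) * η⁻¹) 0 β = (1 : Matrix _ _ ℝ) α β := by
      intro β
      rw [← eta_mul_inv hdet, Matrix.mul_apply, Matrix.mul_apply]
      refine Finset.sum_congr rfl fun δ _ => ?_
      rw [Matrix.of_apply, thirdDeriv_swap hsymm]
      rfl
    rw [Matrix.mul_apply]
    simp only [this, Matrix.one_apply, ite_mul, one_mul, zero_mul, Finset.sum_ite_eq,
      Finset.mem_univ, if_true, Matrix.of_apply]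
    exact thirdDeriv_swap hsymm f γ α ν
  rw [S_eq_lie hsymm hdet, Ring.lie_def, mul_sub, Matrix.sub_apply, h, h,
    thirdDeriv_swap hsymm, sub_self]

theorem S_swap (f : Jet r 3) (α β γ ν : Fin (r + 1)) : S η f α ν γ β = - S η f α β γ ν := by
  simp only [S, ← Finset.sum_neg_distrib, ← mul_neg, neg_sub]

/-- The components omitted from the subsystem carry no information: row and column 0 vanish by
`S_zero_left`, skewness in β, ν covers a ≥ b, and μ = p is the commutator of C_p with itself. -/
theorem isLinearWDVV_iff (hsymm : η.IsSymm) (hdet : η.det ≠ 0) (p : Fin r) (f : Jet r 3) :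
    IsLinearWDVV η p f ↔ ∀ m : Fin r, ⁅mulOp η f p.succ, mulOp η f m.succ⁆ = 0 := by
  refine ⟨fun h m => eta_mul_cancel hdet ?_, fun h m a b _ _ => ?_⟩
  · by_cases hm : m = p
    · rw [hm, Ring.lie_def, sub_self]
    · ext β ν
      rw [← S_eq_lie hsymm hdet, mul_zero, Matrix.zero_apply]
      cases β using Fin.cases with
      | zero => exact S_zero_left hsymm hdet f _ _ _
      | succ a =>
        cases ν using Fin.cases with
        | zero => rw [S_swap, S_zero_left hsymm hdet, neg_zero]
        | succ b =>
          rcases lt_trichotomy a b with hab | rfl | hab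
          · exact h m a b hm hab
          · have := S_swap (η := η) f p.succ a.succ m.succ a.succ
            linarith
          · rw [S_swap, h m b a hm hab, neg_zero]
  · rw [S_eq_lie hsymm hdet, h, mul_zero, Matrix.zero_apply]

end WDVV

namespace WDVV

/-! ### Cyclic operators and the solution of the linear subsystem -/

variable {r : ℕ}

/-- The matrix with columns `e₀, L e₀, L² e₀, …`. -/
def krylov {R : Type*} [CommRing R] (L : Matrix (Fin (r + 1)) (Fin (r + 1)) R) :
    Matrix (Fin (r + 1)) (Fin (r + 1)) R :=
  Matrix.of fun α k => (L ^ (k : ℕ)) α 0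

/-- An operator commuting with a cyclic operator is determined by its value on the cyclic
vector. -/
theorem eq_zero_of_commute_cyclic {L A : Matrix (Fin (r + 1)) (Fin (r + 1)) ℝ}
    (hL : (krylov L).det ≠ 0) (hA : Commute A L) (h0 : ∀ α, A α 0 = 0) : A = 0 := by
  have hAK : A * krylov L = 0 := by
    ext α k
    have : (A * krylov L) α k = (A * L ^ (k : ℕ)) α 0 := by
      simp [Matrix.mul_apply, krylov]
    rw [this, (hA.pow_right k).eq, Matrix.mul_apply]
    simp [h0]
  rw [← mul_one A, ← Matrix.mul_nonsing_inv _ (isUnit_iff_ne_zero.2 hL), ← mul_assoc, hAK,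
    zero_mul]

/-- The polynomial in `L` which maps the cyclic vector to the `i`-th basis vector, times the
determinant of the Krylov matrix. -/
def cyclicOp {R : Type*} [CommRing R] (L : Matrix (Fin (r + 1)) (Fin (r + 1)) R)
    (i : Fin (r + 1)) : Matrix (Fin (r + 1)) (Fin (r + 1)) R :=
  ∑ k : Fin (r + 1), (krylov L).adjugate k i • L ^ (k : ℕ)

theorem commute_cyclicOp (L : Matrix (Fin (r + 1)) (Fin (r + 1)) ℝ) (i : Fin (r + 1)) :
    Commute (cyclicOp L i) L :=
  Commute.sum_left _ _ _ fun k _ => ((Commute.refl L).pow_left k).smul_left _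

theorem commute_cyclicOp_cyclicOp (L : Matrix (Fin (r + 1)) (Fin (r + 1)) ℝ)
    (i j : Fin (r + 1)) : Commute (cyclicOp L i) (cyclicOp L j) :=
  Commute.sum_right _ _ _ fun k _ => ((commute_cyclicOp L i).pow_right k).smul_right _

/-- This is K adj(K) = det K for the Krylov matrix K. Using the adjugate rather than the inverse
keeps everything polynomial in the entries of L. -/
theorem cyclicOp_apply_zero (L : Matrix (Fin (r + 1)) (Fin (r + 1)) ℝ) (i α : Fin (r + 1)) :
    cyclicOp L i α 0 = (krylov L).det * (1 : Matrix _ _ ℝ) α i := by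
  have h : cyclicOp L i α 0 = (krylov L * (krylov L).adjugate) α i := by
    simp [cyclicOp, Matrix.mul_apply, Matrix.sum_apply, krylov, mul_comm]
  rw [h, Matrix.mul_adjugate, Matrix.smul_apply, smul_eq_mul]

variable {η : Matrix (Fin (r + 1)) (Fin (r + 1)) ℝ}

/-- The hypothesis says that L is self-adjoint for η; the property passes to polynomials in L and
yields one symmetry of `cyclicTensor`. -/
theorem transpose_mul_pow {L : Matrix (Fin (r + 1)) (Fin (r + 1)) ℝ}
    (hL : L.transpose * η = η * L) (k : ℕ) : (L ^ k).transpose * η = η * L ^ k := by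
  induction k with
  | zero => simp
  | succ k ih =>
    rw [pow_succ, Matrix.transpose_mul, mul_assoc, ih, ← mul_assoc, hL, mul_assoc, ← pow_succ',
      ← pow_succ]

theorem transpose_cyclicOp {L : Matrix (Fin (r + 1)) (Fin (r + 1)) ℝ}
    (hL : L.transpose * η = η * L) (i : Fin (r + 1)) :
    (cyclicOp L i).transpose * η = η * cyclicOp L i := by
  simp only [cyclicOp, Matrix.transpose_sum, Finset.sum_mul, Finset.mul_sum,
    Matrix.transpose_smul, smul_mul_assoc, mul_smul_comm, transpose_mul_pow hL]

/-- The structure constants `⟨e_α ∘ e_β, e_γ⟩` of the algebra generated by a cyclic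
operator, times the determinant of the Krylov matrix. -/
def cyclicTensor (η L : Matrix (Fin (r + 1)) (Fin (r + 1)) ℝ) (α β γ : Fin (r + 1)) : ℝ :=
  (η * cyclicOp L α) β γ

theorem cyclicTensor_swap_right (hsymm : η.IsSymm)
    {L : Matrix (Fin (r + 1)) (Fin (r + 1)) ℝ} (hL : L.transpose * η = η * L)
    (α β γ : Fin (r + 1)) : cyclicTensor η L α β γ = cyclicTensor η L α γ β := by
  have h := transpose_cyclicOp hL α
  rw [cyclicTensor, cyclicTensor, ← h, ← Matrix.transpose_apply ((cyclicOp L α).transpose * η),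
    Matrix.transpose_mul, Matrix.transpose_transpose, hsymm.eq, h]

/-- Since `cyclicOp L β` sends e₀ to a multiple of e_β, applying `cyclicOp L α` to e_β is, up to the
determinant, applying a product of two polynomials in L to e₀. That product is commutative. -/
theorem cyclicTensor_swap_outer (L : Matrix (Fin (r + 1)) (Fin (r + 1)) ℝ)
    (hL : (krylov L).det ≠ 0) (α β γ : Fin (r + 1)) :
    cyclicTensor η L α γ β = cyclicTensor η L β γ α := by
  have h : ∀ α β δ, (krylov L).det * cyclicOp L α δ β = (cyclicOp L α * cyclicOp L β) δ 0 := by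
    intro α β δ
    simp [Matrix.mul_apply, cyclicOp_apply_zero, Matrix.one_apply, mul_comm]
  rw [cyclicTensor, cyclicTensor, Matrix.mul_apply, Matrix.mul_apply]
  refine Finset.sum_congr rfl fun δ _ => ?_
  congr 1
  refine mul_left_cancel₀ hL ?_
  rw [h, h, (commute_cyclicOp_cyclicOp L α β).eq]

/-! ### Unordered multi-indices and the solution jet -/

/-- The transpositions (12) and (23) generate S₃, so a function invariant under both depends only on
the unordered triple. -/
theorem eq_of_cons_eq {X : Type*} (t : Fin r → Fin r → Fin r → X)
    (h₁ : ∀ i j k, t i j k = t j i k) (h₂ : ∀ i j k, t i j k = t i k j)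
    {i j k i' j' k' : Fin r}
    (h : (i ::ₛ j ::ₛ k ::ₛ Sym.nil : Sym (Fin r) 3) = i' ::ₛ j' ::ₛ k' ::ₛ Sym.nil) :
    t i j k = t i' j' k' := by
  have h' : [i, j, k].Perm [i', j', k'] := by
    have := congrArg (fun s : Sym (Fin r) 3 => (s : Multiset (Fin r))) h
    exact Multiset.coe_eq_coe.1 this
  have pair : ∀ {i j k j' k' : Fin r}, [j, k].Perm [j', k'] → t i j k = t i j' k' := by
    intro i j k j' k' hp
    rcases List.perm_pair.1 hp with h | h
    · simp only [List.cons.injEq, and_true] at h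
      rw [h.1, h.2]
    · simp only [List.cons.injEq, and_true] at h
      rw [h.1, h.2, h₂]
  have hi : i' ∈ [i, j, k] := h'.mem_iff.2 (by simp)
  simp only [List.mem_cons, List.not_mem_nil, or_false] at hi
  rcases hi with rfl | rfl | rfl
  · exact pair ((List.perm_cons _).1 h')
  · rw [h₁]
    exact pair ((List.perm_cons _).1 ((List.Perm.swap _ _ _).trans h'))
  · rw [h₂, h₁]
    have hs := ((List.Perm.swap _ _ _).trans ((List.Perm.swap _ _ _).cons _)).trans h'
    exact pair ((List.perm_cons _).1 hs)

/-- Every third-order multi-index is an unordered triple. -/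
theorem exists_eq_triple (τ : Sym (Fin r) 3) :
    ∃ i j k, τ = i ::ₛ j ::ₛ k ::ₛ Sym.nil := by
  obtain ⟨i, τ', rfl⟩ := τ.exists_eq_cons_of_succ
  obtain ⟨j, τ'', rfl⟩ := τ'.exists_eq_cons_of_succ
  obtain ⟨k, τ''', rfl⟩ := τ''.exists_eq_cons_of_succ
  exact ⟨i, j, k, by rw [Sym.eq_nil_of_card_zero τ''']⟩

theorem exists_eq_pair (I : Sym (Fin r) 2) : ∃ i j, I = i ::ₛ j ::ₛ Sym.nil := by
  obtain ⟨i, J, rfl⟩ := I.exists_eq_cons_of_succ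
  obtain ⟨j, K, rfl⟩ := J.exists_eq_cons_of_succ
  exact ⟨i, j, by rw [Sym.eq_nil_of_card_zero K]⟩

/-- The numerators of the solution of the linear subsystem. -/
def solNum (η L : Matrix (Fin (r + 1)) (Fin (r + 1)) ℝ) (τ : Sym (Fin r) 3) : ℝ :=
  cyclicTensor η L (exists_eq_triple τ).choose.succ
    (exists_eq_triple τ).choose_spec.choose.succ
    (exists_eq_triple τ).choose_spec.choose_spec.choose.succ

/-- `solNum` reads the tensor at an arbitrarily chosen ordering of the multi-index; total symmetry
makes the choice immaterial. -/
theorem solNum_cons (hsymm : η.IsSymm) {L : Matrix (Fin (r + 1)) (Fin (r + 1)) ℝ}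
    (hL : L.transpose * η = η * L) (hK : (krylov L).det ≠ 0) (i j k : Fin r) :
    solNum η L (i ::ₛ j ::ₛ k ::ₛ Sym.nil) = cyclicTensor η L i.succ j.succ k.succ := by
  refine eq_of_cons_eq (fun i j k => cyclicTensor η L i.succ j.succ k.succ) ?_ ?_
    (exists_eq_triple _).choose_spec.choose_spec.choose_spec.symm
  · intro i j k
    rw [cyclicTensor_swap_right hsymm hL, cyclicTensor_swap_outer L hK,
      cyclicTensor_swap_right hsymm hL]
  · intro i j k
    exact cyclicTensor_swap_right hsymm hL _ _ _

/-- The unique solution of the linear subsystem. -/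
def solJet (η L : Matrix (Fin (r + 1)) (Fin (r + 1)) ℝ) : Jet r 3 :=
  fun τ => solNum η L τ / (krylov L).det

/-- Only entries with all indices positive come from the jet. Entries with an index 0 must reproduce
the values prescribed by η: column 0 does so because the normalised polynomial maps e₀ to e_l, and
row 0 follows by symmetry. -/
theorem mulOp_solJet (hsymm : η.IsSymm) (hdet : η.det ≠ 0)
    {L : Matrix (Fin (r + 1)) (Fin (r + 1)) ℝ}
    (hL : L.transpose * η = η * L) (hK : (krylov L).det ≠ 0) (l : Fin r) :
    mulOp η (solJet η L) l.succ = (krylov L).det⁻¹ • cyclicOp L l.succ := by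
  refine eta_mul_cancel hdet ?_
  have h0 : ∀ γ, ((krylov L).det⁻¹ • (η * cyclicOp L l.succ)) γ 0 = η l.succ γ := by
    intro γ
    simp [Matrix.mul_apply, cyclicOp_apply_zero, Matrix.one_apply, eta_comm hsymm γ]
    field_simp
  rw [eta_mul_mulOp hdet, mul_smul_comm]
  ext β γ
  cases γ using Fin.cases with
  | zero =>
    rw [h0]
    cases β using Fin.cases with
    | zero => rfl
    | succ j => rfl
  | succ k =>
    cases β using Fin.cases with
    | zero =>
      have := cyclicTensor_swap_right hsymm hL l.succ 0 k.succ
      have h := h0 k.succ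
      rw [Matrix.smul_apply] at h ⊢
      rw [cyclicTensor, cyclicTensor] at this
      rw [this, h]
      rfl
    | succ j =>
      change solNum η L (l ::ₛ j ::ₛ k ::ₛ Sym.nil) / _ = _
      rw [solNum_cons hsymm hL hK, Matrix.smul_apply, smul_eq_mul, div_eq_inv_mul]
      rfl

theorem transpose_mulOp (hsymm : η.IsSymm) (hdet : η.det ≠ 0) (f : Jet r 3)
    (γ : Fin (r + 1)) : (mulOp η f γ).transpose * η = η * mulOp η f γ := by
  have h := transpose_thirdDeriv hsymm f γ
  rw [← eta_mul_mulOp hdet, Matrix.transpose_mul, hsymm.eq] at h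
  exact h

theorem jet_ext {f f' : Jet r 3}
    (h : ∀ i j k, f (i ::ₛ j ::ₛ k ::ₛ Sym.nil) = f' (i ::ₛ j ::ₛ k ::ₛ Sym.nil)) : f = f' := by
  funext τ
  obtain ⟨i, j, k, rfl⟩ := exists_eq_triple τ
  exact h i j k

theorem jet_ext_of_mulOp (hdet : η.det ≠ 0) {f f' : Jet r 3}
    (h : ∀ l : Fin r, mulOp η f l.succ = mulOp η f' l.succ) : f = f' := by
  refine jet_ext fun i j k => ?_
  have h' : η * mulOp η f i.succ = η * mulOp η f' i.succ := by rw [h]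
  rw [eta_mul_mulOp hdet, eta_mul_mulOp hdet] at h'
  exact congrFun₂ h' j.succ k.succ

theorem eq_of_sliceOp_eq (hdet : η.det ≠ 0) {l : Fin r} {u v : Jet r 2}
    (h : sliceOp η l u = sliceOp η l v) : u = v := by
  have h' : symMat u = symMat v := by
    have := add_left_cancel h
    rw [symOp_apply, symOp_apply] at this
    have := congrArg (η * ·) this
    simpa only [← mul_assoc, eta_mul_inv hdet, one_mul] using this
  funext I
  obtain ⟨i, j, rfl⟩ := exists_eq_pair I
  exact congrFun₂ h' i.succ j.succ

/-- Where the operator of multiplication by the `p`-th vector is cyclic, the linear subsystem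
has a unique solution. -/
theorem isLinearWDVV_iff_eq_solJet (hsymm : η.IsSymm) (hdet : η.det ≠ 0) (p : Fin r)
    (f : Jet r 3) (hK : (krylov (sliceOp η p (param p f))).det ≠ 0) :
    IsLinearWDVV η p f ↔ f = solJet η (sliceOp η p (param p f)) := by
  have hL := transpose_mulOp hsymm hdet f p.succ
  rw [isLinearWDVV_iff hsymm hdet]
  rw [mulOp_succ η f p] at hL ⊢
  set L := sliceOp η p (param p f) with hLdef
  refine ⟨fun h => jet_ext_of_mulOp hdet fun l => ?_, fun h m => ?_⟩
  · rw [mulOp_solJet hsymm hdet hL hK, ← sub_eq_zero]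
    -- Both operators commute with L and send e₀ to e_l, so cyclicity makes them equal.
    refine eq_zero_of_commute_cyclic hK (Commute.sub_left ?_ ?_) fun α => ?_
    · exact (sub_eq_zero.1 (h l)).symm
    · exact (commute_cyclicOp L _).smul_left _
    · rw [Matrix.sub_apply, mulOp_apply_zero hsymm hdet, Matrix.smul_apply, cyclicOp_apply_zero,
        smul_eq_mul, inv_mul_cancel_left₀ hK, sub_self]
  · rw [h, mulOp_solJet hsymm hdet hL hK, Ring.lie_def, sub_eq_zero]
    exact ((commute_cyclicOp L _).smul_left _).symm.eq

/-- The p-th operator of the solution jet commutes with L and maps e₀ to e_p = L e₀, hence equals L.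
-/
theorem param_solJet (hsymm : η.IsSymm) (hdet : η.det ≠ 0) (p : Fin r) (u : Jet r 2)
    (hK : (krylov (sliceOp η p u)).det ≠ 0) : param p (solJet η (sliceOp η p u)) = u := by
  -- Any jet with parametric part u will do; it exhibits L as an operator C_p, with its
  -- self-adjointness and normalisation.
  obtain ⟨f, rfl⟩ : ∃ f, u = param p f := ⟨joinJet p u 0, by
    funext I
    simp [param, joinJet]⟩
  have hL := transpose_mulOp hsymm hdet f p.succ
  have h0 := mulOp_apply_zero hsymm hdet f p.succ
  rw [mulOp_succ η f p] at hL h0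
  set L := sliceOp η p (param p f) with hLdef
  refine eq_of_sliceOp_eq hdet (l := p) ?_
  rw [← mulOp_succ, mulOp_solJet hsymm hdet hL hK, ← hLdef, ← sub_eq_zero]
  refine eq_zero_of_commute_cyclic hK (Commute.sub_left ?_ (Commute.refl L)) fun α => ?_
  · exact (commute_cyclicOp L _).smul_left _
  · rw [Matrix.sub_apply, h0, Matrix.smul_apply, cyclicOp_apply_zero,
      smul_eq_mul, inv_mul_cancel_left₀ hK, sub_self]

/-- All C_γ are polynomials in the single operator L; hence the linear subsystem already forces the
quadratic equations. -/
theorem isWDVV_solJet (hsymm : η.IsSymm) (hdet : η.det ≠ 0) (p : Fin r) (u : Jet r 2)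
    (hK : (krylov (sliceOp η p u)).det ≠ 0) : IsWDVV η (solJet η (sliceOp η p u)) := by
  obtain ⟨f, rfl⟩ : ∃ f, u = param p f := ⟨joinJet p u 0, by
    funext I
    simp [param, joinJet]⟩
  have hL := transpose_mulOp hsymm hdet f p.succ
  rw [mulOp_succ η f p] at hL
  rw [isWDVV_iff hsymm hdet]
  intro α γ
  rw [Ring.lie_def, sub_eq_zero]
  cases α using Fin.cases with
  | zero => rw [mulOp_zero hdet, one_mul, mul_one]
  | succ i =>
    cases γ using Fin.cases with
    | zero => rw [mulOp_zero hdet, one_mul, mul_one]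
    | succ j =>
      rw [mulOp_solJet hsymm hdet hL hK, mulOp_solJet hsymm hdet hL hK]
      exact (((commute_cyclicOp_cyclicOp _ _ _).smul_left _).smul_right _).eq

end WDVV

namespace WDVV

/-! ### The polynomials -/

variable {r : ℕ}

/-- The operator of multiplication by the `p`-th basis vector with polynomial entries. -/
def polyOp (η : Matrix (Fin (r + 1)) (Fin (r + 1)) ℝ) (p : Fin r) :
    Matrix (Fin (r + 1)) (Fin (r + 1)) (MvPolynomial (Sym (Fin r) 2) ℝ) :=
  η⁻¹.map MvPolynomial.C * ((baseMat η p).map MvPolynomial.C + symMat MvPolynomial.X)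

/-- The common denominator of the solution of the linear subsystem. -/
def denom (η : Matrix (Fin (r + 1)) (Fin (r + 1)) ℝ) (p : Fin r) :
    MvPolynomial (Sym (Fin r) 2) ℝ :=
  (krylov (polyOp η p)).det

/-- The numerators of the solution of the linear subsystem, as polynomials. -/
def numer (η : Matrix (Fin (r + 1)) (Fin (r + 1)) ℝ) (p : Fin r) (τ : Sym (Fin r) 3) :
    MvPolynomial (Sym (Fin r) 2) ℝ :=
  (η.map MvPolynomial.C * cyclicOp (polyOp η p) (exists_eq_triple τ).choose.succ :
      Matrix (Fin (r + 1)) (Fin (r + 1)) (MvPolynomial (Sym (Fin r) 2) ℝ))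
    (exists_eq_triple τ).choose_spec.choose.succ
    (exists_eq_triple τ).choose_spec.choose_spec.choose.succ

variable (η : Matrix (Fin (r + 1)) (Fin (r + 1)) ℝ) (p : Fin r) (u : Jet r 2)

theorem map_krylov {R R' : Type*} [CommRing R] [CommRing R'] (φ : R →+* R')
    (L : Matrix (Fin (r + 1)) (Fin (r + 1)) R) : (krylov L).map φ = krylov (L.map φ) := by
  ext α k
  simp only [krylov, Matrix.map_apply, Matrix.of_apply, ← Matrix.map_pow]

theorem map_cyclicOp {R R' : Type*} [CommRing R] [CommRing R'] (φ : R →+* R')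
    (L : Matrix (Fin (r + 1)) (Fin (r + 1)) R) (i : Fin (r + 1)) :
    (cyclicOp L i).map φ = cyclicOp (L.map φ) i := by
  have h : ∀ k, φ ((krylov L).adjugate k i) = (krylov (L.map φ)).adjugate k i := by
    intro k
    rw [← map_krylov, ← RingHom.mapMatrix_apply, ← RingHom.map_adjugate]
    rfl
  ext α β
  simp [cyclicOp, Matrix.sum_apply, h, ← Matrix.map_pow]

theorem map_polyOp : (polyOp η p).map (MvPolynomial.eval u) = sliceOp η p u := by
  have h : (symMat (r := r) (MvPolynomial.X (R := ℝ))).map (MvPolynomial.eval u) = symMat u := by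
    ext α β
    cases α using Fin.cases <;> cases β using Fin.cases <;> simp
  have hC : ∀ A : Matrix (Fin (r + 1)) (Fin (r + 1)) ℝ,
      (A.map (MvPolynomial.C (σ := Sym (Fin r) 2))).map (MvPolynomial.eval u) = A := by
    intro A
    ext α β
    simp
  rw [polyOp, Matrix.map_mul, Matrix.map_add _ (map_add _), h, hC, hC, mul_add]
  rfl

theorem eval_denom : MvPolynomial.eval u (denom η p) = (krylov (sliceOp η p u)).det := by
  rw [denom, RingHom.map_det, RingHom.mapMatrix_apply, map_krylov, map_polyOp]

theorem eval_numer (τ : Sym (Fin r) 3) :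
    MvPolynomial.eval u (numer η p τ) = solNum η (sliceOp η p u) τ := by
  have h : ((η.map (MvPolynomial.C (σ := Sym (Fin r) 2))).map (MvPolynomial.eval u)) = η := by
    ext α β
    simp
  have key : ∀ α, (η.map (MvPolynomial.C (σ := Sym (Fin r) 2)) *
      cyclicOp (polyOp η p) α).map (MvPolynomial.eval u) = η * cyclicOp (sliceOp η p u) α := by
    intro α
    rw [Matrix.map_mul, h, map_cyclicOp, map_polyOp]
  exact congrFun₂ (key _) _ _

theorem solJet_eq_div (τ : Sym (Fin r) 3) :
    solJet η (sliceOp η p u) τ =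
      MvPolynomial.eval u (numer η p τ) / MvPolynomial.eval u (denom η p) := by
  rw [eval_numer, eval_denom, solJet]

/-! ### Failure of uniqueness where the operator is not cyclic -/

/-- A non-cyclic operator has a complex left eigenvector which annihilates the Krylov space. -/
theorem exists_left_eigenvector {L : Matrix (Fin (r + 1)) (Fin (r + 1)) ℝ}
    (hK : (krylov L).det = 0) :
    ∃ (ξ : Fin (r + 1) → ℂ) (c : ℂ), ξ ≠ 0 ∧
      Matrix.vecMul ξ (L.map Complex.ofRealHom) = c • ξ ∧
      ∀ k : ℕ, ∑ α, ξ α * ((L ^ k) α 0 : ℝ) = 0 := by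
  obtain ⟨v, hv0, hv⟩ := Matrix.exists_vecMul_eq_zero_iff.2 hK
  -- A left null vector of the Krylov matrix annihilates L^k e₀ for k ≤ r; Cayley–Hamilton extends
  -- this to all k.
  have hvk : ∀ k : ℕ, ∑ α, v α * (L ^ k) α 0 = 0 := by
    intro k
    rw [Matrix.pow_eq_aeval_mod_charpoly, Polynomial.aeval_eq_sum_range' (n := r + 1)]
    · simp only [Matrix.sum_apply, Finset.mul_sum, Matrix.smul_apply, smul_eq_mul]
      rw [Finset.sum_comm]
      refine Finset.sum_eq_zero fun j hj => ?_
      have := congrFun hv ⟨j, Finset.mem_range.1 hj⟩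
      simp only [Matrix.vecMul, dotProduct, krylov, Matrix.of_apply, Pi.zero_apply] at this
      rw [← mul_zero ((Polynomial.X ^ k %ₘ L.charpoly).coeff j), ← this, Finset.mul_sum]
      exact Finset.sum_congr rfl fun α _ => by ring
    · have h1 := L.charpoly_natDegree_eq_dim
      rw [Fintype.card_fin] at h1
      refine (Polynomial.natDegree_modByMonic_lt _ L.charpoly_monic ?_).trans_eq h1
      intro h
      rw [h, Polynomial.natDegree_one] at h1
      omega
  let A : Matrix (Fin (r + 1)) (Fin (r + 1)) ℂ := L.map Complex.ofRealHom
  have hA : ∀ k : ℕ, ∀ α β, (A ^ k) α β = ((L ^ k) α β : ℝ) := by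
    intro k α β
    rw [← Matrix.map_pow]
    rfl
  -- The complexified annihilator of the Krylov space is nonzero and invariant under the right
  -- action of L, so it contains an eigenvector.
  let W : Submodule ℂ (Fin (r + 1) → ℂ) :=
    { carrier := {ξ | ∀ k : ℕ, Matrix.vecMul ξ (A ^ k) 0 = 0}
      add_mem' := fun {a b} ha hb k => by
        rw [Matrix.add_vecMul, Pi.add_apply, ha k, hb k, add_zero]
      zero_mem' := fun k => by simp
      smul_mem' := fun c a ha k => by
        rw [Matrix.smul_vecMul, Pi.smul_apply, ha k, smul_zero] }
  have hWA : ∀ ξ ∈ W, A.vecMulLinear ξ ∈ W := by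
    intro ξ hξ k
    rw [Matrix.vecMulLinear_apply, Matrix.vecMul_vecMul, ← pow_succ']
    exact hξ (k + 1)
  have hvW : (fun α => (v α : ℂ)) ∈ W := by
    intro k
    simp only [Matrix.vecMul, dotProduct, hA]
    exact_mod_cast hvk k
  have : Nontrivial W := by
    refine ⟨⟨⟨_, hvW⟩, 0, fun h => hv0 ?_⟩⟩
    funext α
    have := congrFun (congrArg Subtype.val h) α
    simpa using this
  obtain ⟨c, hc⟩ := Module.End.exists_eigenvalue (A.vecMulLinear.restrict hWA)
  obtain ⟨ξ, hξ, hξ0⟩ := hc.exists_hasEigenvector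
  refine ⟨ξ, c, fun h => hξ0 (Subtype.ext h), ?_, fun k => ?_⟩
  · exact congrArg Subtype.val (Module.End.mem_eigenspace_iff.1 hξ)
  · have := ξ.2 k
    simpa only [Matrix.vecMul, dotProduct, hA] using this

theorem param_joinJet (u : Jet r 2) (g : principal p → ℝ) : param p (joinJet p u g) = u := by
  funext I
  simp [param, joinJet]

theorem joinJet_param (f : Jet r 3) : joinJet p (param p f) (fun τ => f τ) = f := by
  funext τ
  by_cases h : p ∈ τ
  · rw [joinJet, dif_pos h, param, Sym.cons_erase]
  · rw [joinJet, dif_neg h]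

variable {η}

theorem joinJet_solJet (hsymm : η.IsSymm) (hdet : η.det ≠ 0)
    (hK : (krylov (sliceOp η p u)).det ≠ 0) :
    joinJet p u (fun τ => solJet η (sliceOp η p u) τ) = solJet η (sliceOp η p u) := by
  have h := joinJet_param p (solJet η (sliceOp η p u))
  rwa [param_solJet hsymm hdet p u hK] at h

theorem mulOp_add (f d : Jet r 3) (l : Fin r) :
    mulOp η (f + d) l.succ = mulOp η f l.succ + symOp η (param l d) := by
  rw [mulOp_succ, mulOp_succ, sliceOp, sliceOp, add_assoc, ← map_add]
  rfl

/-- Self-adjointness reads Lη⁻¹ = η⁻¹Lᵀ, so Lη⁻¹D = η⁻¹(DL)ᵀ for symmetric D, and this is η⁻¹DL when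
DL is symmetric. -/
theorem commute_symOp (hdet : η.det ≠ 0) {L : Matrix (Fin (r + 1)) (Fin (r + 1)) ℝ}
    (hL : L.transpose * η = η * L) {d : Jet r 2}
    (h : (symMat d * L).transpose = symMat d * L) : Commute L (symOp η d) := by
  have hL' : L * η⁻¹ = η⁻¹ * L.transpose := by
    have := congrArg (fun A => η⁻¹ * A * η⁻¹) hL
    simp only [mul_assoc, eta_mul_inv hdet, mul_one] at this
    rw [this, ← mul_assoc, eta_inv_mul hdet, one_mul]
  rw [Matrix.transpose_mul, transpose_symMat] at h
  rw [Commute, SemiconjBy, symOp_apply, ← mul_assoc, hL', mul_assoc, h, mul_assoc]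

/-- In the degenerate case, let ξ be a left eigenvector of L annihilating the Krylov space. A real
or imaginary part of ξ_iξ_jξ_k is added to the given solution. This leaves the parametric
derivatives alone because ξ_p = 0, and it preserves the linear equations because ξ is an
eigenvector. Uniqueness then forces all ξ_i³ = 0. -/
theorem mem_regularLocus_iff (hsymm : η.IsSymm) (hdet : η.det ≠ 0) :
    u ∈ regularLocus η p ↔ (krylov (sliceOp η p u)).det ≠ 0 := by
  constructor
  · rintro ⟨g, hg, huniq⟩ hK
    simp only at hg huniq
    obtain ⟨ξ, c, hξ0, hξ, hξk⟩ := exists_left_eigenvector hK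
    have hfp : mulOp η (joinJet p u g) p.succ = sliceOp η p u := by
      rw [mulOp_succ, param_joinJet]
    have hL := transpose_mulOp hsymm hdet (joinJet p u g) p.succ
    have hL0 := mulOp_apply_zero hsymm hdet (joinJet p u g) p.succ
    rw [hfp] at hL hL0
    -- The annihilation conditions for k = 0 and k = 1 concern e₀ and L e₀ = e_p.
    have hz : ξ 0 = 0 := by
      have := hξk 0
      simpa [Matrix.one_apply, apply_ite Complex.ofReal] using this
    have hp : ξ p.succ = 0 := by
      have := hξk 1
      simpa [hL0, Matrix.one_apply, apply_ite Complex.ofReal] using this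
    -- A real-linear functional φ, later the real and the imaginary part, turns the complex cubic
    -- form into a real jet.
    have key : ∀ φ : ℂ →ₗ[ℝ] ℝ, ∀ i : Fin r, φ (ξ i.succ * ξ i.succ * ξ i.succ) = 0 := by
      intro φ i
      let d : Jet r 3 := fun τ => φ ((τ : Multiset (Fin r)).map fun j => ξ j.succ).prod
      have hd : ∀ I, d (p ::ₛ I) = 0 := by
        intro I
        change φ ((p ::ₘ (I : Multiset (Fin r))).map fun j => ξ j.succ).prod = 0
        simp [hp]
      have hcons : ∀ i j k, d (i ::ₛ j ::ₛ k ::ₛ Sym.nil) =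
          φ (ξ i.succ * (ξ j.succ * ξ k.succ)) := by
        intro i j k
        change φ ((i ::ₘ j ::ₘ k ::ₘ 0).map fun j => ξ j.succ).prod = _
        simp
      have hsum : joinJet p u g + d = joinJet p u (g + fun τ => d τ.1) := by
        funext τ
        by_cases h : p ∈ τ
        · have : d τ = 0 := by rw [← Sym.cons_erase h, hd]
          simp [joinJet, h, this]
        · simp [joinJet, h]
      have hlin : IsLinearWDVV η p (joinJet p u (g + fun τ => d τ.1)) := by
        rw [← hsum, isLinearWDVV_iff hsymm hdet]
        rw [isLinearWDVV_iff hsymm hdet] at hg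
        intro m
        have hpd : param p d = 0 := funext hd
        rw [mulOp_add, mulOp_add, hpd, map_zero, add_zero, Ring.lie_def, mul_add, add_mul]
        have h1 := hg m
        rw [Ring.lie_def, sub_eq_zero] at h1
        rw [h1, hfp, add_sub_add_left_eq_sub, sub_eq_zero]
        refine commute_symOp hdet hL ?_
        have hent : ∀ α β, symMat (param m d) α β = φ (ξ m.succ * ξ α * ξ β) := by
          intro α β
          cases α using Fin.cases <;> cases β using Fin.cases <;>
            simp [hz, param, hcons, mul_assoc]
        -- The eigenvector equation replaces multiplication by L with the scalar c, leaving an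
        -- expression symmetric in α and γ.
        have hDL : ∀ α γ, (symMat (param m d) * sliceOp η p u) α γ =
            φ (c * (ξ m.succ * ξ α * ξ γ)) := by
          intro α γ
          have h2 := congrFun hξ γ
          simp only [Matrix.vecMul, dotProduct, Matrix.map_apply, Pi.smul_apply,
            smul_eq_mul] at h2
          have h3 : c * (ξ m.succ * ξ α * ξ γ) =
              ∑ β, (sliceOp η p u β γ) • (ξ m.succ * ξ α * ξ β) := by
            rw [show c * (ξ m.succ * ξ α * ξ γ) = ξ m.succ * ξ α * (c * ξ γ) by ring, ← h2,
              Finset.mul_sum]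
            refine Finset.sum_congr rfl fun β _ => ?_
            rw [Complex.real_smul]
            simp only [Complex.ofRealHom_eq_coe]
            ring
          rw [h3, map_sum, Matrix.mul_apply]
          refine Finset.sum_congr rfl fun β _ => ?_
          rw [hent, map_smul, smul_eq_mul, mul_comm]
        ext α γ
        rw [Matrix.transpose_apply, hDL, hDL]
        congr 1
        ring
      have heq := (huniq _ hlin)
      have hdτ : ∀ τ : principal p, d τ = 0 := by
        intro τ
        have := congrFun heq τ
        simpa using this
      by_cases hip : i = p
      · rw [hip, hp]
        simp
      · have hmem : (i ::ₛ i ::ₛ i ::ₛ Sym.nil : Sym (Fin r) 3) ∈ principal p := by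
          simp [principal, Ne.symm hip]
        have := hdτ ⟨_, hmem⟩
        simpa [hcons, mul_assoc] using this
    apply hξ0
    funext α
    cases α using Fin.cases with
    | zero => exact hz
    | succ i =>
      have h : ξ i.succ * ξ i.succ * ξ i.succ = 0 :=
        Complex.ext (key Complex.reLm i) (key Complex.imLm i)
      simpa using h
  · intro hK
    refine ⟨fun τ => solJet η (sliceOp η p u) τ, ?_, fun g hg => ?_⟩
    · simp only [joinJet_solJet p u hsymm hdet hK]
      have h := isLinearWDVV_iff_eq_solJet hsymm hdet p (solJet η (sliceOp η p u))
      rw [param_solJet hsymm hdet p u hK] at h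
      exact (h hK).2 rfl
    · have h := isLinearWDVV_iff_eq_solJet hsymm hdet p (joinJet p u g)
      rw [param_joinJet] at h
      have h' := (h hK).1 hg
      funext τ
      rw [← h', joinJet, dif_neg τ.2]

end WDVV

namespace WDVV

/-! ### Cyclic operators exist -/

variable {r : ℕ}

theorem exists_jet_of_symm {X : Type*} (t : Fin r → Fin r → X) (ht : ∀ i j, t i j = t j i) :
    ∃ u : Sym (Fin r) 2 → X, ∀ i j, u (i ::ₛ j ::ₛ Sym.nil) = t i j := by
  refine ⟨fun I => t (exists_eq_pair I).choose (exists_eq_pair I).choose_spec.choose,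
    fun i j => ?_⟩
  have h := (exists_eq_pair (i ::ₛ j ::ₛ Sym.nil)).choose_spec.choose_spec
  set k := (exists_eq_pair (i ::ₛ j ::ₛ Sym.nil)).choose
  set l := (exists_eq_pair (i ::ₛ j ::ₛ Sym.nil)).choose_spec.choose
  have h' : [i, j].Perm [k, l] := by
    have := congrArg (fun s : Sym (Fin r) 2 => (s : Multiset (Fin r))) h
    exact Multiset.coe_eq_coe.1 this
  rcases List.perm_pair.1 h' with h | h <;>
    simp only [List.cons.injEq, and_true] at h
  · change t k l = _
    rw [h.1, h.2]
  · change t k l = _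
    rw [h.1, h.2, ht]

/-- The symmetric bilinear form with matrix `η`. -/
abbrev etaForm (η : Matrix (Fin (r + 1)) (Fin (r + 1)) ℝ) :
    LinearMap.BilinForm ℝ (Fin (r + 1) → ℝ) := Matrix.toBilin' η

theorem etaForm_comm {η : Matrix (Fin (r + 1)) (Fin (r + 1)) ℝ} (hsymm : η.IsSymm)
    (x y : Fin (r + 1) → ℝ) : etaForm η x y = etaForm η y x := by
  rw [etaForm, Matrix.toBilin'_apply', Matrix.toBilin'_apply', Matrix.dotProduct_mulVec,
    dotProduct_comm, ← Matrix.mulVec_transpose, hsymm.eq]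

/-- The Hankel matrix of a sequence. -/
def hankel (h : ℕ → ℝ) (k : ℕ) : Matrix (Fin k) (Fin k) ℝ := Matrix.of fun i j => h (i + j)

/-- A sequence starting with two given vectors whose Gram matrix is a nondegenerate
Hankel matrix. -/
def HasHankelChain (η : Matrix (Fin (r + 1)) (Fin (r + 1)) ℝ) (x y : Fin (r + 1) → ℝ)
    (k : ℕ) : Prop :=
  ∃ (v : ℕ → Fin (r + 1) → ℝ) (h : ℕ → ℝ), v 0 = x ∧ v 1 = y ∧
    (∀ i j, i < k → j < k → etaForm η (v i) (v j) = h (i + j)) ∧ (hankel h k).det ≠ 0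

variable {η : Matrix (Fin (r + 1)) (Fin (r + 1)) ℝ}

/-- The new vector is w + e: w lies in the span of the old ones and has the products h(k + j) with
them, while e is orthogonal to them and not isotropic. The old chain leaves h(2k − 1) free, and its
given value is kept; only h(2k) is redefined. As k ≥ 2, the first two vectors survive. -/
theorem HasHankelChain.succ (hsymm : η.IsSymm) (hdet : η.det ≠ 0) {x y : Fin (r + 1) → ℝ}
    {k : ℕ} (hk : 2 ≤ k) (hkr : k < r + 1) (hc : HasHankelChain η x y k) :
    HasHankelChain η x y (k + 1) := by
  obtain ⟨v, h, hv0, hv1, hvh, hH⟩ := hc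
  have hHu : IsUnit (hankel h k).det := isUnit_iff_ne_zero.2 hH
  have hcomm := etaForm_comm hsymm
  have hsol : ∀ t : Fin k → ℝ, ∃ c : Fin k → ℝ,
      ∀ j : Fin k, etaForm η (∑ i, c i • v i) (v j) = t j := by
    intro t
    refine ⟨Matrix.mulVec (hankel h k)⁻¹ t, fun j => ?_⟩
    have : Matrix.mulVec (hankel h k) (Matrix.mulVec (hankel h k)⁻¹ t) j = t j := by
      rw [Matrix.mulVec_mulVec, Matrix.mul_nonsing_inv _ hHu, Matrix.one_mulVec]
    rw [← this, map_sum, LinearMap.sum_apply]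
    refine Finset.sum_congr rfl fun i _ => ?_
    rw [map_smul, LinearMap.smul_apply, hvh i j i.2 j.2, smul_eq_mul, mul_comm, add_comm]
    rfl
  -- If every vector orthogonal to the span were isotropic, polarisation would make a nonzero such
  -- vector orthogonal to the complement too, hence to the whole space.
  obtain ⟨e, he, hee⟩ : ∃ e, (∀ j : Fin k, etaForm η e (v j) = 0) ∧ etaForm η e e ≠ 0 := by
    by_contra! hcon
    let T : (Fin (r + 1) → ℝ) →ₗ[ℝ] (Fin k → ℝ) :=
      LinearMap.pi fun j => (etaForm η).flip (v j)
    have hT : LinearMap.ker T ≠ ⊥ := LinearMap.ker_ne_bot_of_finrank_lt (by simpa using hkr)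
    obtain ⟨e, heT, he0⟩ := Submodule.exists_mem_ne_zero_of_ne_bot hT
    have hmem : ∀ z, z ∈ LinearMap.ker T ↔ ∀ j : Fin k, etaForm η z (v j) = 0 := by
      intro z
      rw [LinearMap.mem_ker, funext_iff]
      rfl
    have hpol : ∀ z ∈ LinearMap.ker T, etaForm η e z = 0 := by
      intro z hz
      have h1 := hcon _ ((hmem _).1 (add_mem heT hz))
      have h2 := hcon _ ((hmem _).1 heT)
      have h3 := hcon _ ((hmem _).1 hz)
      simp only [map_add, LinearMap.add_apply] at h1
      have h4 := hcomm z e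
      linarith
    have hnd := Matrix.Nondegenerate.toBilin' (Matrix.nondegenerate_of_det_ne_zero hdet)
    refine he0 (hnd.1 e fun z => ?_)
    obtain ⟨c, hc⟩ := hsol fun j => etaForm η z (v j)
    have hz : z - ∑ i, c i • v i ∈ LinearMap.ker T := by
      rw [hmem]
      intro j
      rw [map_sub, LinearMap.sub_apply, hc, sub_self]
    have h1 := hpol _ hz
    rw [map_sub, map_sum, sub_eq_zero] at h1
    refine h1.trans (Finset.sum_eq_zero fun i _ => ?_)
    rw [map_smul, (hmem e).1 heT, smul_zero]
  obtain ⟨c, hc⟩ := hsol fun j => h (k + j)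
  set w := ∑ i, c i • v i with hw
  have hew : etaForm η e w = 0 := by
    rw [hw, map_sum]
    exact Finset.sum_eq_zero fun i _ => by rw [map_smul, he, smul_zero]
  let v' := Function.update v k (w + e)
  let h' := Function.update h (2 * k) (etaForm η (w + e) (w + e))
  have hv' : ∀ i, i < k → v' i = v i := fun i hi => Function.update_of_ne hi.ne _ _
  have hv'k : v' k = w + e := Function.update_self _ _ _
  have hh' : ∀ i, i < 2 * k → h' i = h i := fun i hi => Function.update_of_ne hi.ne _ _
  have hkj : ∀ j, j < k → etaForm η (w + e) (v j) = h (k + j) := by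
    intro j hj
    rw [map_add, LinearMap.add_apply, he ⟨j, hj⟩, add_zero]
    exact hc ⟨j, hj⟩
  have hgram : ∀ i j, i < k + 1 → j < k + 1 → etaForm η (v' i) (v' j) = h' (i + j) := by
    intro i j hi hj
    rcases Nat.lt_succ_iff_lt_or_eq.1 hi with hi | rfl
    · rcases Nat.lt_succ_iff_lt_or_eq.1 hj with hj | rfl
      · rw [hv' i hi, hv' j hj, hh' _ (by omega), hvh i j hi hj]
      · rw [hv' i hi, hv'k, hh' _ (by omega), hcomm, hkj i hi, add_comm]
    · rcases Nat.lt_succ_iff_lt_or_eq.1 hj with hj | rfl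
      · rw [hv' j hj, hv'k, hh' _ (by omega), hkj j hj]
      · rw [hv'k, ← two_mul]
        exact (Function.update_self (2 * _) _ h).symm
  refine ⟨v', h', by rw [hv' 0 (by omega), hv0], by rw [hv' 1 (by omega), hv1], hgram, ?_⟩
  -- A null vector d of the new Gram matrix gives a combination orthogonal to all vectors of the
  -- chain, hence to e. Pairing with e leaves d_k⟨e, e⟩ = 0, so d_k = 0 and the rest of d is null
  -- for the old Hankel matrix.
  intro hzero
  obtain ⟨d, hd0, hd⟩ := Matrix.exists_mulVec_eq_zero_iff.2 hzero
  have hdx : ∀ j : Fin (k + 1), etaForm η (v' j) (∑ i, d i • v' i) = 0 := by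
    intro j
    rw [map_sum, ← Pi.zero_apply (M := fun _ => ℝ) j, ← hd]
    refine Finset.sum_congr rfl fun i _ => ?_
    rw [map_smul, hgram j i j.2 i.2, smul_eq_mul, mul_comm]
    rfl
  have hex : etaForm η e (∑ i, d i • v' i) = 0 := by
    have h1 := hdx (Fin.last k)
    have hwx : etaForm η w (∑ i, d i • v' i) = 0 := by
      rw [hw, LinearMap.map_sum₂]
      refine Finset.sum_eq_zero fun i _ => ?_
      have h2 := hdx i.castSucc
      rw [Fin.val_castSucc, hv' i i.2] at h2
      rw [map_smul, LinearMap.smul_apply, h2, smul_zero]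
    rwa [Fin.val_last, hv'k, map_add, LinearMap.add_apply, hwx, zero_add] at h1
  have hdk : d (Fin.last k) = 0 := by
    rw [map_sum, Fin.sum_univ_castSucc, Finset.sum_eq_zero, zero_add, map_smul, Fin.val_last,
      hv'k, map_add, hew, zero_add, smul_eq_mul] at hex
    · exact (mul_eq_zero.1 hex).resolve_right hee
    · intro i _
      rw [Fin.val_castSucc, hv' i i.2, map_smul, he, smul_zero]
  have hd' : (fun i : Fin k => d i.castSucc) ≠ 0 := by
    intro h0
    refine hd0 (funext fun i => ?_)
    refine Fin.lastCases hdk (fun i => congrFun h0 i) i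
  refine hH (Matrix.exists_mulVec_eq_zero_iff.1 ⟨_, hd', funext fun j => ?_⟩)
  have h1 := congrFun hd j.castSucc
  simp only [Matrix.mulVec, dotProduct, Fin.sum_univ_castSucc, hdk, mul_zero, add_zero] at h1
  rw [Pi.zero_apply] at h1
  rw [Pi.zero_apply, ← h1, Matrix.mulVec, dotProduct]
  refine Finset.sum_congr rfl fun i _ => ?_
  simp only [hankel, Matrix.of_apply, Fin.val_castSucc]
  rw [hh' _ (by omega)]

theorem HasHankelChain.top (hsymm : η.IsSymm) (hdet : η.det ≠ 0) {x y : Fin (r + 1) → ℝ}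
    {k : ℕ} (hk : 2 ≤ k) (hkr : k ≤ r + 1) (hc : HasHankelChain η x y k) :
    HasHankelChain η x y (r + 1) := by
  have key : ∀ n, k ≤ n → n ≤ r + 1 → HasHankelChain η x y n := by
    intro n hn
    induction n, hn using Nat.le_induction with
    | base => exact fun _ => hc
    | succ n hn ih => exact fun h => (ih (by omega)).succ hsymm hdet (by omega) (by omega)
  exact key _ hkr le_rfl

/-- The chain starts with as many vectors as a nondegenerate Hankel block requires: two if the Gram
matrix of e₀, e_p is invertible, three if it is singular but nonzero, four if it vanishes. The last
case needs r ≥ 3. -/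
theorem hasHankelChain_single (hsymm : η.IsSymm) (hdet : η.det ≠ 0) (hr : 3 ≤ r) (p : Fin r) :
    HasHankelChain η (Pi.single 0 1) (Pi.single p.succ 1) (r + 1) := by
  set x : Fin (r + 1) → ℝ := Pi.single 0 1
  set y : Fin (r + 1) → ℝ := Pi.single p.succ 1
  have hcomm := etaForm_comm hsymm
  have hsol : ∀ s t : ℝ, ∃ z, etaForm η x z = s ∧ etaForm η y z = t := by
    intro s t
    refine ⟨η⁻¹.mulVec (Pi.single 0 s + Pi.single p.succ t), ?_, ?_⟩ <;>
      simp [x, y, Matrix.toBilin'_apply', Matrix.mulVec_mulVec, eta_mul_inv hdet]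
  set a := etaForm η x x with ha
  set b := etaForm η x y with hb
  set c := etaForm η y y with hc
  by_cases h2 : a * c - b * b = 0
  · by_cases h3 : a = 0 ∧ c = 0
    · obtain ⟨z, hxz, hyz⟩ := hsol 0 1
      obtain ⟨w, hxw, hyw⟩ := hsol 1 (etaForm η z z)
      have hb0 : b = 0 := by
        rw [h3.1, zero_mul, zero_sub, neg_eq_zero] at h2
        exact mul_self_eq_zero.1 h2
      refine HasHankelChain.top hsymm hdet (k := 4) (by norm_num) (by omega)
        ⟨fun n => match n with | 0 => x | 1 => y | 2 => z | _ => w,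
          fun n => match n with
            | 0 => 0 | 1 => 0 | 2 => 0 | 3 => 1 | 4 => etaForm η z z
            | 5 => etaForm η z w | _ => etaForm η w w, rfl, rfl, ?_, ?_⟩
      · intro i j hi hj
        interval_cases i <;> interval_cases j <;>
          simp [← ha, ← hb, ← hc, hxz, hyz, hxw, hyw, hcomm y x, hcomm z x, hcomm z y,
            hcomm w x, hcomm w y, hcomm w z, h3, hb0]
      · simp [hankel, Matrix.det_succ_row_zero, Fin.sum_univ_succ, Fin.succAbove]
    -- As ac = b², this is the 3 × 3 Hankel determinant with h(3) = s; its h(4) term drops out.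
    -- Vanishing at s = 0, 1, −1 would give a = c = 0.
    · obtain ⟨s, hs⟩ : ∃ s : ℝ, 2 * b * c * s - a * s ^ 2 - c ^ 3 ≠ 0 := by
        by_contra! hcon
        have h0 := hcon 0
        have h1 := hcon 1
        have h1' := hcon (-1)
        refine h3 ⟨by nlinarith, ?_⟩
        have : c ^ 3 = 0 := by linarith
        exact pow_eq_zero_iff (by norm_num) |>.1 this
      obtain ⟨z, hxz, hyz⟩ := hsol c s
      refine HasHankelChain.top hsymm hdet (k := 3) (by norm_num) (by omega)
        ⟨fun n => match n with | 0 => x | 1 => y | _ => z,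
          fun n => match n with | 0 => a | 1 => b | 2 => c | 3 => s | _ => etaForm η z z,
          rfl, rfl, ?_, ?_⟩
      · intro i j hi hj
        interval_cases i <;> interval_cases j <;>
          simp [← ha, ← hb, ← hc, hxz, hyz, hcomm y x, hcomm z x, hcomm z y]
      · simp only [hankel, Matrix.det_fin_three, Matrix.of_apply]
        intro h
        apply hs
        simp only [Fin.isValue, Fin.val_zero, Fin.val_one, Fin.val_two, add_zero, zero_add,
          Nat.reduceAdd] at h
        linear_combination h - etaForm η z z * h2
  · refine HasHankelChain.top hsymm hdet (k := 2) le_rfl (by omega)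
      ⟨fun n => match n with | 0 => x | _ => y,
        fun n => match n with | 0 => a | 1 => b | _ => c, rfl, rfl, ?_, ?_⟩
    · intro i j hi hj
      interval_cases i <;> interval_cases j <;> simp [← ha, ← hb, ← hc, hcomm y x]
    · simpa [hankel, Matrix.det_fin_two] using h2

/-- Some value of the parametric derivatives makes the `p`-th multiplication operator
cyclic. -/
theorem exists_cyclic (hsymm : η.IsSymm) (hdet : η.det ≠ 0) (hr : 3 ≤ r) (p : Fin r) :
    ∃ u : Jet r 2, (krylov (sliceOp η p u)).det ≠ 0 := by
  obtain ⟨v, h, hv0, hv1, hvh, hH⟩ := hasHankelChain_single hsymm hdet hr p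
  let A : Matrix (Fin (r + 1)) (Fin (r + 1)) ℝ := Matrix.of fun α k => v k α
  have hgram : A.transpose * η * A = hankel h (r + 1) := by
    ext i j
    rw [hankel, Matrix.of_apply, ← hvh i j i.2 j.2, etaForm, Matrix.toBilin'_apply']
    rw [mul_assoc, Matrix.mul_apply']
    rfl
  have hA : A.det ≠ 0 := by
    intro h0
    rw [← hgram, Matrix.det_mul, h0, mul_zero] at hH
    exact hH rfl
  have hAu : IsUnit A.det := isUnit_iff_ne_zero.2 hA
  have hAT : IsUnit A.transpose.det := by rwa [Matrix.det_transpose]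
  -- The symmetric F is defined by v_iᵀ F v_j = h(i + j + 1), so F v_i = η v_{i+1}: the operator
  -- η⁻¹F shifts the chain, and its Krylov matrix is A.
  let H' : Matrix (Fin (r + 1)) (Fin (r + 1)) ℝ := Matrix.of fun i j => h (i + j + 1)
  let F := A.transpose⁻¹ * H' * A⁻¹
  have hFA : A.transpose * (F * A) = H' := by
    simp only [F]
    rw [mul_assoc, Matrix.nonsing_inv_mul _ hAu, mul_one, ← mul_assoc,
      Matrix.mul_nonsing_inv _ hAT, one_mul]
  have hF : F.transpose = F := by
    have : H'.transpose = H' := by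
      ext i j
      simp [H', add_comm]
    simp only [F, Matrix.transpose_mul, this, Matrix.transpose_nonsing_inv,
      Matrix.transpose_transpose, mul_assoc]
  have hstep : ∀ i : ℕ, i + 1 < r + 1 → F.mulVec (v i) = η.mulVec (v (i + 1)) := by
    intro i hi
    have h1 : A.transpose.mulVec (F.mulVec (v i)) = A.transpose.mulVec (η.mulVec (v (i + 1))) := by
      have e1 := fun j => congrFun₂ hFA j ⟨i, by omega⟩
      have e2 := fun j => congrFun₂ hgram j ⟨i + 1, hi⟩
      have e3 : ∀ j, (A.transpose * (F * A)) j ⟨i, by omega⟩ =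
          (A.transpose * η * A) j ⟨i + 1, hi⟩ := by
        intro j
        rw [e1, e2]
        simp only [H', hankel, Matrix.of_apply]
        congr 1
      funext j
      have := e3 j
      rw [mul_assoc A.transpose η] at this
      exact this
    have h2 := congrArg (A.transpose⁻¹.mulVec ·) h1
    simpa only [Matrix.mulVec_mulVec, ← mul_assoc, Matrix.nonsing_inv_mul _ hAT, one_mul] using h2
  -- The first shift e₀ ↦ e_p fixes row and column 0 of F to the values prescribed by η, so F comes
  -- from some u.
  have hF0 : ∀ α, F α 0 = η α p.succ := by
    intro α
    have := congrFun (hstep 0 (by omega)) α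
    simpa [hv0, hv1] using this
  have hFs : ∀ α β, F α β = F β α := fun α β => congrFun₂ hF β α
  obtain ⟨u, hu⟩ := exists_jet_of_symm (fun i j : Fin r => F i.succ j.succ) fun i j => hFs _ _
  have hFu : baseMat η p + symMat u = F := by
    ext α β
    cases α using Fin.cases <;> cases β using Fin.cases
    · simp [baseMat, thirdDeriv, hF0, eta_comm hsymm p.succ]
    · simp [baseMat, thirdDeriv, hF0, eta_comm hsymm p.succ, hFs 0]
    · simp [baseMat, thirdDeriv, hF0, eta_comm hsymm p.succ]
    · simp [baseMat, thirdDeriv, hu]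
  have hL : sliceOp η p u = η⁻¹ * F := by
    rw [sliceOp, symOp_apply, ← mul_add, hFu]
  refine ⟨u, ?_⟩
  rw [hL]
  have hpow : ∀ k : ℕ, k < r + 1 → ((η⁻¹ * F) ^ k).mulVec (v 0) = v k := by
    intro k
    induction k with
    | zero => simp
    | succ k ih =>
      intro hk
      rw [pow_succ', ← Matrix.mulVec_mulVec, ih (by omega), ← Matrix.mulVec_mulVec, hstep k hk,
        Matrix.mulVec_mulVec, eta_inv_mul hdet, Matrix.one_mulVec]
  have hk : krylov (η⁻¹ * F) = A := by
    ext α k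
    have := congrFun (hpow k k.2) α
    simpa [hv0, krylov, A] using this
  rwa [hk]

theorem denom_ne_zero (hsymm : η.IsSymm) (hdet : η.det ≠ 0) (hr : 3 ≤ r) (p : Fin r) :
    denom η p ≠ 0 := by
  obtain ⟨u, hu⟩ := exists_cyclic hsymm hdet hr p
  intro h
  rw [← eval_denom, h, map_zero] at hu
  exact hu rfl

end WDVV

namespace WDVV

/-! ### The number of principal derivatives and the ranking -/

variable {r : ℕ}

/-- Removing one p identifies the multi-indices containing p with unordered pairs, and C(r+2,3) −
C(r+1,2) = C(r+1,3). -/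
theorem card_principal (p : Fin r) : Nat.card (principal p) = (r + 1).choose 3 := by
  classical
  have e : {τ : Sym (Fin r) 3 // p ∈ τ} ≃ Sym (Fin r) 2 :=
    { toFun := fun τ => τ.1.erase p τ.2
      invFun := fun I => ⟨p ::ₛ I, Sym.mem_cons_self p I⟩
      left_inv := fun τ => Subtype.ext (Sym.cons_erase τ.2)
      right_inv := fun I => Sym.erase_cons_head I p _ }
  have h1 : Fintype.card {τ : Sym (Fin r) 3 // p ∈ τ} = (r + 1).choose 2 := by
    rw [Fintype.card_congr e, Sym.card_sym_eq_choose, Fintype.card_fin]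
    rfl
  have h2 : Fintype.card (Sym (Fin r) 3) = (r + 2).choose 3 := by
    rw [Sym.card_sym_eq_choose, Fintype.card_fin]
    rfl
  have h3 := Fintype.card_subtype_compl fun τ : Sym (Fin r) 3 => p ∈ τ
  rw [h1, h2, Nat.choose_succ_succ' (r + 1) 2, Nat.add_sub_cancel_left] at h3
  rw [← h3, ← Nat.card_eq_fintype_card]
  rfl

/-- The weights of a graded ranking in which, for a given order, derivatives with
fewer differentiations in the direction `p` are higher. -/
def rankKey (p : Fin r) (σ : Multiset (Fin r)) : ℕ ×ₗ (ℕ ×ₗ Lex (Fin r → ℕ)) :=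
  toLex (σ.card, toLex ((σ.filter (· ≠ p)).card, toLex fun i => σ.count i))

theorem rankKey_cons (p i : Fin r) (σ : Multiset (Fin r)) :
    rankKey p (i ::ₘ σ) = rankKey p {i} + rankKey p σ := by
  rw [← Multiset.singleton_add]
  simp only [rankKey, Multiset.card_add, Multiset.filter_add, Multiset.count_add]
  rfl

theorem rankKey_injective (p : Fin r) : Function.Injective (rankKey p) := by
  intro σ τ h
  ext i
  have h1 : (rankKey p σ).2 = (rankKey p τ).2 := by rw [h]
  have h2 : (rankKey p σ).2.2 = (rankKey p τ).2.2 := by rw [h1]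
  exact congrFun h2 i

theorem isRanking_rankKey (p : Fin r) : IsRanking fun σ τ => rankKey p σ < rankKey p τ where
  irrefl σ := lt_irrefl _
  trans ρ σ τ := lt_trans
  total σ τ := by
    rcases lt_trichotomy (rankKey p σ) (rankKey p τ) with h | h | h
    · exact Or.inl h
    · exact Or.inr (Or.inl (rankKey_injective p h))
    · exact Or.inr (Or.inr h)
  lt_cons i σ := by
    rw [rankKey, rankKey, Prod.Lex.toLex_lt_toLex]
    exact Or.inl (by simp)
  cons_lt_cons i σ τ h := by
    rw [rankKey_cons, rankKey_cons p i τ]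
    exact add_lt_add_right h _

theorem rankKey_lt_of_mem (p : Fin r) {σ τ : Sym (Fin r) 3} (hσ : p ∈ σ) (hτ : p ∉ τ) :
    rankKey p (σ : Multiset (Fin r)) < rankKey p (τ : Multiset (Fin r)) := by
  rw [rankKey, rankKey, Prod.Lex.toLex_lt_toLex]
  refine Or.inr ⟨by simp, ?_⟩
  rw [Prod.Lex.toLex_lt_toLex]
  refine Or.inl ?_
  have h1 : ((τ : Multiset (Fin r)).filter (· ≠ p)) = τ := by
    rw [Multiset.filter_eq_self]
    rintro i hi rfl
    exact hτ hi
  dsimp only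
  rw [h1, Sym.card_coe]
  refine (Multiset.card_lt_card (lt_of_le_of_ne (Multiset.filter_le _ _) fun h => ?_)).trans_eq
    σ.card_coe
  rw [Multiset.filter_eq_self] at h
  exact h p hσ rfl

theorem isOrthonomic_param (p : Fin r) (G : principal p → Jet r 2 → ℝ) :
    IsOrthonomic (fun σ τ => rankKey p σ < rankKey p τ) (principal p)
      (fun τ f => G τ (param p f)) := by
  intro τ f f' h
  have : param p f = param p f' := by
    funext I
    refine h _ ⟨fun hp => hp (Sym.mem_cons_self p I), ?_⟩
    exact rankKey_lt_of_mem p (Sym.mem_cons_self p I) τ.2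
  simp only [this]

end WDVV

namespace WDVV

/-! ### Regular functions on infinite jets -/

section Regular

variable {ι : Type}

/-- Functions on infinite jets which, over `U`, are rational in the coordinates with
nowhere vanishing denominators. -/
inductive IsRegular (U : Set (ι → ℝ)) : (InfJet ι → ℝ) → Prop
  | const (c : ℝ) : IsRegular U fun _ => c
  | coord (k : ℕ) (i : ι) : IsRegular U fun z => z k i
  | add {g h : InfJet ι → ℝ} : IsRegular U g → IsRegular U h → IsRegular U fun z => g z + h z
  | mul {g h : InfJet ι → ℝ} : IsRegular U g → IsRegular U h → IsRegular U fun z => g z * h z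
  | inv {g : InfJet ι → ℝ} : IsRegular U g → (∀ z, z 0 ∈ U → g z ≠ 0) →
      IsRegular U fun z => (g z)⁻¹
  | congr {g h : InfJet ι → ℝ} : IsRegular U g → (∀ z, z 0 ∈ U → g z = h z) → IsRegular U h

theorem IsRegular.eval {U : Set (ι → ℝ)} (P : MvPolynomial ι ℝ) :
    IsRegular U fun z => MvPolynomial.eval (z 0) P := by
  induction P using MvPolynomial.induction_on with
  | C a => simpa using IsRegular.const a
  | add P Q hP hQ => simpa using hP.add hQ
  | mul_X P i hP => simpa using hP.mul (IsRegular.coord 0 i)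

variable {U : Set (ι → ℝ)}

theorem eventually_line_mem (hU : IsOpen U) {z : InfJet ι} (hz : z 0 ∈ U) (v : InfJet ι) :
    ∀ᶠ t : ℝ in nhds 0, (z + t • v) 0 ∈ U := by
  have hc : Continuous fun t : ℝ => (z + t • v) 0 := by
    simp only [Pi.add_apply, Pi.smul_apply]
    fun_prop
  refine hc.continuousAt.eventually (hU.mem_nhds ?_)
  simpa using hz

theorem lineDeriv_congr (hU : IsOpen U) {g h : InfJet ι → ℝ}
    (hgh : ∀ z, z 0 ∈ U → g z = h z) {z : InfJet ι} (hz : z 0 ∈ U) (v : InfJet ι) :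
    lineDeriv ℝ g z v = lineDeriv ℝ h z v := by
  refine Filter.EventuallyEq.deriv_eq ?_
  filter_upwards [eventually_line_mem hU hz v] with t ht using hgh _ ht

/-- Only derivatives along lines are used on the infinite jet space. They are ordinary one-variable
derivatives, so the calculus rules follow by induction on the construction of a regular function. -/
theorem IsRegular.lineDifferentiableAt (hU : IsOpen U) {g : InfJet ι → ℝ}
    (hg : IsRegular U g) {z : InfJet ι} (hz : z 0 ∈ U) (v : InfJet ι) :
    LineDifferentiableAt ℝ g z v := by
  induction hg with
  | const c => exact differentiableAt_const c
  | coord k i =>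
    change DifferentiableAt ℝ (fun t : ℝ => z k i + t * v k i) 0
    fun_prop
  | add _ _ hg hh => exact DifferentiableAt.add hg hh
  | mul _ _ hg hh => exact DifferentiableAt.mul hg hh
  | inv _ h0 hg =>
    refine DifferentiableAt.inv hg ?_
    simpa using h0 z hz
  | congr _ hgh hg =>
    refine DifferentiableAt.congr_of_eventuallyEq hg ?_
    filter_upwards [eventually_line_mem hU hz v] with t ht using (hgh _ ht).symm

theorem lineDeriv_coord (k : ℕ) (i : ι) (z v : InfJet ι) :
    lineDeriv ℝ (fun y : InfJet ι => y k i) z v = v k i := by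
  change deriv (fun t : ℝ => z k i + t * v k i) 0 = _
  simp

theorem lineDeriv_add (hU : IsOpen U) {g h : InfJet ι → ℝ} (hg : IsRegular U g)
    (hh : IsRegular U h) {z : InfJet ι} (hz : z 0 ∈ U) (v : InfJet ι) :
    lineDeriv ℝ (fun y => g y + h y) z v = lineDeriv ℝ g z v + lineDeriv ℝ h z v :=
  deriv_fun_add (hg.lineDifferentiableAt hU hz v) (hh.lineDifferentiableAt hU hz v)

theorem lineDeriv_mul (hU : IsOpen U) {g h : InfJet ι → ℝ} (hg : IsRegular U g)
    (hh : IsRegular U h) {z : InfJet ι} (hz : z 0 ∈ U) (v : InfJet ι) :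
    lineDeriv ℝ (fun y => g y * h y) z v = lineDeriv ℝ g z v * h z + g z * lineDeriv ℝ h z v := by
  have := deriv_fun_mul (hg.lineDifferentiableAt hU hz v) (hh.lineDifferentiableAt hU hz v)
  simpa [lineDeriv] using this

theorem lineDeriv_inv (hU : IsOpen U) {g : InfJet ι → ℝ} (hg : IsRegular U g)
    {z : InfJet ι} (hz : z 0 ∈ U) (h0 : g z ≠ 0) (v : InfJet ι) :
    lineDeriv ℝ (fun y => (g y)⁻¹) z v = -1 * ((g z)⁻¹ * (g z)⁻¹ * lineDeriv ℝ g z v) := by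
  have := deriv_fun_inv'' (hg.lineDifferentiableAt hU hz v) (by simpa using h0)
  rw [lineDeriv, this, lineDeriv]
  simp only [zero_smul, add_zero]
  field_simp

/-- A vector field on infinite jets with regular components. -/
def IsRegularField (U : Set (ι → ℝ)) (X : InfJet ι → InfJet ι) : Prop :=
  ∀ k i, IsRegular U fun z => X z k i

theorem IsRegular.lineDeriv (hU : IsOpen U) {X : InfJet ι → InfJet ι} (hX : IsRegularField U X)
    {g : InfJet ι → ℝ} (hg : IsRegular U g) :
    IsRegular U fun z => lineDeriv ℝ g z (X z) := by
  induction hg with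
  | const c => simpa [_root_.lineDeriv] using IsRegular.const (U := U) 0
  | coord k i => exact (hX k i).congr fun z _ => (lineDeriv_coord k i z _).symm
  | add hg hh ihg ihh => exact (ihg.add ihh).congr fun z hz => (lineDeriv_add hU hg hh hz _).symm
  | mul hg hh ihg ihh =>
    exact ((ihg.mul hh).add (hg.mul ihh)).congr fun z hz => (lineDeriv_mul hU hg hh hz _).symm
  | inv hg h0 ih =>
    exact ((IsRegular.const (-1)).mul (((hg.inv h0).mul (hg.inv h0)).mul ih)).congr
      fun z hz => (lineDeriv_inv hU hg hz (h0 z hz) _).symm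
  | congr _ hgh ih => exact ih.congr fun z hz => lineDeriv_congr hU hgh hz _

/-- Regular vector fields which commute on coordinates commute on all regular functions. -/
theorem IsRegular.lineDeriv_comm (hU : IsOpen U) {X Y : InfJet ι → InfJet ι}
    (hX : IsRegularField U X) (hY : IsRegularField U Y)
    (hXY : ∀ z, z 0 ∈ U → ∀ k i, _root_.lineDeriv ℝ (fun y => Y y k i) z (X z) =
      _root_.lineDeriv ℝ (fun y => X y k i) z (Y z))
    {g : InfJet ι → ℝ} (hg : IsRegular U g) {z : InfJet ι} (hz : z 0 ∈ U) :
    _root_.lineDeriv ℝ (fun y => _root_.lineDeriv ℝ g y (Y y)) z (X z) =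
      _root_.lineDeriv ℝ (fun y => _root_.lineDeriv ℝ g y (X y)) z (Y z) := by
  induction hg with
  | const c => simp [_root_.lineDeriv]
  | coord k i =>
    simp only [lineDeriv_coord]
    exact hXY z hz k i
  | add hg hh ihg ihh =>
    rw [lineDeriv_congr hU (fun z hz => lineDeriv_add hU hg hh hz _) hz,
      lineDeriv_congr hU (fun z hz => lineDeriv_add hU hg hh hz (X z)) hz,
      lineDeriv_add hU (hg.lineDeriv hU hY) (hh.lineDeriv hU hY) hz,
      lineDeriv_add hU (hg.lineDeriv hU hX) (hh.lineDeriv hU hX) hz, ihg, ihh]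
  | mul hg hh ihg ihh =>
    have h : ∀ {X : InfJet ι → InfJet ι}, IsRegularField U X → ∀ v, _ := fun {X} hX v =>
      lineDeriv_congr hU (fun z hz => lineDeriv_mul hU hg hh hz (X z)) hz v
    rw [h hY, h hX,
      lineDeriv_add hU ((hg.lineDeriv hU hY).mul hh) (hg.mul (hh.lineDeriv hU hY)) hz,
      lineDeriv_add hU ((hg.lineDeriv hU hX).mul hh) (hg.mul (hh.lineDeriv hU hX)) hz,
      lineDeriv_mul hU (hg.lineDeriv hU hY) hh hz, lineDeriv_mul hU hg (hh.lineDeriv hU hY) hz,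
      lineDeriv_mul hU (hg.lineDeriv hU hX) hh hz, lineDeriv_mul hU hg (hh.lineDeriv hU hX) hz,
      ihg, ihh]
    ring
  | inv hg h0 ih =>
    have h : ∀ {X : InfJet ι → InfJet ι}, IsRegularField U X → ∀ v, _ := fun {X} hX v =>
      lineDeriv_congr hU (fun z hz => lineDeriv_inv hU hg hz (h0 z hz) (X z)) hz v
    have hi := hg.inv h0
    rw [h hY, h hX,
      lineDeriv_mul hU (IsRegular.const (-1)) ((hi.mul hi).mul (hg.lineDeriv hU hY)) hz,
      lineDeriv_mul hU (IsRegular.const (-1)) ((hi.mul hi).mul (hg.lineDeriv hU hX)) hz,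
      lineDeriv_mul hU (hi.mul hi) (hg.lineDeriv hU hY) hz,
      lineDeriv_mul hU (hi.mul hi) (hg.lineDeriv hU hX) hz,
      lineDeriv_mul hU hi hi hz, lineDeriv_mul hU hi hi hz,
      lineDeriv_inv hU hg hz (h0 z hz), lineDeriv_inv hU hg hz (h0 z hz), ih]
    simp [_root_.lineDeriv]
    ring
  | congr hg hgh ih =>
    rw [lineDeriv_congr hU (fun z hz => (lineDeriv_congr hU hgh hz (Y z)).symm) hz,
      lineDeriv_congr hU (fun z hz => (lineDeriv_congr hU hgh hz (X z)).symm) hz, ih]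

/-! ### Evolutionary vector fields -/

theorem isRegularField_shift : IsRegularField U fun (z : InfJet ι) k => z (k + 1) :=
  fun k i => IsRegular.coord (k + 1) i

theorem IsRegular.dx (hU : IsOpen U) {g : InfJet ι → ℝ} (hg : IsRegular U g) :
    IsRegular U (Dx g) :=
  hg.lineDeriv hU isRegularField_shift

theorem IsRegular.dx_iterate (hU : IsOpen U) {g : InfJet ι → ℝ} (hg : IsRegular U g) (k : ℕ) :
    IsRegular U (Dx^[k] g) := by
  induction k with
  | zero => exact hg
  | succ k ih =>
    rw [Function.iterate_succ_apply']
    exact ih.dx hU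

theorem dx_congr (hU : IsOpen U) {g h : InfJet ι → ℝ} (hgh : ∀ z, z 0 ∈ U → g z = h z)
    {z : InfJet ι} (hz : z 0 ∈ U) : Dx g z = Dx h z :=
  lineDeriv_congr hU hgh hz _

theorem evol_congr (hU : IsOpen U) (V : ι → (ι → ℝ) → ℝ) {g h : InfJet ι → ℝ}
    (hgh : ∀ z, z 0 ∈ U → g z = h z) {z : InfJet ι} (hz : z 0 ∈ U) : evol V g z = evol V h z :=
  lineDeriv_congr hU hgh hz _

theorem isRegularField_evol (hU : IsOpen U) {V : ι → (ι → ℝ) → ℝ}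
    (hV : ∀ i, IsRegular U fun z => V i (z 0)) :
    IsRegularField U fun z k i => (Dx^[k + 1] fun y => V i (y 0)) z :=
  fun k i => (hV i).dx_iterate hU (k + 1)

theorem IsRegular.evol (hU : IsOpen U) {V : ι → (ι → ℝ) → ℝ}
    (hV : ∀ i, IsRegular U fun z => V i (z 0)) {g : InfJet ι → ℝ} (hg : IsRegular U g) :
    IsRegular U (evol V g) :=
  hg.lineDeriv hU (isRegularField_evol hU hV)

/-- On a coordinate u_k both compositions give D_x^{k+2}V; two fields that commute on coordinates
commute on regular functions. -/
theorem evol_dx (hU : IsOpen U) {V : ι → (ι → ℝ) → ℝ}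
    (hV : ∀ i, IsRegular U fun z => V i (z 0)) {g : InfJet ι → ℝ} (hg : IsRegular U g)
    {z : InfJet ι} (hz : z 0 ∈ U) : evol V (Dx g) z = Dx (evol V g) z := by
  refine hg.lineDeriv_comm hU (isRegularField_evol hU hV) isRegularField_shift
    (fun z _ k i => ?_) hz
  rw [lineDeriv_coord, Function.iterate_succ_apply']
  rfl

theorem evol_dx_iterate (hU : IsOpen U) {V : ι → (ι → ℝ) → ℝ}
    (hV : ∀ i, IsRegular U fun z => V i (z 0)) {g : InfJet ι → ℝ} (hg : IsRegular U g) (k : ℕ)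
    {z : InfJet ι} (hz : z 0 ∈ U) : evol V (Dx^[k] g) z = Dx^[k] (evol V g) z := by
  induction k generalizing z with
  | zero => rfl
  | succ k ih =>
    rw [Function.iterate_succ_apply', Function.iterate_succ_apply',
      evol_dx hU hV (hg.dx_iterate hU k) hz]
    exact dx_congr hU (fun z hz => ih hz) hz

theorem dx_iterate_congr (hU : IsOpen U) {g h : InfJet ι → ℝ}
    (hgh : ∀ z, z 0 ∈ U → g z = h z) (k : ℕ) {z : InfJet ι} (hz : z 0 ∈ U) :
    Dx^[k] g z = Dx^[k] h z := by
  induction k generalizing z with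
  | zero => exact hgh z hz
  | succ k ih =>
    rw [Function.iterate_succ_apply', Function.iterate_succ_apply']
    exact dx_congr hU (fun z hz => ih hz) hz

/-- Evolutionary fields commute if they commute on the dependent variables. -/
theorem evol_comm (hU : IsOpen U) {V W : ι → (ι → ℝ) → ℝ}
    (hV : ∀ i, IsRegular U fun z => V i (z 0)) (hW : ∀ i, IsRegular U fun z => W i (z 0))
    (hVW : ∀ i z, z 0 ∈ U → evol V (fun y => W i (y 0)) z = evol W (fun y => V i (y 0)) z)
    {g : InfJet ι → ℝ} (hg : IsRegular U g) {z : InfJet ι} (hz : z 0 ∈ U) :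
    evol V (evol W g) z = evol W (evol V g) z := by
  refine hg.lineDeriv_comm hU (isRegularField_evol hU hV) (isRegularField_evol hU hW)
    (fun z hz k i => ?_) hz
  exact (evol_dx_iterate hU hV (hW i) (k + 1) hz).trans
    ((dx_iterate_congr hU (hVW i) (k + 1) hz).trans
      (evol_dx_iterate hU hW (hV i) (k + 1) hz).symm)

theorem flowsCommute_of_evol (hU : IsOpen U) {V W : ι → (ι → ℝ) → ℝ}
    (hV : ∀ i, IsRegular U fun z => V i (z 0)) (hW : ∀ i, IsRegular U fun z => W i (z 0))
    (hVW : ∀ i z, z 0 ∈ U → evol V (fun y => W i (y 0)) z = evol W (fun y => V i (y 0)) z) :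
    FlowsCommute U V W := by
  intro z hz i
  rw [evol_dx hU hV (hW i) hz, evol_dx hU hW (hV i) hz]
  exact dx_congr hU (hVW i) hz

/-- On functions of u alone only the component V_x = V′(u)u_x enters, so commutation of two flows on
fluxes becomes commutation of Jacobian matrices. -/
theorem evol_apply (V : ι → (ι → ℝ) → ℝ) (φ : (ι → ℝ) → ℝ) (z : InfJet ι) :
    evol V (fun y => φ (y 0)) z =
      lineDeriv ℝ φ (z 0) fun i => lineDeriv ℝ (V i) (z 0) (z 1) := rfl

end Regular

end WDVV

namespace WDVV

/-! ### The fluxes -/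

variable {r : ℕ} {η : Matrix (Fin (r + 1)) (Fin (r + 1)) ℝ}

/-- The right-hand sides of the reduced system. -/
def rhs (η : Matrix (Fin (r + 1)) (Fin (r + 1)) ℝ) (p : Fin r) (τ : principal p)
    (u : Jet r 2) : ℝ :=
  solJet η (sliceOp η p u) τ

theorem rhs_eq_div (p : Fin r) (τ : principal p) (u : Jet r 2) :
    rhs η p τ u = MvPolynomial.eval u (numer η p τ) / MvPolynomial.eval u (denom η p) :=
  solJet_eq_div η p u τ

theorem mem_regularLocus_iff_denom (hsymm : η.IsSymm) (hdet : η.det ≠ 0) (p : Fin r)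
    (u : Jet r 2) : u ∈ regularLocus η p ↔ MvPolynomial.eval u (denom η p) ≠ 0 := by
  rw [mem_regularLocus_iff p u hsymm hdet, eval_denom]

theorem isOpen_regularLocus (hsymm : η.IsSymm) (hdet : η.det ≠ 0) (p : Fin r) :
    IsOpen (regularLocus η p) := by
  have h : regularLocus η p = {u | MvPolynomial.eval u (denom η p) ≠ 0} :=
    Set.ext fun u => mem_regularLocus_iff_denom hsymm hdet p u
  rw [h]
  exact isOpen_ne_fun (MvPolynomial.continuous_eval _) continuous_const

theorem contDiff_eval {ι : Type*} [Fintype ι] (P : MvPolynomial ι ℝ) :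
    ContDiff ℝ ∞ fun u => MvPolynomial.eval u P := by
  induction P using MvPolynomial.induction_on with
  | C a => simpa using contDiff_const
  | add P Q hP hQ => simpa using hP.add hQ
  | mul_X P i hP => simpa using hP.mul (contDiff_apply ℝ ℝ i)

theorem contDiffOn_flux (hsymm : η.IsSymm) (hdet : η.det ≠ 0) (p l : Fin r)
    (I : Sym (Fin r) 2) :
    ContDiffOn ℝ ∞ (flux p (rhs η p) l I) (regularLocus η p) := by
  by_cases h : p ∈ l ::ₛ I
  · have : flux p (rhs η p) l I = fun u => u ((l ::ₛ I).erase p h) := by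
      funext u
      rw [flux, joinJet, dif_pos h]
    rw [this]
    exact (contDiff_apply ℝ ℝ _).contDiffOn
  · have : flux p (rhs η p) l I = fun u => MvPolynomial.eval u (numer η p (l ::ₛ I)) /
        MvPolynomial.eval u (denom η p) := by
      funext u
      rw [flux, joinJet, dif_neg h, rhs_eq_div]
    rw [this]
    exact (contDiff_eval _).contDiffOn.div (contDiff_eval _).contDiffOn
      fun u hu => (mem_regularLocus_iff_denom hsymm hdet p u).1 hu

theorem differentiableAt_flux (hsymm : η.IsSymm) (hdet : η.det ≠ 0) (p l : Fin r)
    (I : Sym (Fin r) 2) {u : Jet r 2} (hu : u ∈ regularLocus η p) :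
    DifferentiableAt ℝ (flux p (rhs η p) l I) u :=
  ((contDiffOn_flux hsymm hdet p l I).contDiffAt
    ((isOpen_regularLocus hsymm hdet p).mem_nhds hu)).differentiableAt (by simp)

theorem isRegular_flux (hsymm : η.IsSymm) (hdet : η.det ≠ 0) (p l : Fin r)
    (I : Sym (Fin r) 2) :
    IsRegular (regularLocus η p) fun z => flux p (rhs η p) l I (z 0) := by
  by_cases h : p ∈ l ::ₛ I
  · simp only [flux, joinJet, dif_pos h]
    exact IsRegular.coord 0 _
  · simp only [flux, joinJet, dif_neg h, rhs_eq_div, div_eq_mul_inv]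
    exact (IsRegular.eval _).mul ((IsRegular.eval _).inv
      fun z hz => (mem_regularLocus_iff_denom hsymm hdet p _).1 hz)

theorem flux_self (p : Fin r) (G : principal p → Jet r 2 → ℝ) (I : Sym (Fin r) 2)
    (u : Jet r 2) : flux p G p I u = u I :=
  congrFun (param_joinJet p u _) I

/-- The solution of the reduced system with given parametric derivatives. -/
def fullJet (η : Matrix (Fin (r + 1)) (Fin (r + 1)) ℝ) (p : Fin r) (u : Jet r 2) : Jet r 3 :=
  joinJet p u fun τ => rhs η p τ u

theorem param_fullJet_self (p : Fin r) (u : Jet r 2) : param p (fullJet η p u) = u :=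
  param_joinJet p u _

theorem param_fullJet (p l : Fin r) (u : Jet r 2) :
    param l (fullJet η p u) = fun I => flux p (rhs η p) l I u := rfl

theorem fullJet_eq_solJet (hsymm : η.IsSymm) (hdet : η.det ≠ 0) (p : Fin r) {u : Jet r 2}
    (hu : u ∈ regularLocus η p) : fullJet η p u = solJet η (sliceOp η p u) :=
  joinJet_solJet p u hsymm hdet ((mem_regularLocus_iff p u hsymm hdet).1 hu)

theorem isWDVV_fullJet (hsymm : η.IsSymm) (hdet : η.det ≠ 0) (p : Fin r) {u : Jet r 2}
    (hu : u ∈ regularLocus η p) : IsWDVV η (fullJet η p u) := by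
  rw [fullJet_eq_solJet hsymm hdet p hu]
  exact isWDVV_solJet hsymm hdet p u ((mem_regularLocus_iff p u hsymm hdet).1 hu)

theorem isReduced_iff (p : Fin r) (f : Jet r 3) :
    IsReduced p (rhs η p) f ↔ f = fullJet η p (param p f) := by
  constructor
  · intro h
    have : (fun τ : principal p => rhs η p τ (param p f)) = fun τ => f τ.1 :=
      funext fun τ => (h τ).symm
    rw [fullJet, this, joinJet_param]
  · intro h τ
    have := congrFun h τ.1
    rwa [fullJet, joinJet, dif_neg τ.2] at this

theorem isLinearWDVV_iff_isReduced (hsymm : η.IsSymm) (hdet : η.det ≠ 0) (p : Fin r)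
    (f : Jet r 3) (hf : param p f ∈ regularLocus η p) :
    IsLinearWDVV η p f ↔ IsReduced p (rhs η p) f := by
  rw [isReduced_iff, fullJet_eq_solJet hsymm hdet p hf]
  exact isLinearWDVV_iff_eq_solJet hsymm hdet p f ((mem_regularLocus_iff p _ hsymm hdet).1 hf)

theorem isWDVV_iff_isReduced (hsymm : η.IsSymm) (hdet : η.det ≠ 0) (p : Fin r)
    (f : Jet r 3) (hf : param p f ∈ regularLocus η p) :
    IsWDVV η f ↔ IsReduced p (rhs η p) f := by
  constructor
  · intro h
    rw [← isLinearWDVV_iff_isReduced hsymm hdet p f hf]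
    exact fun m a b _ _ => h _ _ _ _
  · intro h
    rw [(isReduced_iff p f).1 h]
    exact isWDVV_fullJet hsymm hdet p hf

/-! ### Tangent vectors of the WDVV variety -/

/-- The first variation of the multiplication operators. -/
def dOp (η : Matrix (Fin (r + 1)) (Fin (r + 1)) ℝ) (h : Jet r 3) (α : Fin (r + 1)) :
    Matrix (Fin (r + 1)) (Fin (r + 1)) ℝ :=
  Fin.cases 0 (fun l => symOp η (param l h)) α

theorem mulOp_line (hdet : η.det ≠ 0) (f h : Jet r 3) (t : ℝ) (α : Fin (r + 1)) :
    mulOp η (f + t • h) α = mulOp η f α + t • dOp η h α := by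
  cases α using Fin.cases with
  | zero => simp [mulOp_zero hdet, dOp]
  | succ l =>
    rw [mulOp_add, dOp, Fin.cases_succ, ← map_smul]
    rfl

/-- S is quadratic in the operators, which are affine in the jet; the derivative is the linear
coefficient of a quadratic polynomial in t. -/
theorem lineDeriv_S (hsymm : η.IsSymm) (hdet : η.det ≠ 0) (f h : Jet r 3)
    (α β γ ν : Fin (r + 1)) :
    lineDeriv ℝ (fun f' => S η f' α β γ ν) f h =
      (η * (⁅dOp η h α, mulOp η f γ⁆ + ⁅mulOp η f α, dOp η h γ⁆)) β ν := by
  have key : (fun t : ℝ => S η (f + t • h) α β γ ν) = fun t =>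
      (η * ⁅mulOp η f α, mulOp η f γ⁆) β ν +
      t * (η * (⁅dOp η h α, mulOp η f γ⁆ + ⁅mulOp η f α, dOp η h γ⁆)) β ν +
      t ^ 2 * (η * ⁅dOp η h α, dOp η h γ⁆) β ν := by
    funext t
    have e : ∀ A B D E : Matrix (Fin (r + 1)) (Fin (r + 1)) ℝ,
        η * ⁅A + t • D, B + t • E⁆ =
          η * ⁅A, B⁆ + t • (η * (⁅D, B⁆ + ⁅A, E⁆)) + t ^ 2 • (η * ⁅D, E⁆) := by
      intro A B D E
      simp only [Ring.lie_def, mul_add, add_mul, mul_sub, mul_smul_comm, smul_mul_assoc, smul_add,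
        smul_sub, smul_smul, pow_two]
      abel
    rw [S_eq_lie hsymm hdet, mulOp_line hdet, mulOp_line hdet, e]
    rfl
  have quad : ∀ a b c : ℝ, deriv (fun t : ℝ => a + t * b + t ^ 2 * c) 0 = b := by
    intro a b c
    have h1 : HasDerivAt (fun t : ℝ => a + t * b + t ^ 2 * c)
        (1 * b + (2 * (0 : ℝ) ^ 1 * 1) * c) 0 :=
      (((hasDerivAt_id' (0 : ℝ)).mul_const b).const_add a).add
        (((hasDerivAt_id' (0 : ℝ)).pow 2).mul_const c)
    simpa using h1.deriv
  rw [lineDeriv, key, quad]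

theorem lineDeriv_S_eq_zero_iff (hsymm : η.IsSymm) (hdet : η.det ≠ 0) (f h : Jet r 3) :
    (∀ α β γ ν, lineDeriv ℝ (fun f' => S η f' α β γ ν) f h = 0) ↔
      ∀ α γ, ⁅dOp η h α, mulOp η f γ⁆ + ⁅mulOp η f α, dOp η h γ⁆ = 0 := by
  simp only [lineDeriv_S hsymm hdet]
  refine ⟨fun H α γ => eta_mul_cancel hdet ?_, fun H α β γ ν => ?_⟩
  · ext β ν
    rw [H α β γ ν, mul_zero, Matrix.zero_apply]
  · rw [H, mul_zero, Matrix.zero_apply]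

theorem symOp_injective (hdet : η.det ≠ 0) : Function.Injective (symOp η) := by
  intro x y hxy
  funext I
  obtain ⟨i, j, rfl⟩ := exists_eq_pair I
  have h : η * symOp η x = η * symOp η y := by rw [hxy]
  rw [symOp_apply, symOp_apply, ← mul_assoc, ← mul_assoc, eta_mul_inv hdet, one_mul, one_mul] at h
  exact congrFun₂ h i.succ j.succ

theorem symOp_apply_zero (x : Jet r 2) (α : Fin (r + 1)) : symOp η x α 0 = 0 := by
  rw [symOp_apply, Matrix.mul_apply]
  simp

/-- On the regular locus, the commutator with the `p`-th multiplication operator is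
injective. -/
theorem symOp_lie_injective (hsymm : η.IsSymm) (hdet : η.det ≠ 0) (p : Fin r) {u : Jet r 2}
    (hu : u ∈ regularLocus η p) {x y : Jet r 2}
    (h : ⁅symOp η x, sliceOp η p u⁆ = ⁅symOp η y, sliceOp η p u⁆) : x = y := by
  refine symOp_injective hdet (sub_eq_zero.1 ?_)
  refine eq_zero_of_commute_cyclic ((mem_regularLocus_iff p u hsymm hdet).1 hu) ?_ fun α => ?_
  · rw [Ring.lie_def, Ring.lie_def] at h
    rw [Commute, SemiconjBy, sub_mul, mul_sub, sub_eq_sub_iff_sub_eq_sub]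
    exact h
  · rw [Matrix.sub_apply, symOp_apply_zero, symOp_apply_zero, sub_zero]

/-- The derivative of all third derivatives as functions of the parametric ones. -/
def dFullJet (η : Matrix (Fin (r + 1)) (Fin (r + 1)) ℝ) (p : Fin r) (u x : Jet r 2) : Jet r 3 :=
  fun τ => lineDeriv ℝ (fun v => fullJet η p v τ) u x

section

-- A submultiplicative matrix norm makes the product rule available for matrix-valued curves.
attribute [local instance] Matrix.linftyOpNormedRing Matrix.linftyOpNormedAlgebra

theorem hasDerivAt_fullJet (hsymm : η.IsSymm) (hdet : η.det ≠ 0) (p : Fin r) {u : Jet r 2}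
    (hu : u ∈ regularLocus η p) (x : Jet r 2) (α : Fin (r + 1)) :
    HasDerivAt (fun t : ℝ => mulOp η (fullJet η p (u + t • x)) α)
      (dOp η (dFullJet η p u x) α) 0 := by
  cases α using Fin.cases with
  | zero =>
    simp only [mulOp_zero hdet]
    exact hasDerivAt_const _ _
  | succ l =>
    simp only [mulOp_succ, sliceOp]
    refine HasDerivAt.const_add _ ?_
    have h1 : HasDerivAt (fun t : ℝ => param l (fullJet η p (u + t • x)))
        (param l (dFullJet η p u x)) 0 := by
      rw [hasDerivAt_pi]
      intro I
      exact (differentiableAt_flux hsymm hdet p l I hu).lineDifferentiableAt.hasLineDerivAt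
    exact (symOp η).toContinuousLinearMap.hasFDerivAt.comp_hasDerivAt 0 h1

/-- Since U is open, the jets over u + t x stay on the WDVV variety for small t; the relation is the
derivative of [C_α, C_γ] = 0 at t = 0. -/
theorem tangent_dFullJet (hsymm : η.IsSymm) (hdet : η.det ≠ 0) (p : Fin r) {u : Jet r 2}
    (hu : u ∈ regularLocus η p) (x : Jet r 2) (α γ : Fin (r + 1)) :
    ⁅dOp η (dFullJet η p u x) α, mulOp η (fullJet η p u) γ⁆ +
      ⁅mulOp η (fullJet η p u) α, dOp η (dFullJet η p u x) γ⁆ = 0 := by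
  have h1 := hasDerivAt_fullJet hsymm hdet p hu x α
  have h2 := hasDerivAt_fullJet hsymm hdet p hu x γ
  have h3 := (h1.mul h2).sub (h2.mul h1)
  have h4 : HasDerivAt (fun t : ℝ => ⁅mulOp η (fullJet η p (u + t • x)) α,
      mulOp η (fullJet η p (u + t • x)) γ⁆) 0 0 := by
    refine (hasDerivAt_const (0 : ℝ)
      (0 : Matrix (Fin (r + 1)) (Fin (r + 1)) ℝ)).congr_of_eventuallyEq ?_
    have hc : Continuous fun t : ℝ => u + t • x := by fun_prop
    have h0 : (fun t : ℝ => u + t • x) ⁻¹' regularLocus η p ∈ nhds (0 : ℝ) := by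
      refine ((isOpen_regularLocus hsymm hdet p).preimage hc).mem_nhds ?_
      rw [Set.mem_preimage, zero_smul, add_zero]
      exact hu
    filter_upwards [h0] with t ht
    exact (isWDVV_iff hsymm hdet _).1 (isWDVV_fullJet hsymm hdet p ht) α γ
  have h5 := h3.unique h4
  simp only [zero_smul, add_zero] at h5
  rw [← h5, Ring.lie_def, Ring.lie_def]
  abel

end

theorem tangent_of_isProlonged (hsymm : η.IsSymm) (hdet : η.det ≠ 0) {f : Jet r 3}
    {h : Fin r → Jet r 3} (hfh : IsProlonged η f h) (l : Fin r) (a b : Fin r) :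
    ⁅symOp η (param a (h l)), mulOp η f b.succ⁆ +
      ⁅mulOp η f a.succ, symOp η (param b (h l))⁆ = 0 :=
  (lineDeriv_S_eq_zero_iff hsymm hdet f (h l)).1 (hfh.2 l) a.succ b.succ

theorem tangent_flux (hsymm : η.IsSymm) (hdet : η.det ≠ 0) (p : Fin r) {u : Jet r 2}
    (hu : u ∈ regularLocus η p) (x : Jet r 2) (a b : Fin r) :
    ⁅symOp η (fun I => lineDeriv ℝ (flux p (rhs η p) a I) u x),
        mulOp η (fullJet η p u) b.succ⁆ +
      ⁅mulOp η (fullJet η p u) a.succ,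
        symOp η (fun I => lineDeriv ℝ (flux p (rhs η p) b I) u x)⁆ = 0 :=
  tangent_dFullJet hsymm hdet p hu x a.succ b.succ

theorem lineDeriv_flux_self (p : Fin r) (G : principal p → Jet r 2 → ℝ) (u x : Jet r 2) :
    (fun I => lineDeriv ℝ (flux p G p I) u x) = x := by
  funext I
  have : flux p G p I = fun u => u I := funext fun u => flux_self p G I u
  rw [this]
  change deriv (fun t : ℝ => u I + t * x I) 0 = _
  simp

theorem mulOp_fullJet_self (p : Fin r) (u : Jet r 2) :
    mulOp η (fullJet η p u) p.succ = sliceOp η p u := by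
  rw [mulOp_succ, param_fullJet_self]

/-- The Jacobian matrices of the fluxes commute. -/
theorem lineDeriv_flux_comm (hsymm : η.IsSymm) (hdet : η.det ≠ 0) (p : Fin r) {u : Jet r 2}
    (hu : u ∈ regularLocus η p) (x : Jet r 2) (l m : Fin r) (I : Sym (Fin r) 2) :
    lineDeriv ℝ (flux p (rhs η p) l I) u (fun J => lineDeriv ℝ (flux p (rhs η p) m J) u x) =
      lineDeriv ℝ (flux p (rhs η p) m I) u (fun J => lineDeriv ℝ (flux p (rhs η p) l J) u x) := by
  have hl := tangent_flux hsymm hdet p hu (fun J => lineDeriv ℝ (flux p (rhs η p) m J) u x) l p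
  have hm := tangent_flux hsymm hdet p hu (fun J => lineDeriv ℝ (flux p (rhs η p) l J) u x) m p
  have hlm := tangent_flux hsymm hdet p hu x l m
  rw [lineDeriv_flux_self, mulOp_fullJet_self] at hl hm
  -- By tangency for (l, p), the commutator of E(V_l′V_m′x) with L is −[C_l, E(V_m′x)]; tangency for
  -- (l, m) along x makes this symmetric in l and m.
  refine congrFun (symOp_lie_injective hsymm hdet p hu
    (x := fun I => lineDeriv ℝ (flux p (rhs η p) l I) u
      fun J => lineDeriv ℝ (flux p (rhs η p) m J) u x)
    (y := fun I => lineDeriv ℝ (flux p (rhs η p) m I) u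
      fun J => lineDeriv ℝ (flux p (rhs η p) l J) u x) ?_) I
  rw [eq_neg_of_add_eq_zero_left hl, eq_neg_of_add_eq_zero_left hm]
  rw [← eq_neg_of_add_eq_zero_left hlm, Ring.lie_def, Ring.lie_def, neg_sub]

/-- On the prolonged system, holonomic jets are those that satisfy the first-order systems. -/
theorem isHolonomic_iff_satisfiesSystems (hsymm : η.IsSymm) (hdet : η.det ≠ 0) (p : Fin r)
    (f : Jet r 3) (h : Fin r → Jet r 3) (hf : param p f ∈ regularLocus η p)
    (hfh : IsProlonged η f h) :
    IsHolonomic h ↔ SatisfiesSystems p (rhs η p) f h := by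
  have hff : f = fullJet η p (param p f) :=
    (isReduced_iff p f).1 ((isWDVV_iff_isReduced hsymm hdet p f hf).1 hfh.1)
  have htan := tangent_of_isProlonged hsymm hdet hfh
  have hL : mulOp η f p.succ = sliceOp η p (param p f) := mulOp_succ η f p
  -- Both sides have the same commutator with L, by the tangency relations for (l, p) along x^p. So
  -- the right-hand side of the l-th system is just a coordinate of h.
  have hder : ∀ l I, fderiv ℝ (flux p (rhs η p) l I) (param p f) (param p (h p)) =
      h p (l ::ₛ I) := by
    intro l I
    rw [← (differentiableAt_flux hsymm hdet p l I hf).lineDeriv_eq_fderiv]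
    have h1 := tangent_flux hsymm hdet p hf (param p (h p)) l p
    have h2 := htan p l p
    rw [lineDeriv_flux_self, ← hff, hL] at h1
    rw [hL] at h2
    refine congrFun (symOp_lie_injective hsymm hdet p hf
      (x := fun I => lineDeriv ℝ (flux p (rhs η p) l I) (param p f) (param p (h p)))
      (y := param l (h p)) ?_) I
    rw [eq_neg_of_add_eq_zero_left h1, eq_neg_of_add_eq_zero_left h2]
  have hsys : SatisfiesSystems p (rhs η p) f h ↔ ∀ l, param p (h l) = param l (h p) := by
    simp only [SatisfiesSystems, hder]
    refine ⟨fun H l => ?_, fun H l _ I => congrFun (H l) I⟩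
    by_cases hl : l = p
    · rw [hl]
    · exact funext fun I => H l hl I
  rw [hsys]
  refine ⟨fun H l => funext fun I => H l p I, fun H l m I => ?_⟩
  -- Once (u^I)_l is replaced by (u^I_l)_p, the commutator of either side with L is −[C_m,
  -- E((f_{lI})_p)] or its mirror under l ↔ m; the tangency relation along x^p equates them.
  have h1 := htan l m p
  have h2 := htan m l p
  have h3 := htan p l m
  rw [hL, H] at h1 h2
  refine congrFun (symOp_lie_injective hsymm hdet p hf (x := param m (h l))
    (y := param l (h m)) ?_) I
  rw [eq_neg_of_add_eq_zero_left h1, eq_neg_of_add_eq_zero_left h2,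
    ← eq_neg_of_add_eq_zero_left h3, Ring.lie_def, Ring.lie_def, neg_sub]

/-! ### Passivity -/

theorem restrictedD_flux_comm (hsymm : η.IsSymm) (hdet : η.det ≠ 0) (p l m : Fin r)
    (I : Sym (Fin r) 2) (z : InfJet (Sym (Fin r) 2)) (hz : z 0 ∈ regularLocus η p) :
    restrictedD p (rhs η p) m (fun y => flux p (rhs η p) l I (y 0)) z =
      restrictedD p (rhs η p) l (fun y => flux p (rhs η p) m I (y 0)) z := by
  rw [restrictedD, restrictedD, evol_apply, evol_apply]
  exact lineDeriv_flux_comm hsymm hdet p hz (z 1) l m I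

theorem isRegular_foldr (hsymm : η.IsSymm) (hdet : η.det ≠ 0) (p : Fin r) (a : List (Fin r))
    {g : InfJet (Sym (Fin r) 2) → ℝ} (hg : IsRegular (regularLocus η p) g) :
    IsRegular (regularLocus η p) (a.foldr (restrictedD p (rhs η p)) g) := by
  induction a with
  | nil => exact hg
  | cons l a ih =>
    exact ih.evol (isOpen_regularLocus hsymm hdet p) (isRegular_flux hsymm hdet p l)

theorem foldr_congr (hsymm : η.IsSymm) (hdet : η.det ≠ 0) (p : Fin r) (a : List (Fin r))
    {g h : InfJet (Sym (Fin r) 2) → ℝ} (hgh : ∀ z, z 0 ∈ regularLocus η p → g z = h z)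
    {z : InfJet (Sym (Fin r) 2)} (hz : z 0 ∈ regularLocus η p) :
    a.foldr (restrictedD p (rhs η p)) g z = a.foldr (restrictedD p (rhs η p)) h z := by
  induction a generalizing z with
  | nil => exact hgh z hz
  | cons l a ih => exact evol_congr (isOpen_regularLocus hsymm hdet p) _ (fun z hz => ih hz) hz

theorem foldr_perm (hsymm : η.IsSymm) (hdet : η.det ≠ 0) (p : Fin r) {a b : List (Fin r)}
    (hab : a.Perm b) {g : InfJet (Sym (Fin r) 2) → ℝ} (hg : IsRegular (regularLocus η p) g)
    {z : InfJet (Sym (Fin r) 2)} (hz : z 0 ∈ regularLocus η p) :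
    a.foldr (restrictedD p (rhs η p)) g z = b.foldr (restrictedD p (rhs η p)) g z := by
  have hU := isOpen_regularLocus hsymm hdet p
  induction hab generalizing z with
  | nil => rfl
  | cons l _ ih => exact evol_congr hU _ (fun z hz => ih hz) hz
  | swap l m a =>
    exact evol_comm hU (isRegular_flux hsymm hdet p m) (isRegular_flux hsymm hdet p l)
      (fun I z hz => restrictedD_flux_comm hsymm hdet p l m I z hz)
      (isRegular_foldr hsymm hdet p a hg) hz
  | trans _ _ ih₁ ih₂ => exact (ih₁ hz).trans (ih₂ hz)

/-- A derivative of order at least three, expressed through the parametric derivatives, does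
not depend on the third derivative from which it is computed. -/
theorem foldr_fullJet_congr (hsymm : η.IsSymm) (hdet : η.det ≠ 0) (p : Fin r)
    (a b : List (Fin r)) (σ τ : Sym (Fin r) 3)
    (h : (a : Multiset (Fin r)) + (σ : Multiset (Fin r)) =
      (b : Multiset (Fin r)) + (τ : Multiset (Fin r)))
    {z : InfJet (Sym (Fin r) 2)} (hz : z 0 ∈ regularLocus η p) :
    a.foldr (restrictedD p (rhs η p)) (fun y => fullJet η p (y 0) σ) z =
      b.foldr (restrictedD p (rhs η p)) (fun y => fullJet η p (y 0) τ) z := by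
  have hU := isOpen_regularLocus hsymm hdet p
  have hreg : ∀ τ : Sym (Fin r) 3,
      IsRegular (regularLocus η p) fun y => fullJet η p (y 0) τ := by
    intro τ
    obtain ⟨l, I, rfl⟩ := τ.exists_eq_cons_of_succ
    exact isRegular_flux hsymm hdet p l I
  have hlen : a.length = b.length := by
    have := congrArg Multiset.card h
    simpa using this
  induction a generalizing b τ z with
  | nil =>
    obtain rfl : b = [] := List.length_eq_zero_iff.1 hlen.symm
    have : σ = τ := Sym.coe_injective (by simpa using h)
    rw [this]
  | cons l a ih =>
    -- If l occurs in b, it can be moved to the front because restricted derivatives commute, and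
    -- the induction hypothesis applies below it.
    have main : ∀ (b : List (Fin r)) (τ : Sym (Fin r) 3), l ∈ b →
        ((l :: a : List (Fin r)) : Multiset (Fin r)) + (σ : Multiset (Fin r)) =
          (b : Multiset (Fin r)) + (τ : Multiset (Fin r)) →
        (l :: a).foldr (restrictedD p (rhs η p)) (fun y => fullJet η p (y 0) σ) z =
          b.foldr (restrictedD p (rhs η p)) (fun y => fullJet η p (y 0) τ) z := by
      intro b τ hlb hb
      have hperm := List.perm_cons_erase hlb
      rw [foldr_perm hsymm hdet p hperm (hreg τ) hz]
      have hb' : (a : Multiset (Fin r)) + (σ : Multiset (Fin r)) =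
          (b.erase l : List (Fin r)) + (τ : Multiset (Fin r)) := by
        rw [Multiset.coe_eq_coe.2 hperm, ← Multiset.cons_coe, ← Multiset.cons_coe,
          Multiset.cons_add, Multiset.cons_add] at hb
        exact (Multiset.cons_inj_right l).1 hb
      have hlen' : a.length = (b.erase l).length := by
        have := congrArg Multiset.card hb'
        simpa using this
      exact evol_congr hU _ (fun z hz => ih _ _ hb' hz hlen') hz
    by_cases hlb : l ∈ b
    · exact main b τ hlb h
    · have hlτ : l ∈ τ := by
        have : l ∈ (b : Multiset (Fin r)) + (τ : Multiset (Fin r)) := by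
          rw [← h]
          simp
        exact (Multiset.mem_add.1 this).resolve_left (by simpa using hlb)
      obtain ⟨J, rfl⟩ : ∃ J : Sym (Fin r) 2, τ = l ::ₛ J :=
        ⟨τ.erase l hlτ, (Sym.cons_erase hlτ).symm⟩
      -- Otherwise l occurs in τ = lJ. The innermost derivative ∂_m is exchanged with it by ∂_m
      -- f_{lJ} = ∂_l f_{mJ}, after which l does occur in the list.
      obtain ⟨b, m, rfl⟩ : ∃ b' m, b = b' ++ [m] := by
        rcases List.eq_nil_or_concat b with rfl | ⟨b', m, hb⟩
        · simp at hlen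
        · exact ⟨b', m, by simpa using hb⟩
      rw [main (b ++ [l]) (m ::ₛ J) (by simp) ?_, List.foldr_append, List.foldr_append]
      · exact foldr_congr hsymm hdet p b
          (fun z hz => restrictedD_flux_comm hsymm hdet p m l J z hz) hz
      · rw [h, ← Multiset.coe_add, ← Multiset.coe_add, add_assoc, add_assoc]
        congr 1
        change ({m} : Multiset (Fin r)) + l ::ₘ (J : Multiset (Fin r)) =
          {l} + m ::ₘ (J : Multiset (Fin r))
        rw [Multiset.singleton_add, Multiset.singleton_add, Multiset.cons_swap]

theorem isPassive_rhs (hsymm : η.IsSymm) (hdet : η.det ≠ 0) (p : Fin r) :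
    IsPassive p (rhs η p) (regularLocus η p) := by
  intro a b σ τ h z hz
  have hG : ∀ τ : principal p, (fun y : InfJet (Sym (Fin r) 2) => rhs η p τ (y 0)) =
      fun y => fullJet η p (y 0) τ := by
    intro τ
    funext y
    rw [fullJet, joinJet, dif_neg τ.2]
  rw [hG, hG]
  exact foldr_fullJet_congr hsymm hdet p a b σ τ h hz

theorem flowsCommute_flux (hsymm : η.IsSymm) (hdet : η.det ≠ 0) (p l m : Fin r) :
    FlowsCommute (regularLocus η p) (flux p (rhs η p) l) (flux p (rhs η p) m) :=
  flowsCommute_of_evol (isOpen_regularLocus hsymm hdet p) (isRegular_flux hsymm hdet p l)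
    (isRegular_flux hsymm hdet p m)
    fun I z hz => restrictedD_flux_comm hsymm hdet p m l I z hz

end WDVV

namespace WDVV

/-! ### Functions -/

variable {r : ℕ} {M : Set (Fin r → ℝ)}

theorem pd_congr (hM : IsOpen M) (i : Fin r) {f g : (Fin r → ℝ) → ℝ} (hfg : Set.EqOn f g M) :
    Set.EqOn (pd i f) (pd i g) M := by
  intro t ht
  rw [pd, pd, Filter.EventuallyEq.fderiv_eq (Filter.mem_of_superset (hM.mem_nhds ht) hfg)]

theorem contDiffOn_pd (hM : IsOpen M) (i : Fin r) {f : (Fin r → ℝ) → ℝ} {n : ℕ}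
    (hf : ContDiffOn ℝ (n + 1 : ℕ) f M) : ContDiffOn ℝ n (pd i f) M :=
  (hf.fderiv_of_isOpen hM (by norm_cast)).clm_apply contDiffOn_const

theorem pd_comm (hM : IsOpen M) (i j : Fin r) {f : (Fin r → ℝ) → ℝ}
    (hf : ContDiffOn ℝ 2 f M) : Set.EqOn (pd i (pd j f)) (pd j (pd i f)) M := by
  intro t ht
  have hft : ContDiffAt ℝ 2 f t := hf.contDiffAt (hM.mem_nhds ht)
  have hd : DifferentiableAt ℝ (fderiv ℝ f) t :=
    (hft.fderiv_right (m := 1) (by norm_num)).differentiableAt (by norm_num)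
  have key : ∀ i j, pd i (pd j f) t =
      fderiv ℝ (fderiv ℝ f) t (Pi.single i 1) (Pi.single j 1) := by
    intro i j
    change fderiv ℝ (fun s => fderiv ℝ f s (Pi.single j 1)) t (Pi.single i 1) = _
    rw [fderiv_clm_apply hd (by fun_prop)]
    simp
  rw [key, key]
  exact hft.isSymmSndFDerivAt (by simp) _ _

theorem contDiffOn_foldr_pd (hM : IsOpen M) (a : List (Fin r)) {f : (Fin r → ℝ) → ℝ} {n : ℕ}
    (hf : ContDiffOn ℝ (n + a.length : ℕ) f M) : ContDiffOn ℝ n (a.foldr pd f) M := by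
  induction a generalizing n with
  | nil => exact hf
  | cons i a ih =>
    refine contDiffOn_pd hM i (ih ?_)
    rwa [List.length_cons, ← add_assoc, add_right_comm] at hf

theorem foldr_pd_perm (hM : IsOpen M) {a b : List (Fin r)} (hab : a.Perm b)
    {f : (Fin r → ℝ) → ℝ} (hf : ContDiffOn ℝ a.length f M) :
    Set.EqOn (a.foldr pd f) (b.foldr pd f) M := by
  induction hab with
  | nil => exact fun t _ => rfl
  | cons i _ ih => exact pd_congr hM i (ih (hf.of_le (by simp)))
  | swap i j a =>
    refine pd_comm hM j i (contDiffOn_foldr_pd hM a (n := 2) (hf.of_le ?_))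
    simp [add_comm 2, add_assoc]
  | trans h₁ _ ih₁ ih₂ => exact (ih₁ hf).trans (ih₂ (by rwa [← h₁.length_eq]))

theorem jet3_cons (hM : IsOpen M) {f : (Fin r → ℝ) → ℝ} (hf : ContDiffOn ℝ 3 f M)
    (i j k : Fin r) :
    Set.EqOn (fun t => jet3 f t (i ::ₛ j ::ₛ k ::ₛ Sym.nil)) (pd i (pd j (pd k f))) M := by
  have hperm : (((i ::ₛ j ::ₛ k ::ₛ Sym.nil : Sym (Fin r) 3) : Multiset (Fin r)).toList).Perm
      [i, j, k] := by
    rw [← Multiset.coe_eq_coe, Multiset.coe_toList]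
    rfl
  refine foldr_pd_perm hM hperm (hf.of_le ?_)
  rw [hperm.length_eq]
  rfl

theorem pd_jet3_comm (hM : IsOpen M) {f : (Fin r → ℝ) → ℝ} (hf : ContDiffOn ℝ 4 f M)
    (l p : Fin r) (I : Sym (Fin r) 2) :
    Set.EqOn (pd l fun s => jet3 f s (p ::ₛ I)) (pd p fun s => jet3 f s (l ::ₛ I)) M := by
  obtain ⟨i, j, rfl⟩ := exists_eq_pair I
  have hf3 : ContDiffOn ℝ 3 f M := hf.of_le (by norm_num)
  refine (pd_congr hM l (jet3_cons hM hf3 p i j)).trans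
    (Set.EqOn.trans ?_ (pd_congr hM p (jet3_cons hM hf3 l i j)).symm)
  exact pd_comm hM l p (contDiffOn_foldr_pd hM [i, j] (n := 2) hf)

/-- Along a solution the flux equals f_{lI}, so the conservation law is equality of mixed partial
derivatives of f. -/
theorem pd_param_eq_pd_flux {η : Matrix (Fin (r + 1)) (Fin (r + 1)) ℝ} (hsymm : η.IsSymm)
    (hdet : η.det ≠ 0) (p : Fin r) (hM : IsOpen M) {f : (Fin r → ℝ) → ℝ}
    (hf : ContDiffOn ℝ 4 f M) (hreg : ∀ t ∈ M, param p (jet3 f t) ∈ regularLocus η p)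
    (hW : ∀ t ∈ M, IsWDVV η (jet3 f t)) (l : Fin r) (I : Sym (Fin r) 2) {t : Fin r → ℝ}
    (ht : t ∈ M) :
    pd l (fun s => param p (jet3 f s) I) t =
      pd p (fun s => flux p (rhs η p) l I (param p (jet3 f s))) t := by
  rw [pd_congr hM p (g := fun s => jet3 f s (l ::ₛ I)) ?_ ht]
  · exact pd_jet3_comm hM hf l p I ht
  · intro s hs
    have := (isReduced_iff p _).1
      ((isWDVV_iff_isReduced hsymm hdet p _ (hreg s hs)).1 (hW s hs))
    exact (congrFun this (l ::ₛ I)).symm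

end WDVV

namespace WDVV

/-! ### Third-order operators of commutator type -/

section Algebra

variable {𝔸 : Type*} [NormedRing 𝔸] [NormedAlgebra ℝ 𝔸]

theorem trace_lie_mul {tr : 𝔸 →L[ℝ] ℝ}
    (htr : ∀ a b, tr (a * b) = tr (b * a)) (X T W : 𝔸) :
    tr (⁅X, T⁆ * W) = tr (T * ⁅W, X⁆) := by
  have h := htr X (T * W)
  simp only [Ring.lie_def, sub_mul, mul_sub, map_sub, mul_assoc] at h ⊢
  rw [h]

/-- The Jacobi identity paired with a fourth element. -/
theorem trace_lie_cyclic {tr : 𝔸 →L[ℝ] ℝ}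
    (htr : ∀ a b, tr (a * b) = tr (b * a)) (X Y Z T : 𝔸) :
    tr (⁅X, T⁆ * ⁅Y, Z⁆) + tr (⁅Y, T⁆ * ⁅Z, X⁆) + tr (⁅Z, T⁆ * ⁅X, Y⁆) = 0 := by
  rw [trace_lie_mul htr, trace_lie_mul htr, trace_lie_mul htr, ← map_add, ← map_add, ← mul_add,
    ← mul_add]
  have : ⁅⁅Y, Z⁆, X⁆ + ⁅⁅Z, X⁆, Y⁆ + ⁅⁅X, Y⁆, Z⁆ = 0 := by
    simp only [Ring.lie_def]
    noncomm_ring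
  rw [this, mul_zero, map_zero]

theorem hasDerivAt_lie {f g : ℝ → 𝔸} {f' g' : 𝔸} {x : ℝ} (hf : HasDerivAt f f' x)
    (hg : HasDerivAt g g' x) :
    HasDerivAt (fun t => ⁅f t, g t⁆) (⁅f', g x⁆ + ⁅f x, g'⁆) x := by
  have h := (hf.mul hg).sub (hg.mul hf)
  refine h.congr_deriv ?_
  simp only [Ring.lie_def]
  abel

theorem hasDerivAt_trace_mul (tr : 𝔸 →L[ℝ] ℝ) {f g : ℝ → 𝔸} {f' g' : 𝔸} {x : ℝ}
    (hf : HasDerivAt f f' x) (hg : HasDerivAt g g' x) :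
    HasDerivAt (fun t => tr (f t * g t)) (tr (f' * g x) + tr (f x * g')) x := by
  have h := tr.hasFDerivAt.comp_hasDerivAt x (hf.mul hg)
  rwa [map_add] at h

variable {ι : Type} [Fintype ι] [DecidableEq ι]
variable (tr : 𝔸 →L[ℝ] ℝ) (E : (ι → ℝ) →L[ℝ] 𝔸) (L₀ : 𝔸)

/-- The linear map `x ↦ [E x, S]`. -/
def lieMap (S : 𝔸) : (ι → ℝ) →ₗ[ℝ] 𝔸 where
  toFun x := ⁅E x, S⁆
  map_add' x y := by
    simp only [Ring.lie_def, map_add, add_mul, mul_add]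
    abel
  map_smul' c x := by
    simp only [Ring.lie_def, map_smul, smul_mul_assoc, mul_smul_comm, smul_sub, RingHom.id_apply]

/-- The matrix of `(x, y) ↦ tr ([x, S] [y, T])`. -/
def lieMatrix (S T : 𝔸) : Matrix ι ι ℝ :=
  Matrix.of fun i j => tr (⁅E (Pi.single i 1), S⁆ * ⁅E (Pi.single j 1), T⁆)

theorem dotProduct_lieMatrix (S T : 𝔸) (x y : ι → ℝ) :
    dotProduct x ((lieMatrix tr E S T).mulVec y) = tr (⁅E x, S⁆ * ⁅E y, T⁆) := by
  have h : lieMatrix tr E S T = LinearMap.BilinForm.toMatrix'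
      (((LinearMap.mul ℝ 𝔸).compl₁₂ (lieMap E S) (lieMap E T)).compr₂ (tr : 𝔸 →ₗ[ℝ] ℝ)) := by
    ext i j
    rw [LinearMap.BilinForm.toMatrix'_apply]
    rfl
  rw [h, ← Matrix.toBilin'_apply', Matrix.toBilin'_toMatrix']
  rfl

/-- The covariant metric `g_{ij} = tr ([E_i, L] [E_j, L])` with `L = L₀ + E u`. -/
def covMetric (u : ι → ℝ) : Matrix ι ι ℝ := lieMatrix tr E (L₀ + E u) (L₀ + E u)

/-- The contravariant metric. -/
def conMetric (u : ι → ℝ) : Matrix ι ι ℝ := (covMetric tr E L₀ u)⁻¹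

/-- The coefficients `c^{ij}_k` of the operator. -/
def conCoeff (u : ι → ℝ) (i j k : ι) : ℝ :=
  -(conMetric tr E L₀ u * lieMatrix tr E (E (Pi.single k 1)) (L₀ + E u) *
    conMetric tr E L₀ u) i j

/-- The operator `g^{ij} D + c^{ij}_k u^k_x` applied to `w`, as a function of `u`, `q = u_x`,
`w` and `w' = w_x`. -/
def midOp (u q w w' : ι → ℝ) (i : ι) : ℝ :=
  ∑ j, (conMetric tr E L₀ u i j * w' j + (∑ k, conCoeff tr E L₀ u i j k * q k) * w j)

theorem covMetric_symm (htr : ∀ a b, tr (a * b) = tr (b * a)) (u : ι → ℝ) :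
    (covMetric tr E L₀ u).IsSymm := by
  ext i j
  exact htr _ _

theorem conMetric_symm (htr : ∀ a b, tr (a * b) = tr (b * a)) (u : ι → ℝ) :
    (conMetric tr E L₀ u).IsSymm := by
  rw [Matrix.IsSymm, conMetric, Matrix.transpose_nonsing_inv, (covMetric_symm tr E L₀ htr u).eq]

theorem midOp_eq (u q w w' : ι → ℝ) :
    midOp tr E L₀ u q w w' = (conMetric tr E L₀ u).mulVec
      (w' - (lieMatrix tr E (E q) (L₀ + E u)).mulVec ((conMetric tr E L₀ u).mulVec w)) := by
  have hq : lieMatrix tr E (E q) (L₀ + E u) =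
      ∑ k, q k • lieMatrix tr E (E (Pi.single k 1)) (L₀ + E u) := by
    ext i j
    rw [Matrix.sum_apply]
    simp only [lieMatrix, Matrix.of_apply, Matrix.smul_apply, smul_eq_mul]
    conv_lhs => rw [pi_eq_sum_univ' q]
    simp only [Ring.lie_def, map_sum, map_smul, Finset.mul_sum, Finset.sum_mul, mul_smul_comm,
      smul_mul_assoc, ← Finset.sum_sub_distrib, ← smul_sub, smul_eq_mul]
  funext i
  rw [Matrix.mulVec_sub, Matrix.mulVec_mulVec, Matrix.mulVec_mulVec, hq]
  simp only [midOp, Finset.sum_add_distrib, Pi.sub_apply]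
  rw [sub_eq_add_neg]
  congr 1
  simp only [Matrix.mulVec, dotProduct, Finset.mul_sum, Finset.sum_mul, Matrix.sum_apply,
    ← Finset.sum_neg_distrib, conCoeff]
  refine Finset.sum_congr rfl fun j _ => Finset.sum_congr rfl fun k _ => ?_
  simp only [mul_smul_comm, smul_mul_assoc, Matrix.smul_apply, smul_eq_mul]
  ring

variable {tr E L₀} {u : ι → ℝ}

theorem cov_mul_con (hu : (covMetric tr E L₀ u).det ≠ 0) :
    covMetric tr E L₀ u * conMetric tr E L₀ u = 1 :=
  Matrix.mul_nonsing_inv _ (isUnit_iff_ne_zero.2 hu)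

theorem det_conMetric_ne_zero (hu : (covMetric tr E L₀ u).det ≠ 0) :
    (conMetric tr E L₀ u).det ≠ 0 := by
  rw [conMetric, Matrix.det_nonsing_inv, Ring.inverse_eq_inv']
  exact inv_ne_zero hu

/-- The vector g⁻¹w is characterised by its commutator with L, tested against commutators [E y, L].
-/
theorem trace_lie_conMetric (hu : (covMetric tr E L₀ u).det ≠ 0) (w y : ι → ℝ) :
    tr (⁅E y, L₀ + E u⁆ * ⁅E ((conMetric tr E L₀ u).mulVec w), L₀ + E u⁆) = dotProduct y w := by
  rw [← dotProduct_lieMatrix, Matrix.mulVec_mulVec]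
  change dotProduct y ((covMetric tr E L₀ u * conMetric tr E L₀ u).mulVec w) = _
  rw [cov_mul_con hu, Matrix.one_mulVec]

/-- This identity explains the choice of c: the subtracted trace is the term that arises when the
first L in tr([E y, L][Eζ, L]) is differentiated with u_x = q. -/
theorem trace_lie_midOp (hu : (covMetric tr E L₀ u).det ≠ 0) (q w w' y : ι → ℝ) :
    tr (⁅E y, L₀ + E u⁆ * ⁅E (midOp tr E L₀ u q w w'), L₀ + E u⁆) = dotProduct y w' -
      tr (⁅E y, E q⁆ * ⁅E ((conMetric tr E L₀ u).mulVec w), L₀ + E u⁆) := by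
  rw [midOp_eq, trace_lie_conMetric hu, dotProduct_sub, dotProduct_lieMatrix]

theorem eq_of_trace_lie (hu : (covMetric tr E L₀ u).det ≠ 0) {x x' : ι → ℝ}
    (h : ∀ y, tr (⁅E y, L₀ + E u⁆ * ⁅E x, L₀ + E u⁆) =
      tr (⁅E y, L₀ + E u⁆ * ⁅E x', L₀ + E u⁆)) : x = x' := by
  have h1 : (covMetric tr E L₀ u).mulVec x = (covMetric tr E L₀ u).mulVec x' := by
    refine dotProduct_eq _ _ fun y => ?_
    rw [dotProduct_comm, dotProduct_comm _ y, covMetric, dotProduct_lieMatrix,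
      dotProduct_lieMatrix]
    exact h y
  exact Matrix.mulVec_injective_of_isUnit ((Matrix.isUnit_iff_isUnit_det _).2
    (isUnit_iff_ne_zero.2 hu)) h1

end Algebra

end WDVV

namespace WDVV

/-! ### Smoothness -/

section Smooth

open MeasureTheory

theorem contDiff_det {X n : Type*} [NormedAddCommGroup X] [NormedSpace ℝ X] [Fintype n]
    [DecidableEq n] {A : X → Matrix n n ℝ} (hA : ∀ i j, ContDiff ℝ ∞ fun x => A x i j) :
    ContDiff ℝ ∞ fun x => (A x).det := by
  simp only [Matrix.det_apply]
  exact ContDiff.sum fun σ _ => (contDiff_prod fun i _ => hA _ _).const_smul _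

theorem contDiff_adjugate {X n : Type*} [NormedAddCommGroup X] [NormedSpace ℝ X] [Fintype n]
    [DecidableEq n] {A : X → Matrix n n ℝ} (hA : ∀ i j, ContDiff ℝ ∞ fun x => A x i j)
    (i j : n) : ContDiff ℝ ∞ fun x => (A x).adjugate i j := by
  simp only [Matrix.adjugate_apply]
  refine contDiff_det fun k l => ?_
  by_cases hk : k = j
  · subst hk
    simp only [Matrix.updateRow_self]
    exact contDiff_const
  · simp only [Matrix.updateRow_ne hk]
    exact hA k l

variable {𝔸 : Type*} [NormedRing 𝔸] [NormedAlgebra ℝ 𝔸]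
variable {ι : Type} [Fintype ι] [DecidableEq ι]
variable (tr : 𝔸 →L[ℝ] ℝ) (E : (ι → ℝ) →L[ℝ] 𝔸) (L₀ : 𝔸)

theorem contDiff_covMetric (i j : ι) : ContDiff ℝ ∞ fun u => covMetric tr E L₀ u i j := by
  simp only [covMetric, lieMatrix, Matrix.of_apply, Ring.lie_def]
  fun_prop

theorem continuous_det_covMetric : Continuous fun u => (covMetric tr E L₀ u).det :=
  (contDiff_det (contDiff_covMetric tr E L₀)).continuous

theorem contDiffAt_conMetric {u : ι → ℝ} (hu : (covMetric tr E L₀ u).det ≠ 0) (i j : ι) :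
    ContDiffAt ℝ ∞ (fun u => conMetric tr E L₀ u i j) u := by
  simp only [conMetric, Matrix.inv_def, Matrix.smul_apply, Ring.inverse_eq_inv', smul_eq_mul]
  exact ((contDiff_det (contDiff_covMetric tr E L₀)).contDiffAt.inv hu).mul
    (contDiff_adjugate (contDiff_covMetric tr E L₀) i j).contDiffAt

theorem contDiffAt_conCoeff {u : ι → ℝ} (hu : (covMetric tr E L₀ u).det ≠ 0) (i j k : ι) :
    ContDiffAt ℝ ∞ (fun u => conCoeff tr E L₀ u i j k) u := by
  simp only [conCoeff, Matrix.mul_apply]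
  refine (ContDiffAt.sum fun l _ => (ContDiffAt.sum fun m _ => ?_).mul
    (contDiffAt_conMetric tr E L₀ hu _ _)).neg
  refine (contDiffAt_conMetric tr E L₀ hu _ _).mul (ContDiff.contDiffAt ?_)
  simp only [lieMatrix, Matrix.of_apply, Ring.lie_def]
  fun_prop

variable {X : Type*} [NormedAddCommGroup X] [NormedSpace ℝ X]

theorem contDiffAt_midOp {u q w w' : X → ι → ℝ} {x : X} (hu : ContDiffAt ℝ ∞ u x)
    (hq : ContDiffAt ℝ ∞ q x) (hw : ContDiffAt ℝ ∞ w x) (hw' : ContDiffAt ℝ ∞ w' x)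
    (hx : (covMetric tr E L₀ (u x)).det ≠ 0) :
    ContDiffAt ℝ ∞ (fun y => midOp tr E L₀ (u y) (q y) (w y) (w' y)) x := by
  rw [contDiffAt_pi] at hq hw hw' ⊢
  intro i
  simp only [midOp]
  refine ContDiffAt.sum fun j _ => ContDiffAt.add ?_ ?_
  · exact ((contDiffAt_conMetric tr E L₀ hx i j).comp x hu).mul (hw' j)
  · exact (ContDiffAt.sum fun k _ =>
      ((contDiffAt_conCoeff tr E L₀ hx i j k).comp x hu).mul (hq k)).mul (hw j)

theorem contDiffAt_conMetric_mulVec {u w : X → ι → ℝ} {x : X} (hu : ContDiffAt ℝ ∞ u x)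
    (hw : ContDiffAt ℝ ∞ w x) (hx : (covMetric tr E L₀ (u x)).det ≠ 0) :
    ContDiffAt ℝ ∞ (fun y => (conMetric tr E L₀ (u y)).mulVec (w y)) x := by
  rw [contDiffAt_pi] at hw ⊢
  intro i
  simp only [Matrix.mulVec, dotProduct]
  exact ContDiffAt.sum fun j _ => ((contDiffAt_conMetric tr E L₀ hx i j).comp x hu).mul (hw j)

/-! ### Integrals of compactly supported functions -/

theorem integral_deriv_eq_zero {φ φ' : ℝ → ℝ} (hφ : ∀ x, HasDerivAt φ (φ' x) x)
    (hφ' : Continuous φ') (hc : HasCompactSupport φ) : ∫ x, φ' x = 0 := by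
  have h : φ' = deriv φ := funext fun x => (hφ x).deriv.symm
  have hcφ : Continuous φ := continuous_iff_continuousAt.2 fun x => (hφ x).continuousAt
  refine integral_eq_zero_of_hasDerivAt_of_integrable hφ ?_ (hcφ.integrable_of_hasCompactSupport hc)
  refine hφ'.integrable_of_hasCompactSupport ?_
  rw [h]
  exact hc.deriv

/-- The ε-derivative is bounded on the compact set [−δ, δ] × K and vanishes off K, which supplies
the dominating function. -/
theorem hasDerivAt_integral_of_contDiffOn {F : ℝ → ℝ → ℝ} {s : Set ℝ} (hs : s ∈ nhds 0)
    {K : Set ℝ} (hK : IsCompact K) (h0 : ∀ ε, ∀ x ∉ K, F ε x = 0)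
    (hF : ∀ ε ∈ s, ∀ x, ContDiffAt ℝ ∞ (Function.uncurry F) (ε, x)) :
    HasDerivAt (fun ε => ∫ x, F ε x) (∫ x, deriv (fun ε => F ε x) 0) 0 := by
  obtain ⟨δ, hδ, hδs⟩ := Metric.nhds_basis_closedBall.mem_iff.1 hs
  have hs0 : ∀ {ε}, ε ∈ Metric.ball (0 : ℝ) δ → ε ∈ s :=
    fun h => hδs (Metric.ball_subset_closedBall h)
  have hdiff : ∀ ε ∈ s, ∀ x, HasDerivAt (fun ε => F ε x)
      (fderiv ℝ (Function.uncurry F) (ε, x) (1, 0)) ε := by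
    intro ε hε x
    have h1 : HasDerivAt (fun ε : ℝ => (ε, x)) (1, 0) ε :=
      (hasDerivAt_id' ε).prodMk (hasDerivAt_const ε x)
    exact (((hF ε hε x).differentiableAt (by simp)).hasFDerivAt).comp_hasDerivAt ε h1
  have hcont : ContinuousOn (fun P : ℝ × ℝ => fderiv ℝ (Function.uncurry F) P (1, 0))
      (Metric.closedBall 0 δ ×ˢ K) := by
    rintro ⟨ε, x⟩ ⟨hε, -⟩
    have := (hF ε (hδs hε) x).fderiv_right (m := 0) (by simp)
    exact (this.continuousAt.clm_apply continuousAt_const).continuousWithinAt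
  obtain ⟨C, hC⟩ := ((isCompact_closedBall (0 : ℝ) δ).prod hK).exists_bound_of_continuousOn hcont
  have hslice : ∀ ε ∈ s, Continuous (F ε) := by
    intro ε hε
    rw [continuous_iff_continuousAt]
    intro x
    have h1 : ContinuousAt (fun y : ℝ => (ε, y)) x := by fun_prop
    exact (hF ε hε x).continuousAt.comp h1
  have hsupp : ∀ ε, HasCompactSupport (F ε) := fun ε =>
    HasCompactSupport.intro hK fun x hx => h0 ε x hx
  have h00 : (0 : ℝ) ∈ s := mem_of_mem_nhds hs
  have hzero : ∀ ε ∈ s, ∀ x ∉ K, fderiv ℝ (Function.uncurry F) (ε, x) (1, 0) = 0 := by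
    intro ε hε x hx
    have h1 := hdiff ε hε x
    have h2 : (fun ε => F ε x) = fun _ => 0 := funext fun ε => h0 ε x hx
    rw [h2] at h1
    exact h1.unique (hasDerivAt_const ε (0 : ℝ))
  have h := hasDerivAt_integral_of_dominated_loc_of_deriv_le (μ := volume) (F := F)
    (F' := fun ε x => fderiv ℝ (Function.uncurry F) (ε, x) (1, 0)) (x₀ := 0)
    (bound := K.indicator fun _ => C) (Metric.ball_mem_nhds 0 hδ) ?_ ?_ ?_ ?_ ?_ ?_
  · have h2 : (fun x => deriv (fun ε => F ε x) 0) =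
        fun x => fderiv ℝ (Function.uncurry F) (0, x) (1, 0) :=
      funext fun x => (hdiff 0 h00 x).deriv
    rw [h2]
    exact h.2
  · filter_upwards [hs] with ε hε using (hslice ε hε).aestronglyMeasurable
  · exact (hslice 0 h00).integrable_of_hasCompactSupport (hsupp 0)
  · refine Continuous.aestronglyMeasurable ?_
    rw [continuous_iff_continuousAt]
    intro x
    have h1 : ContinuousAt (fun P : ℝ × ℝ => fderiv ℝ (Function.uncurry F) P (1, 0)) (0, x) :=
      ((hF 0 h00 x).fderiv_right (m := 0) (by simp)).continuousAt.clm_apply continuousAt_const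
    have h2 : ContinuousAt (fun y : ℝ => ((0 : ℝ), y)) x := by fun_prop
    exact ContinuousAt.comp (f := fun y : ℝ => ((0 : ℝ), y)) h1 h2
  · refine Filter.Eventually.of_forall fun x ε hε => ?_
    by_cases hx : x ∈ K
    · rw [Set.indicator_of_mem hx]
      exact hC (ε, x) ⟨Metric.ball_subset_closedBall hε, hx⟩
    · rw [Set.indicator_of_notMem hx, hzero ε (hs0 hε) x hx, norm_zero]
  · exact (integrable_indicator_iff hK.measurableSet).2
      (integrableOn_const hK.measure_lt_top.ne)
  · exact Filter.Eventually.of_forall fun x ε hε => hdiff ε (hs0 hε) x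

/-! ### The bracket -/

variable {tr E L₀}

theorem deriv_apply_of_contDiff {w : ℝ → ι → ℝ} (hw : ContDiff ℝ ∞ w) (j : ι) (y : ℝ) :
    deriv (fun s => w s j) y = deriv w y j :=
  (hasDerivAt_pi.1 ((hw.differentiable (by simp)) y).hasDerivAt j).deriv

theorem contDiff_deriv {Y : Type*} [NormedAddCommGroup Y] [NormedSpace ℝ Y] {w : ℝ → Y}
    (hw : ContDiff ℝ ∞ w) : ContDiff ℝ ∞ (deriv w) :=
  (contDiff_infty_iff_deriv.1 hw).2

/-- The vector `(g D + c u_x) D w` along a curve `u`. -/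
def midCurve (tr : 𝔸 →L[ℝ] ℝ) (E : (ι → ℝ) →L[ℝ] 𝔸) (L₀ : 𝔸) (u w : ℝ → ι → ℝ) (x : ℝ) :
    ι → ℝ :=
  midOp tr E L₀ (u x) (deriv u x) (deriv w x) (deriv (deriv w) x)

theorem contDiff_midCurve {u w : ℝ → ι → ℝ} (hu : ContDiff ℝ ∞ u) (hw : ContDiff ℝ ∞ w)
    (hU : ∀ x, (covMetric tr E L₀ (u x)).det ≠ 0) :
    ContDiff ℝ ∞ (midCurve tr E L₀ u w) :=
  contDiff_iff_contDiffAt.2 fun x => contDiffAt_midOp tr E L₀ hu.contDiffAt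
    (contDiff_deriv hu).contDiffAt (contDiff_deriv hw).contDiffAt
    (contDiff_deriv (contDiff_deriv hw)).contDiffAt (hU x)

theorem thirdOrderOp_eq {u w : ℝ → ι → ℝ} (hu : ContDiff ℝ ∞ u) (hw : ContDiff ℝ ∞ w) (x : ℝ)
    (i : ι) : thirdOrderOp (conMetric tr E L₀) (conCoeff tr E L₀) u w x i =
      deriv (fun y => midCurve tr E L₀ u w y i) x := by
  have h1 : ∀ j, (fun s => deriv (fun s => w s j) s) = fun s => deriv w s j :=
    fun j => funext fun s => deriv_apply_of_contDiff hw j s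
  simp only [thirdOrderOp, midCurve, midOp]
  simp only [h1, deriv_apply_of_contDiff hu, deriv_apply_of_contDiff (contDiff_deriv hw)]

theorem thirdOrderOp_eq_deriv {u w : ℝ → ι → ℝ} (hu : ContDiff ℝ ∞ u) (hw : ContDiff ℝ ∞ w)
    (hU : ∀ x, (covMetric tr E L₀ (u x)).det ≠ 0) :
    thirdOrderOp (conMetric tr E L₀) (conCoeff tr E L₀) u w = deriv (midCurve tr E L₀ u w) := by
  funext x i
  rw [thirdOrderOp_eq hu hw, deriv_apply_of_contDiff (contDiff_midCurve hu hw hU)]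

/-- The outer D_x is moved onto the test covector by parts. -/
theorem bracket_eq {a b u : ℝ → ι → ℝ} (hu : ContDiff ℝ ∞ u)
    (hU : ∀ x, (covMetric tr E L₀ (u x)).det ≠ 0) (ha : IsTest a) (hb : IsTest b) :
    bracket (conMetric tr E L₀) (conCoeff tr E L₀) a b u =
      -∫ x, dotProduct (midCurve tr E L₀ u b x) (deriv a x) := by
  have hm := contDiff_midCurve hu hb.1 hU
  have hd : ∀ x, HasDerivAt (fun x => dotProduct (midCurve tr E L₀ u b x) (a x))
      (dotProduct (midCurve tr E L₀ u b x) (deriv a x) +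
        ∑ i, a x i * deriv (midCurve tr E L₀ u b) x i) x := by
    intro x
    have h1 := hasDerivAt_pi.1 ((hm.differentiable (by simp)) x).hasDerivAt
    have h2 := hasDerivAt_pi.1 ((ha.1.differentiable (by simp)) x).hasDerivAt
    have h3 := HasDerivAt.fun_sum (u := Finset.univ) fun i _ => (h1 i).mul (h2 i)
    refine h3.congr_deriv ?_
    rw [dotProduct, ← Finset.sum_add_distrib]
    exact Finset.sum_congr rfl fun i _ => by ring
  have hma : ∀ i, Continuous fun x => midCurve tr E L₀ u b x i := fun i =>
    (continuous_apply i).comp hm.continuous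
  have hmd : ∀ i, Continuous fun x => deriv (midCurve tr E L₀ u b) x i := fun i =>
    (continuous_apply i).comp (contDiff_deriv hm).continuous
  have haa : ∀ i, Continuous fun x => a x i := fun i => (continuous_apply i).comp ha.1.continuous
  have had : ∀ i, Continuous fun x => deriv a x i := fun i =>
    (continuous_apply i).comp (contDiff_deriv ha.1).continuous
  have hc1 : Continuous fun x => dotProduct (midCurve tr E L₀ u b x) (deriv a x) :=
    continuous_finsetSum _ fun i _ => (hma i).mul (had i)
  have hc2 : Continuous fun x => ∑ i, a x i * deriv (midCurve tr E L₀ u b) x i :=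
    continuous_finsetSum _ fun i _ => (haa i).mul (hmd i)
  have hs1 : HasCompactSupport fun x => dotProduct (midCurve tr E L₀ u b x) (deriv a x) :=
    ha.2.deriv.mono' fun x hx => subset_tsupport _ fun h => hx (by simp [h])
  have hs2 : HasCompactSupport fun x => ∑ i, a x i * deriv (midCurve tr E L₀ u b) x i :=
    ha.2.mono' fun x hx => subset_tsupport _ fun h => hx (by simp [h])
  have hs3 : HasCompactSupport fun x => dotProduct (midCurve tr E L₀ u b x) (a x) :=
    ha.2.mono' fun x hx => subset_tsupport _ fun h => hx (by simp [h])
  have h0 := integral_deriv_eq_zero hd (hc1.add hc2) hs3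
  rw [integral_add (hc1.integrable_of_hasCompactSupport hs1)
    (hc2.integrable_of_hasCompactSupport hs2)] at h0
  rw [bracket, thirdOrderOp_eq_deriv hu hb.1 hU]
  linarith

end Smooth

end WDVV

namespace WDVV

/-! ### The Jacobi identity -/

section Jacobi

open MeasureTheory

variable {𝔸 : Type*} [NormedRing 𝔸] [NormedAlgebra ℝ 𝔸]
variable {ι : Type} [Fintype ι] [DecidableEq ι]
variable {tr : 𝔸 →L[ℝ] ℝ} {E : (ι → ℝ) →L[ℝ] 𝔸} {L₀ : 𝔸}

theorem hasDerivAt_comp_clm {f : ℝ → ι → ℝ} {f' : ι → ℝ} {x : ℝ} (hf : HasDerivAt f f' x) :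
    HasDerivAt (fun t => E (f t)) (E f') x :=
  E.hasFDerivAt.comp_hasDerivAt x hf

theorem hasDerivAt_lax {u : ℝ → ι → ℝ} {q : ι → ℝ} {x : ℝ} (hu : HasDerivAt u q x) :
    HasDerivAt (fun t => L₀ + E (u t)) (E q) x :=
  (hasDerivAt_comp_clm hu).const_add L₀

/-- The derivative of `tr ([y, S] [ζ, L])` along curves with constant `y`. -/
theorem hasDerivAt_trace_lie_lie {S ζ L : ℝ → 𝔸} {S' ζ' L' : 𝔸} {x : ℝ} (y : 𝔸)
    (hS : HasDerivAt S S' x) (hζ : HasDerivAt ζ ζ' x) (hL : HasDerivAt L L' x) :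
    HasDerivAt (fun t => tr (⁅y, S t⁆ * ⁅ζ t, L t⁆))
      (tr (⁅y, S'⁆ * ⁅ζ x, L x⁆) + tr (⁅y, S x⁆ * (⁅ζ', L x⁆ + ⁅ζ x, L'⁆))) x := by
  have h1 : HasDerivAt (fun t => ⁅y, S t⁆) ⁅y, S'⁆ x := by
    refine (hasDerivAt_lie (hasDerivAt_const x y) hS).congr_deriv ?_
    simp [Ring.lie_def]
  exact hasDerivAt_trace_mul tr h1 (hasDerivAt_lie hζ hL)

/-- First variation of `ζ = g w`. -/
theorem trace_lie_variation {u w : ℝ → ι → ℝ} {v w' ζ' : ι → ℝ} {x : ℝ}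
    (hu : HasDerivAt u v x) (hw : HasDerivAt w w' x)
    (hζ : HasDerivAt (fun t => (conMetric tr E L₀ (u t)).mulVec (w t)) ζ' x)
    (hdet : (covMetric tr E L₀ (u x)).det ≠ 0) (y : ι → ℝ) :
    tr (⁅E y, E v⁆ * ⁅E ((conMetric tr E L₀ (u x)).mulVec (w x)), L₀ + E (u x)⁆) +
      tr (⁅E y, L₀ + E (u x)⁆ * (⁅E ζ', L₀ + E (u x)⁆ +
        ⁅E ((conMetric tr E L₀ (u x)).mulVec (w x)), E v⁆)) = dotProduct y w' := by
  have h1 := hasDerivAt_trace_lie_lie (tr := tr) (E y) (hasDerivAt_lax (E := E) (L₀ := L₀) hu)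
    (hasDerivAt_comp_clm (E := E) hζ) (hasDerivAt_lax (E := E) (L₀ := L₀) hu)
  have h2 : HasDerivAt (fun t => dotProduct y (w t)) (dotProduct y w') x :=
    HasDerivAt.fun_sum fun i _ => (hasDerivAt_pi.1 hw i).const_mul (y i)
  refine h1.unique (h2.congr_of_eventuallyEq ?_)
  have hopen : ∀ᶠ t in nhds x, (covMetric tr E L₀ (u t)).det ≠ 0 :=
    ((continuous_det_covMetric tr E L₀).continuousAt.comp hu.continuousAt).eventually_ne hdet
  filter_upwards [hopen] with t ht using trace_lie_conMetric ht (w t) y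

/-- First variation of `ξ = (g D + c u_x) w`. -/
theorem trace_lie_midOp_variation {u q : ℝ → ι → ℝ} {v v' w w' ζ' ξ' : ι → ℝ} {x : ℝ}
    (hu : HasDerivAt u v x) (hq : HasDerivAt q v' x)
    (hζ : HasDerivAt (fun t => (conMetric tr E L₀ (u t)).mulVec w) ζ' x)
    (hξ : HasDerivAt (fun t => midOp tr E L₀ (u t) (q t) w w') ξ' x)
    (hdet : (covMetric tr E L₀ (u x)).det ≠ 0) (y : ι → ℝ) :
    tr (⁅E y, E v⁆ * ⁅E (midOp tr E L₀ (u x) (q x) w w'), L₀ + E (u x)⁆) +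
      tr (⁅E y, L₀ + E (u x)⁆ * (⁅E ξ', L₀ + E (u x)⁆ +
        ⁅E (midOp tr E L₀ (u x) (q x) w w'), E v⁆)) =
    -(tr (⁅E y, E v'⁆ * ⁅E ((conMetric tr E L₀ (u x)).mulVec w), L₀ + E (u x)⁆) +
      tr (⁅E y, E (q x)⁆ * (⁅E ζ', L₀ + E (u x)⁆ +
        ⁅E ((conMetric tr E L₀ (u x)).mulVec w), E v⁆))) := by
  have h1 := hasDerivAt_trace_lie_lie (tr := tr) (E y) (hasDerivAt_lax (E := E) (L₀ := L₀) hu)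
    (hasDerivAt_comp_clm (E := E) hξ) (hasDerivAt_lax (E := E) (L₀ := L₀) hu)
  have h2 := (hasDerivAt_trace_lie_lie (tr := tr) (E y) (hasDerivAt_comp_clm (E := E) hq)
    (hasDerivAt_comp_clm (E := E) hζ) (hasDerivAt_lax (E := E) (L₀ := L₀) hu)).const_sub
      (dotProduct y w')
  refine h1.unique (h2.congr_of_eventuallyEq ?_)
  have hopen : ∀ᶠ t in nhds x, (covMetric tr E L₀ (u t)).det ≠ 0 :=
    ((continuous_det_covMetric tr E L₀).continuousAt.comp hu.continuousAt).eventually_ne hdet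
  filter_upwards [hopen] with t ht
    using trace_lie_midOp ht (q t) _ _ y

/-- The vector `g D w` along a curve `u`. -/
def conCurve (tr : 𝔸 →L[ℝ] ℝ) (E : (ι → ℝ) →L[ℝ] 𝔸) (L₀ : 𝔸) (u w : ℝ → ι → ℝ) (x : ℝ) :
    ι → ℝ :=
  (conMetric tr E L₀ (u x)).mulVec (deriv w x)

/-- The commutator of `g D w` with `L` along a curve `u`. -/
def lieCurve (tr : 𝔸 →L[ℝ] ℝ) (E : (ι → ℝ) →L[ℝ] 𝔸) (L₀ : 𝔸) (u w : ℝ → ι → ℝ) (x : ℝ) : 𝔸 :=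
  ⁅E (conCurve tr E L₀ u w x), L₀ + E (u x)⁆

theorem contDiff_conCurve {u w : ℝ → ι → ℝ} (hu : ContDiff ℝ ∞ u) (hw : ContDiff ℝ ∞ w)
    (hU : ∀ x, (covMetric tr E L₀ (u x)).det ≠ 0) : ContDiff ℝ ∞ (conCurve tr E L₀ u w) :=
  contDiff_iff_contDiffAt.2 fun x => contDiffAt_conMetric_mulVec tr E L₀ hu.contDiffAt
    (contDiff_deriv hw).contDiffAt (hU x)

theorem hasDerivAt_of_contDiff {Y : Type*} [NormedAddCommGroup Y] [NormedSpace ℝ Y] {w : ℝ → Y}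
    (hw : ContDiff ℝ ∞ w) (x : ℝ) : HasDerivAt w (deriv w x) x :=
  ((hw.differentiable (by simp)) x).hasDerivAt

/-- This says that [Eξ, L] = D_x[Eζ, L]. It comes from differentiating tr([E y, L][Eζ, L]) = y·w_x.
By `hR` the stray term [Eζ, E u_x] is itself a commutator with L, so testing against all [E y, L]
suffices. -/
theorem lie_midCurve {u w : ℝ → ι → ℝ} (hu : ContDiff ℝ ∞ u) (hw : ContDiff ℝ ∞ w)
    (hU : ∀ x, (covMetric tr E L₀ (u x)).det ≠ 0)
    (hR : ∀ t x y, ∃ z, ⁅E z, L₀ + E (u t)⁆ = ⁅E x, E y⁆) (x : ℝ) :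
    ⁅E (midCurve tr E L₀ u w x), L₀ + E (u x)⁆ =
      ⁅E (deriv (conCurve tr E L₀ u w) x), L₀ + E (u x)⁆ +
        ⁅E (conCurve tr E L₀ u w x), E (deriv u x)⁆ := by
  obtain ⟨z, hz⟩ := hR x (conCurve tr E L₀ u w x) (deriv u x)
  have hadd : ∀ s t : ι → ℝ, ⁅E (s + t), L₀ + E (u x)⁆ =
      ⁅E s, L₀ + E (u x)⁆ + ⁅E t, L₀ + E (u x)⁆ := fun s t => (lieMap E _).map_add s t
  rw [← hz, ← hadd]
  congr 2
  refine eq_of_trace_lie (hU x) fun y => ?_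
  have h1 := trace_lie_variation (tr := tr) (E := E) (L₀ := L₀) (hasDerivAt_of_contDiff hu x)
    (hasDerivAt_of_contDiff (contDiff_deriv hw) x)
    (hasDerivAt_of_contDiff (contDiff_conCurve hu hw hU) x) (hU x) y
  have h2 := trace_lie_midOp (hU x) (deriv u x) (deriv w x) (deriv (deriv w) x) y
  rw [midCurve, h2, ← h1, hadd, hz, conCurve]
  ring

theorem hasDerivAt_lieCurve {u w : ℝ → ι → ℝ} (hu : ContDiff ℝ ∞ u) (hw : ContDiff ℝ ∞ w)
    (hU : ∀ x, (covMetric tr E L₀ (u x)).det ≠ 0)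
    (hR : ∀ t x y, ∃ z, ⁅E z, L₀ + E (u t)⁆ = ⁅E x, E y⁆) (x : ℝ) :
    HasDerivAt (lieCurve tr E L₀ u w) ⁅E (midCurve tr E L₀ u w x), L₀ + E (u x)⁆ x := by
  rw [lie_midCurve hu hw hU hR]
  exact hasDerivAt_lie (hasDerivAt_comp_clm (hasDerivAt_of_contDiff (contDiff_conCurve hu hw hU) x))
    (hasDerivAt_lax (hasDerivAt_of_contDiff hu x))

theorem dotProduct_deriv_eq (htr : ∀ a b, tr (a * b) = tr (b * a)) {u a : ℝ → ι → ℝ} {x : ℝ}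
    (hU : (covMetric tr E L₀ (u x)).det ≠ 0) (y : ι → ℝ) :
    dotProduct y (deriv a x) = tr (lieCurve tr E L₀ u a x * ⁅E y, L₀ + E (u x)⁆) := by
  rw [htr, lieCurve, conCurve, trace_lie_conMetric hU]

theorem continuous_lie {f g : ℝ → 𝔸} (hf : Continuous f) (hg : Continuous g) :
    Continuous fun x => ⁅f x, g x⁆ := by
  simp only [Ring.lie_def]
  fun_prop

theorem hasCompactSupport_lieCurve {u a : ℝ → ι → ℝ} (ha : IsTest a) :
    HasCompactSupport (lieCurve tr E L₀ u a) :=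
  ha.2.deriv.mono' fun x hx => subset_tsupport _ fun h =>
    hx (by simp [lieCurve, conCurve, h, Ring.lie_def])

/-- With X_a = [Eζ_a, L], the density a_x·ξ_b equals tr(X_a D_x X_b), so the symmetric part of the
bracket integrates the derivative of tr(X_a X_b). -/
theorem bracket_skew (htr : ∀ a b, tr (a * b) = tr (b * a)) {a b u : ℝ → ι → ℝ}
    (hu : ContDiff ℝ ∞ u) (hU : ∀ x, (covMetric tr E L₀ (u x)).det ≠ 0)
    (hR : ∀ t x y, ∃ z, ⁅E z, L₀ + E (u t)⁆ = ⁅E x, E y⁆) (ha : IsTest a) (hb : IsTest b) :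
    bracket (conMetric tr E L₀) (conCoeff tr E L₀) a b u =
      -bracket (conMetric tr E L₀) (conCoeff tr E L₀) b a u := by
  rw [bracket_eq hu hU ha hb, bracket_eq hu hU hb ha]
  have hA := hasDerivAt_lieCurve hu ha.1 hU hR
  have hB := hasDerivAt_lieCurve hu hb.1 hU hR
  have hcont : ∀ {c d : ℝ → ι → ℝ}, IsTest c → IsTest d → Continuous fun x =>
      dotProduct (midCurve tr E L₀ u c x) (deriv d x) := by
    intro c d hc hd
    exact continuous_finsetSum _ fun i _ =>
      ((continuous_apply i).comp (contDiff_midCurve hu hc.1 hU).continuous).mul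
        ((continuous_apply i).comp (contDiff_deriv hd.1).continuous)
  have hsupp : ∀ {c d : ℝ → ι → ℝ}, IsTest d → HasCompactSupport fun x =>
      dotProduct (midCurve tr E L₀ u c x) (deriv d x) := by
    intro c d hd
    exact hd.2.deriv.mono' fun x hx => subset_tsupport _ fun h => hx (by simp [h])
  have hd : ∀ x, HasDerivAt (fun x => tr (lieCurve tr E L₀ u a x * lieCurve tr E L₀ u b x))
      (dotProduct (midCurve tr E L₀ u a x) (deriv b x) +
        dotProduct (midCurve tr E L₀ u b x) (deriv a x)) x := by
    intro x
    rw [dotProduct_deriv_eq htr (hU x), dotProduct_deriv_eq htr (hU x),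
      htr (lieCurve tr E L₀ u b x)]
    exact hasDerivAt_trace_mul tr (hA x) (hB x)
  have h0 := integral_deriv_eq_zero hd ((hcont ha hb).add (hcont hb ha))
    ((hasCompactSupport_lieCurve (tr := tr) (E := E) (L₀ := L₀) (u := u) ha).mono
      fun x hx h => hx (by simp [h]))
  rw [integral_add ((hcont ha hb).integrable_of_hasCompactSupport (hsupp hb))
    ((hcont hb ha).integrable_of_hasCompactSupport (hsupp ha))] at h0
  linarith

end Jacobi

end WDVV

namespace WDVV

/-! ### Variation of the bracket along a field and the cyclic sum -/

section JacobiIdentity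

open MeasureTheory

variable {𝔸 : Type*} [NormedRing 𝔸] [NormedAlgebra ℝ 𝔸]
variable {ι : Type} [Fintype ι] [DecidableEq ι]
variable {tr : 𝔸 →L[ℝ] ℝ} {E : (ι → ℝ) →L[ℝ] 𝔸} {L₀ : 𝔸}

/-- The curve is unchanged off the support of v, and on this compact set the open condition holds
uniformly in small ε. -/
theorem eventually_forall_det_covMetric {u v : ℝ → ι → ℝ} (hu : ContDiff ℝ ∞ u) (hv : IsTest v)
    (hU : ∀ x, (covMetric tr E L₀ (u x)).det ≠ 0) :
    ∀ᶠ ε : ℝ in nhds 0, ∀ x, (covMetric tr E L₀ (u x + ε • v x)).det ≠ 0 := by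
  have h1 : ∀ᶠ ε : ℝ in nhds 0, ∀ x ∈ tsupport v,
      (covMetric tr E L₀ (u x + ε • v x)).det ≠ 0 := by
    refine hv.2.isCompact.eventually_forall_of_forall_eventually fun x _ => ?_
    have hc : Continuous fun P : ℝ × ℝ => (covMetric tr E L₀ (u P.2 + P.1 • v P.2)).det := by
      have := hu.continuous
      have := hv.1.continuous
      exact (continuous_det_covMetric tr E L₀).comp (by fun_prop)
    have h := hc.continuousAt (x := (0, x))
    refine h.eventually_ne ?_
    simpa using hU x
  filter_upwards [h1] with ε hε x
  by_cases hx : x ∈ tsupport v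
  · exact hε x hx
  · rw [image_eq_zero_of_notMem_tsupport hx, smul_zero, add_zero]
    exact hU x

/-- The density of the derivative of the bracket of `a` and `b` along `v`. -/
def variationDensity (tr : 𝔸 →L[ℝ] ℝ) (E : (ι → ℝ) →L[ℝ] 𝔸) (L₀ : 𝔸) (u a b v : ℝ → ι → ℝ)
    (x : ℝ) : ℝ :=
  tr (lieCurve tr E L₀ u a x * ⁅E (midCurve tr E L₀ u b x), E (v x)⁆) -
    tr (lieCurve tr E L₀ u b x * ⁅E (midCurve tr E L₀ u a x), E (v x)⁆)

/-- The first bracketed sum is the x-derivative of tr([Eζ_a, E v] X_b), so up to a total derivative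
only the density remains, in which v is not differentiated. -/
theorem dotProduct_variation (htr : ∀ a b, tr (a * b) = tr (b * a)) {a b u v : ℝ → ι → ℝ}
    (hu : ContDiff ℝ ∞ u) (ha : ContDiff ℝ ∞ a)
    (hU : ∀ x, (covMetric tr E L₀ (u x)).det ≠ 0)
    (hR : ∀ t x y, ∃ z, ⁅E z, L₀ + E (u t)⁆ = ⁅E x, E y⁆) (x : ℝ) {ξ' : ι → ℝ}
    (hξ : HasDerivAt (fun ε : ℝ => midOp tr E L₀ (u x + ε • v x) (deriv u x + ε • deriv v x)
      (deriv b x) (deriv (deriv b) x)) ξ' 0) :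
    dotProduct ξ' (deriv a x) =
      -(tr ((⁅E (deriv (conCurve tr E L₀ u a) x), E (v x)⁆ +
            ⁅E (conCurve tr E L₀ u a x), E (deriv v x)⁆) * lieCurve tr E L₀ u b x) +
          tr (⁅E (conCurve tr E L₀ u a x), E (v x)⁆ *
            ⁅E (midCurve tr E L₀ u b x), L₀ + E (u x)⁆)) -
        variationDensity tr E L₀ u a b v x := by
  have hline : ∀ s t : ι → ℝ, HasDerivAt (fun ε : ℝ => s + ε • t) t 0 := fun s t => by
    simpa using ((hasDerivAt_id (0 : ℝ)).smul_const t).const_add s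
  have hU0 : (covMetric tr E L₀ (u x + (0 : ℝ) • v x)).det ≠ 0 := by simpa using hU x
  have hζ := ((contDiffAt_conMetric_mulVec tr E L₀ (u := fun ε : ℝ => u x + ε • v x)
    (w := fun _ => deriv b x) (x := 0) (by fun_prop) contDiffAt_const hU0).differentiableAt
      (by simp)).hasDerivAt
  have hadd : ∀ s t : ι → ℝ, ⁅E (s - t), L₀ + E (u x)⁆ =
      ⁅E s, L₀ + E (u x)⁆ - ⁅E t, L₀ + E (u x)⁆ := fun s t => (lieMap E _).map_sub s t
  have hadd' : ∀ s t : ι → ℝ, ⁅E (s - t), E (v x)⁆ =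
      ⁅E s, E (v x)⁆ - ⁅E t, E (v x)⁆ := fun s t => (lieMap E _).map_sub s t
  -- The test vectors ξ_a − D_xζ_a and ζ_a make the unknown variation of ζ_b cancel: the commutator
  -- of the first with L is [Eζ_a, E u_x], exactly the factor paired with that variation in the
  -- second relation.
  have h1 := trace_lie_variation (hline (u x) (v x)) (hasDerivAt_const 0 (deriv b x)) hζ hU0
    (midCurve tr E L₀ u a x - deriv (conCurve tr E L₀ u a) x)
  have h2 := trace_lie_midOp_variation (hline (u x) (v x)) (hline (deriv u x) (deriv v x)) hζ hξ
    hU0 (conCurve tr E L₀ u a x)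
  generalize deriv (fun ε : ℝ => (conMetric tr E L₀ (u x + ε • v x)).mulVec (deriv b x)) 0 = ζ'
    at h1 h2
  simp only [zero_smul, add_zero] at h1 h2
  have h3 := lie_midCurve hu ha hU hR x
  rw [hadd, h3, hadd', add_sub_cancel_left, dotProduct_zero] at h1
  change _ = -(tr (_ * lieCurve tr E L₀ u b x) + tr (_ * (_ + ⁅E (conCurve tr E L₀ u b x), _⁆)))
    at h2
  change tr (_ * lieCurve tr E L₀ u b x) + tr (_ * (_ + ⁅E (conCurve tr E L₀ u b x), _⁆)) = 0
    at h1
  change tr (_ * ⁅E (midCurve tr E L₀ u b x), _⁆) +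
    tr (lieCurve tr E L₀ u a x * (_ + ⁅E (midCurve tr E L₀ u b x), _⁆)) = _ at h2
  rw [dotProduct_deriv_eq htr (hU x), variationDensity, htr (lieCurve tr E L₀ u b x)]
  rw [mul_add, map_add] at h2
  rw [sub_mul, map_sub] at h1
  rw [add_mul, map_add]
  linarith

theorem continuous_variationDensity {a b u v : ℝ → ι → ℝ} (hu : ContDiff ℝ ∞ u)
    (hU : ∀ x, (covMetric tr E L₀ (u x)).det ≠ 0) (ha : ContDiff ℝ ∞ a) (hb : ContDiff ℝ ∞ b)
    (hv : Continuous v) : Continuous (variationDensity tr E L₀ u a b v) := by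
  have hl : ∀ {c : ℝ → ι → ℝ}, ContDiff ℝ ∞ c → Continuous (lieCurve tr E L₀ u c) := fun hc =>
    continuous_lie (E.continuous.comp (contDiff_conCurve hu hc hU).continuous)
      (continuous_const.add (E.continuous.comp hu.continuous))
  have hm : ∀ {c : ℝ → ι → ℝ}, ContDiff ℝ ∞ c →
      Continuous fun x => ⁅E (midCurve tr E L₀ u c x), E (v x)⁆ := fun hc =>
    continuous_lie (E.continuous.comp (contDiff_midCurve hu hc hU).continuous)
      (E.continuous.comp hv)
  exact (tr.continuous.comp ((hl ha).mul (hm hb))).sub (tr.continuous.comp ((hl hb).mul (hm ha)))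

theorem hasCompactSupport_variationDensity {a b u v : ℝ → ι → ℝ} (hv : HasCompactSupport v) :
    HasCompactSupport (variationDensity tr E L₀ u a b v) :=
  hv.mono fun x hx h => hx (by simp [variationDensity, h, Ring.lie_def])

theorem hasDerivAt_bracket (htr : ∀ a b, tr (a * b) = tr (b * a)) {a b u v : ℝ → ι → ℝ}
    (hu : ContDiff ℝ ∞ u) (hU : ∀ x, (covMetric tr E L₀ (u x)).det ≠ 0)
    (hR : ∀ t x y, ∃ z, ⁅E z, L₀ + E (u t)⁆ = ⁅E x, E y⁆) (ha : IsTest a) (hb : IsTest b)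
    (hv : IsTest v) :
    HasDerivAt (fun ε : ℝ => bracket (conMetric tr E L₀) (conCoeff tr E L₀) a b
      (fun x => u x + ε • v x)) (∫ x, variationDensity tr E L₀ u a b v x) 0 := by
  have hu' := contDiff_deriv hu
  have hv' := contDiff_deriv hv.1
  have ha' := contDiff_deriv ha.1
  have hb' := contDiff_deriv hb.1
  have hb'' := contDiff_deriv hb'
  have hev := eventually_forall_det_covMetric hu hv hU
  set M : ℝ → ℝ → ι → ℝ := fun ε x => midOp tr E L₀ (u x + ε • v x) (deriv u x + ε • deriv v x)
    (deriv b x) (deriv (deriv b) x) with hM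
  have hMs : ∀ ε x, (covMetric tr E L₀ (u x + ε • v x)).det ≠ 0 →
      ContDiffAt ℝ ∞ (Function.uncurry M) (ε, x) := by
    intro ε x h
    refine contDiffAt_midOp tr E L₀ (X := ℝ × ℝ) (u := fun P => u P.2 + P.1 • v P.2)
      (q := fun P => deriv u P.2 + P.1 • deriv v P.2) (w := fun P => deriv b P.2)
      (w' := fun P => deriv (deriv b) P.2) ?_ ?_ ?_ ?_ h
    · exact ((hu.comp contDiff_snd).add (contDiff_fst.smul (hv.1.comp contDiff_snd))).contDiffAt
    · exact ((hu'.comp contDiff_snd).add (contDiff_fst.smul (hv'.comp contDiff_snd))).contDiffAt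
    · exact (hb'.comp contDiff_snd).contDiffAt
    · exact (hb''.comp contDiff_snd).contDiffAt
  have hFs : ∀ ε ∈ {ε : ℝ | ∀ x, (covMetric tr E L₀ (u x + ε • v x)).det ≠ 0}, ∀ x,
      ContDiffAt ℝ ∞ (Function.uncurry fun ε x => dotProduct (M ε x) (deriv a x)) (ε, x) := by
    intro ε hε x
    have h1 := contDiffAt_pi.1 (hMs ε x (hε x))
    have h2 := contDiffAt_pi.1 ((ha'.comp contDiff_snd).contDiffAt (x := (ε, x)))
    exact ContDiffAt.sum fun i _ => (h1 i).mul (h2 i)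
  have h := (hasDerivAt_integral_of_contDiffOn hev ha.2.deriv.isCompact
    (fun ε x hx => by rw [image_eq_zero_of_notMem_tsupport hx, dotProduct_zero]) hFs).neg
  have hline : ∀ {c : ℝ → ι → ℝ}, ContDiff ℝ ∞ c → ∀ x, HasDerivAt (fun t => E (c t))
      (E (deriv c x)) x := fun hc x => hasDerivAt_comp_clm (hasDerivAt_of_contDiff hc x)
  have hpt : ∀ x, deriv (fun ε => dotProduct (M ε x) (deriv a x)) 0 =
      -(tr ((⁅E (deriv (conCurve tr E L₀ u a) x), E (v x)⁆ +
            ⁅E (conCurve tr E L₀ u a x), E (deriv v x)⁆) * lieCurve tr E L₀ u b x) +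
          tr (⁅E (conCurve tr E L₀ u a x), E (v x)⁆ *
            ⁅E (midCurve tr E L₀ u b x), L₀ + E (u x)⁆)) -
        variationDensity tr E L₀ u a b v x := by
    intro x
    have hd : ContDiffAt ℝ ∞ (fun ε => M ε x) 0 :=
      ContDiffAt.comp (0 : ℝ) (hMs 0 x (by simpa using hU x))
        (contDiffAt_id.prodMk contDiffAt_const)
    have hd' := (hd.differentiableAt (by simp)).hasDerivAt
    rw [← dotProduct_variation htr hu ha.1 hU hR x hd']
    have := HasDerivAt.fun_sum (u := Finset.univ) fun i _ =>
      (hasDerivAt_pi.1 hd' i).mul_const (deriv a x i)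
    exact this.deriv
  have hφ : ∀ x, HasDerivAt (fun x => tr (⁅E (conCurve tr E L₀ u a x), E (v x)⁆ *
      lieCurve tr E L₀ u b x)) _ x := fun x =>
    hasDerivAt_trace_mul tr (hasDerivAt_lie (hline (contDiff_conCurve hu ha.1 hU) x)
      (hline hv.1 x)) (hasDerivAt_lieCurve hu hb.1 hU hR x)
  have hcE : ∀ {c : ℝ → ι → ℝ}, ContDiff ℝ ∞ c → Continuous fun x => E (c x) :=
    fun hc => E.continuous.comp hc.continuous
  have hcL : Continuous fun x => L₀ + E (u x) := continuous_const.add (hcE hu)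
  have hca := contDiff_conCurve hu ha.1 hU
  have hcb := contDiff_conCurve hu hb.1 hU
  have hmb := contDiff_midCurve hu hb.1 hU
  have hφc : Continuous fun x => tr ((⁅E (deriv (conCurve tr E L₀ u a) x), E (v x)⁆ +
            ⁅E (conCurve tr E L₀ u a x), E (deriv v x)⁆) * lieCurve tr E L₀ u b x) +
          tr (⁅E (conCurve tr E L₀ u a x), E (v x)⁆ *
            ⁅E (midCurve tr E L₀ u b x), L₀ + E (u x)⁆) :=
    (tr.continuous.comp (((continuous_lie (hcE (contDiff_deriv hca)) (hcE hv.1)).add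
      (continuous_lie (hcE hca) (hcE hv'))).mul (continuous_lie (hcE hcb) hcL))).add
      (tr.continuous.comp ((continuous_lie (hcE hca) (hcE hv.1)).mul
        (continuous_lie (hcE hmb) hcL)))
  have hφs : HasCompactSupport fun x => tr (⁅E (conCurve tr E L₀ u a x), E (v x)⁆ *
      lieCurve tr E L₀ u b x) :=
    hv.2.mono fun x hx h => hx (by simp [h, Ring.lie_def])
  have hφ0 := integral_deriv_eq_zero hφ hφc hφs
  have hφi := hφc.integrable_of_hasCompactSupport (μ := volume) (by
    have h2 := hφs.deriv
    rwa [show deriv _ = _ from funext fun x => (hφ x).deriv] at h2)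
  have hψi := (continuous_variationDensity hu hU ha.1 hb.1
    hv.1.continuous).integrable_of_hasCompactSupport (μ := volume)
      (hasCompactSupport_variationDensity hv.2)
  have hval : -∫ x, deriv (fun ε => dotProduct (M ε x) (deriv a x)) 0 =
      ∫ x, variationDensity tr E L₀ u a b v x := by
    simp only [hpt]
    have hsub := integral_sub hφi.neg hψi
    simp only [Pi.neg_apply] at hsub
    rw [hsub, integral_neg, hφ0]
    ring
  rw [← hval]
  refine h.congr_of_eventuallyEq ?_
  filter_upwards [hev] with ε hε
  have hue : ContDiff ℝ ∞ fun x => u x + ε • v x := hu.add (hv.1.const_smul ε)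
  rw [bracket_eq hue hε ha hb]
  have hde : ∀ x, deriv (fun x => u x + ε • v x) x = deriv u x + ε • deriv v x := fun x =>
    ((hasDerivAt_of_contDiff hu x).add ((hasDerivAt_of_contDiff hv.1 x).const_smul ε)).deriv
  simp only [midCurve, hde, hM, Pi.neg_apply]

theorem isTest_thirdOrderOp {u d : ℝ → ι → ℝ} (hu : ContDiff ℝ ∞ u)
    (hU : ∀ x, (covMetric tr E L₀ (u x)).det ≠ 0) (hd : IsTest d) :
    IsTest (deriv (midCurve tr E L₀ u d)) := by
  refine ⟨contDiff_deriv (contDiff_midCurve hu hd.1 hU), HasCompactSupport.deriv ?_⟩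
  refine hd.2.deriv.mono' fun x hx => by_contra fun h => hx ?_
  have h2 : deriv (deriv d) x = 0 :=
    image_eq_zero_of_notMem_tsupport fun hh => h (tsupport_deriv_subset hh)
  funext i
  simp [midCurve, midOp, image_eq_zero_of_notMem_tsupport h, h2]

/-- The cyclic sum is the x-derivative of the cyclic sum of tr(X_a[Eξ_b, Eξ_d]). The terms with D_x
X_a = [Eξ_a, L] cancel by `trace_lie_cyclic`, and the others reassemble into the three densities. -/
theorem integral_variationDensity_cyclic (htr : ∀ a b, tr (a * b) = tr (b * a))
    {a b d u : ℝ → ι → ℝ}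
    (hu : ContDiff ℝ ∞ u) (hU : ∀ x, (covMetric tr E L₀ (u x)).det ≠ 0)
    (hR : ∀ t x y, ∃ z, ⁅E z, L₀ + E (u t)⁆ = ⁅E x, E y⁆) (ha : IsTest a) (hb : IsTest b)
    (hd : IsTest d) :
    (∫ x, variationDensity tr E L₀ u a b (deriv (midCurve tr E L₀ u d)) x) +
      (∫ x, variationDensity tr E L₀ u b d (deriv (midCurve tr E L₀ u a)) x) +
      (∫ x, variationDensity tr E L₀ u d a (deriv (midCurve tr E L₀ u b)) x) = 0 := by
  have hc : ∀ {a b d : ℝ → ι → ℝ}, IsTest a → IsTest b → IsTest d →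
      Continuous (variationDensity tr E L₀ u a b (deriv (midCurve tr E L₀ u d))) :=
    fun ha hb hd => continuous_variationDensity hu hU ha.1 hb.1
      (isTest_thirdOrderOp hu hU hd).1.continuous
  have hi : ∀ {a b d : ℝ → ι → ℝ}, IsTest a → IsTest b → IsTest d →
      Integrable (variationDensity tr E L₀ u a b (deriv (midCurve tr E L₀ u d))) :=
    fun ha hb hd => (hc ha hb hd).integrable_of_hasCompactSupport
      (hasCompactSupport_variationDensity (isTest_thirdOrderOp hu hU hd).2)
  rw [← integral_add' (hi ha hb hd) (hi hb hd ha),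
    ← integral_add' ((hi ha hb hd).add (hi hb hd ha)) (hi hd ha hb)]
  have hl : ∀ {c : ℝ → ι → ℝ}, IsTest c → ∀ x, HasDerivAt (fun t => E (midCurve tr E L₀ u c t))
      (E (deriv (midCurve tr E L₀ u c) x)) x := fun hc x =>
    hasDerivAt_comp_clm (hasDerivAt_of_contDiff (contDiff_midCurve hu hc.1 hU) x)
  have hterm : ∀ {a b d : ℝ → ι → ℝ}, IsTest a → IsTest b → IsTest d → ∀ x,
      HasDerivAt (fun x => tr (lieCurve tr E L₀ u a x *
        ⁅E (midCurve tr E L₀ u b x), E (midCurve tr E L₀ u d x)⁆)) _ x :=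
    fun ha hb hd x => hasDerivAt_trace_mul tr (hasDerivAt_lieCurve hu ha.1 hU hR x)
      (hasDerivAt_lie (hl hb x) (hl hd x))
  refine integral_deriv_eq_zero (φ := fun x => tr (lieCurve tr E L₀ u a x *
        ⁅E (midCurve tr E L₀ u b x), E (midCurve tr E L₀ u d x)⁆) +
      tr (lieCurve tr E L₀ u b x *
        ⁅E (midCurve tr E L₀ u d x), E (midCurve tr E L₀ u a x)⁆) +
      tr (lieCurve tr E L₀ u d x *
        ⁅E (midCurve tr E L₀ u a x), E (midCurve tr E L₀ u b x)⁆)) (fun x => ?_)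
    (((hc ha hb hd).add (hc hb hd ha)).add (hc hd ha hb)) ?_
  · refine (((hterm ha hb hd x).add (hterm hb hd ha x)).add (hterm hd ha hb x)).congr_deriv ?_
    have hcyc := trace_lie_cyclic htr (E (midCurve tr E L₀ u a x)) (E (midCurve tr E L₀ u b x))
      (E (midCurve tr E L₀ u d x)) (L₀ + E (u x))
    have hskew : ∀ A X Y : 𝔸, tr (A * ⁅X, Y⁆) = -tr (A * ⁅Y, X⁆) := fun A X Y => by
      rw [← map_neg, ← mul_neg, Ring.lie_def, Ring.lie_def, neg_sub]
    simp only [variationDensity, mul_add, map_add, Pi.add_apply]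
    rw [hskew _ (E (deriv (midCurve tr E L₀ u b) x)), hskew _ (E (deriv (midCurve tr E L₀ u d) x)),
      hskew _ (E (deriv (midCurve tr E L₀ u a) x))]
    linarith
  · have hs : ∀ {c : ℝ → ι → ℝ} (f : ℝ → 𝔸), IsTest c →
        HasCompactSupport fun x => tr (lieCurve tr E L₀ u c x * f x) := fun f hc =>
      (hasCompactSupport_lieCurve (tr := tr) (E := E) (L₀ := L₀) (u := u) hc).mono
        fun x hx h => hx (by simp [h])
    exact ((hs _ ha).add (hs _ hb)).add (hs _ hd)

/-- The operator with covariant metric `tr ([E_i, L] [E_j, L])` is Hamiltonian. -/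
theorem isHamiltonianOp_conMetric (htr : ∀ a b, tr (a * b) = tr (b * a)) {U : Set (ι → ℝ)}
    (hU : ∀ u ∈ U, (covMetric tr E L₀ u).det ≠ 0)
    (hR : ∀ u ∈ U, ∀ x y, ∃ z, ⁅E z, L₀ + E u⁆ = ⁅E x, E y⁆) :
    IsHamiltonianOp U (conMetric tr E L₀) (conCoeff tr E L₀) := by
  intro u hu huU
  have hU' := fun x => hU _ (huU x)
  have hR' := fun t => hR _ (huU t)
  refine ⟨fun a b ha hb => bracket_skew htr hu hU' hR' ha hb, fun a b d ha hb hd => ?_⟩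
  rw [thirdOrderOp_eq_deriv hu ha.1 hU', thirdOrderOp_eq_deriv hu hb.1 hU',
    thirdOrderOp_eq_deriv hu hd.1 hU']
  exact ⟨_, _, _, hasDerivAt_bracket htr hu hU' hR' ha hb (isTest_thirdOrderOp hu hU' hd),
    hasDerivAt_bracket htr hu hU' hR' hb hd (isTest_thirdOrderOp hu hU' ha),
    hasDerivAt_bracket htr hu hU' hR' hd ha (isTest_thirdOrderOp hu hU' hb),
    integral_variationDensity_cyclic htr hu hU' hR' ha hb hd⟩

end JacobiIdentity

end WDVV

namespace WDVV

/-! ### Hamiltonian systems -/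

section HamiltonianSystem

variable {𝔸 : Type*} [NormedRing 𝔸] [NormedAlgebra ℝ 𝔸]
variable {ι : Type} [Fintype ι] [DecidableEq ι]
variable {tr : 𝔸 →L[ℝ] ℝ} {E : (ι → ℝ) →L[ℝ] 𝔸} {L₀ : 𝔸}

/-- The density `tr ([M, L] [C, M]) / 3` with `M = x L₀ + E b` and `L = L₀ + E b_x = M_x`. -/
def hamDensity (tr : 𝔸 →L[ℝ] ℝ) (E : (ι → ℝ) →L[ℝ] 𝔸) (L₀ C : 𝔸)
    (P : ℝ × (ι → ℝ) × (ι → ℝ)) : ℝ :=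
  3⁻¹ * tr (⁅P.1 • L₀ + E P.2.1, L₀ + E P.2.2⁆ * ⁅C, P.1 • L₀ + E P.2.1⁆)

theorem contDiff_hamDensity (C : 𝔸) : ContDiff ℝ ∞ (hamDensity tr E L₀ C) := by
  unfold hamDensity
  simp only [Ring.lie_def]
  fun_prop

theorem hasDerivAt_lie_const {f : ℝ → 𝔸} {f' : 𝔸} {x : ℝ} (C : 𝔸) (hf : HasDerivAt f f' x) :
    HasDerivAt (fun t => ⁅C, f t⁆) ⁅C, f'⁆ x := by
  refine (hasDerivAt_lie (hasDerivAt_const x C) hf).congr_deriv ?_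
  simp [Ring.lie_def]

theorem hasDerivAt_line (s t : ι → ℝ) : HasDerivAt (fun ε : ℝ => s + ε • t) t 0 := by
  simpa using ((hasDerivAt_id (0 : ℝ)).smul_const t).const_add s

theorem fderiv_hamDensity_apply (C : 𝔸) (x : ℝ) (β s y : ι → ℝ) :
    fderiv ℝ (hamDensity tr E L₀ C) (x, β, s) (0, y, 0) =
      3⁻¹ * (tr (⁅E y, L₀ + E s⁆ * ⁅C, x • L₀ + E β⁆) +
        tr (⁅x • L₀ + E β, L₀ + E s⁆ * ⁅C, E y⁆)) := by
  have h1 : HasDerivAt (fun ε : ℝ => (x, β + ε • y, s)) (0, y, 0) 0 :=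
    (hasDerivAt_const 0 x).prodMk ((hasDerivAt_line β y).prodMk (hasDerivAt_const 0 s))
  have h2 := (((contDiff_hamDensity (tr := tr) (E := E) (L₀ := L₀) C).differentiable (by simp)
    (x, β + (0 : ℝ) • y, s)).hasFDerivAt).comp_hasDerivAt 0 h1
  rw [zero_smul, add_zero] at h2
  have h3 : HasDerivAt (fun ε : ℝ => x • L₀ + E (β + ε • y)) (E y) 0 :=
    (hasDerivAt_comp_clm (hasDerivAt_line β y)).const_add _
  have h4 : HasDerivAt (fun ε : ℝ => ⁅x • L₀ + E (β + ε • y), L₀ + E s⁆) ⁅E y, L₀ + E s⁆ 0 := by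
    refine (hasDerivAt_lie h3 (hasDerivAt_const 0 (L₀ + E s))).congr_deriv ?_
    simp [Ring.lie_def]
  have h5 := (hasDerivAt_trace_mul tr h4 (hasDerivAt_lie_const C h3)).const_mul (3⁻¹ : ℝ)
  rw [zero_smul, add_zero] at h5
  exact h2.unique h5

theorem fderiv_hamDensity_apply' (C : 𝔸) (x : ℝ) (β s y : ι → ℝ) :
    fderiv ℝ (hamDensity tr E L₀ C) (x, β, s) (0, 0, y) =
      3⁻¹ * tr (⁅x • L₀ + E β, E y⁆ * ⁅C, x • L₀ + E β⁆) := by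
  have h1 : HasDerivAt (fun ε : ℝ => (x, β, s + ε • y)) (0, 0, y) 0 :=
    (hasDerivAt_const 0 x).prodMk ((hasDerivAt_const 0 β).prodMk (hasDerivAt_line s y))
  have h2 := (((contDiff_hamDensity (tr := tr) (E := E) (L₀ := L₀) C).differentiable (by simp)
    (x, β, s + (0 : ℝ) • y)).hasFDerivAt).comp_hasDerivAt 0 h1
  rw [zero_smul, add_zero] at h2
  have h3 := hasDerivAt_lie_const (x • L₀ + E β)
    (hasDerivAt_lax (E := E) (L₀ := L₀) (hasDerivAt_line s y))
  have h5 := (hasDerivAt_trace_mul tr h3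
    (hasDerivAt_const 0 ⁅C, x • L₀ + E β⁆)).const_mul (3⁻¹ : ℝ)
  rw [mul_zero, map_zero, add_zero] at h5
  exact h2.unique h5

theorem hasDerivAt_potential {b : ℝ → ι → ℝ} (hb : ContDiff ℝ ∞ b) (x : ℝ) :
    HasDerivAt (fun x => x • L₀ + E (b x)) (L₀ + E (deriv b x)) x := by
  have h := ((hasDerivAt_id x).smul_const L₀).add
    (hasDerivAt_comp_clm (E := E) (hasDerivAt_of_contDiff hb x))
  rwa [one_smul] at h

/-- Differentiation produces the right-hand trace twice, plus two further terms that the Jacobi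
identity merges into a third copy; this explains the factor 1/3. -/
theorem varDeriv_hamDensity (htr : ∀ a b, tr (a * b) = tr (b * a)) (C : 𝔸) {b : ℝ → ι → ℝ}
    (hb : ContDiff ℝ ∞ b) (x : ℝ) (i : ι) :
    varDeriv (hamDensity tr E L₀ C) b x i =
      tr (⁅E (Pi.single i 1), L₀ + E (deriv b x)⁆ * ⁅C, x • L₀ + E (b x)⁆) := by
  simp only [varDeriv, fderiv_hamDensity_apply, fderiv_hamDensity_apply']
  have h1 := hasDerivAt_potential (E := E) (L₀ := L₀) hb x
  have h2 : HasDerivAt (fun x => ⁅x • L₀ + E (b x), E (Pi.single i 1)⁆)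
      ⁅L₀ + E (deriv b x), E (Pi.single i 1)⁆ x := by
    refine (hasDerivAt_lie h1 (hasDerivAt_const x (E (Pi.single i 1)))).congr_deriv ?_
    simp [Ring.lie_def]
  have h3 := (hasDerivAt_trace_mul tr h2 (hasDerivAt_lie_const C h1)).const_mul (3⁻¹ : ℝ)
  rw [h3.deriv]
  have hcyc := trace_lie_cyclic htr (x • L₀ + E (b x)) (E (Pi.single i 1))
    (L₀ + E (deriv b x)) C
  have hskew : ∀ X Y : 𝔸, ⁅X, Y⁆ = -⁅Y, X⁆ := fun X Y => by
    rw [Ring.lie_def, Ring.lie_def, neg_sub]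
  rw [hskew _ C, hskew _ C, hskew _ C, htr, htr (-_), htr (-_),
    hskew (L₀ + E (deriv b x)) (x • L₀ + E (b x))] at hcyc
  rw [hskew (L₀ + E (deriv b x)) (E (Pi.single i 1))]
  simp only [neg_mul, mul_neg, neg_neg, map_neg] at hcyc ⊢
  linarith

theorem dotProduct_apply_single (φ : (ι → ℝ) →ₗ[ℝ] ℝ) (y : ι → ℝ) :
    dotProduct y (fun i => φ (Pi.single i 1)) = φ y := by
  rw [LinearMap.pi_apply_eq_sum_univ φ y]
  simp only [dotProduct, smul_eq_mul]
  refine Finset.sum_congr rfl fun i _ => ?_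
  congr 2
  funext j
  simp [Pi.single_apply, eq_comm]

theorem dotProduct_trace_lie (S T : 𝔸) (y : ι → ℝ) :
    dotProduct y (fun i => tr (⁅E (Pi.single i 1), S⁆ * T)) = tr (⁅E y, S⁆ * T) :=
  dotProduct_apply_single ((tr : 𝔸 →ₗ[ℝ] ℝ) ∘ₗ LinearMap.mulRight ℝ T ∘ₗ lieMap E S) y

/-- A system whose fluxes satisfy `[E V, L] = -[C, L]` is Hamiltonian. -/
theorem isHamiltonianSystem_conMetric (htr : ∀ a b, tr (a * b) = tr (b * a)) {U : Set (ι → ℝ)}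
    (hU : ∀ u ∈ U, (covMetric tr E L₀ u).det ≠ 0) {C : 𝔸} {V : ι → (ι → ℝ) → ℝ}
    (hV : ∀ u ∈ U, ⁅E (fun i => V i u), L₀ + E u⁆ = -⁅C, L₀ + E u⁆)
    (hC : ∀ u ∈ U, ∀ (x : ℝ) (β : ι → ℝ), ∃ z, ⁅E z, L₀ + E u⁆ = -⁅C, x • L₀ + E β⁆) :
    IsHamiltonianSystem U (conMetric tr E L₀) (conCoeff tr E L₀) V := by
  refine ⟨hamDensity tr E L₀ C, contDiff_hamDensity C, fun b hb hbU w hw x i => ?_⟩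
  have hb' := contDiff_deriv hb
  set w₁ : ℝ → ι → ℝ := fun x i =>
    tr (⁅E (Pi.single i 1), L₀ + E (deriv b x)⁆ * (-⁅C, x • L₀ + E (b x)⁆)) with hw₁
  have hw₁s : ContDiff ℝ ∞ w₁ := by
    rw [contDiff_pi]
    intro i
    simp only [hw₁, Ring.lie_def]
    fun_prop
  have hwd : ∀ x, HasDerivAt w (w₁ x) x := fun x => hasDerivAt_pi.2 fun i => by
    have := hw x i
    rwa [varDeriv_hamDensity htr C hb, ← map_neg, ← mul_neg] at this
  have hdw : deriv w = w₁ := funext fun x => (hwd x).deriv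
  have hws : ContDiff ℝ ∞ w :=
    contDiff_infty_iff_deriv.2 ⟨fun x => (hwd x).differentiableAt, hdw ▸ hw₁s⟩
  rw [thirdOrderOp_eq hb' hws]
  congr 1
  funext s
  refine congrFun (a := i) (f := fun i => V i (deriv b s))
    (eq_of_trace_lie (hU _ (hbU s)) fun y => ?_)
  rw [midCurve, hdw, trace_lie_midOp (hU _ (hbU s)), hV _ (hbU s)]
  obtain ⟨z, hz⟩ := hC _ (hbU s) s (b s)
  -- The equation for w_x says that ζ = g⁻¹w_x has [Eζ, L] = −[C, M]; differentiating this below,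
  -- with M_x = L, gives [Eξ, L] = −[C, L], the relation satisfied by V.
  have hζ : (conMetric tr E L₀ (deriv b s)).mulVec (w₁ s) = z :=
    eq_of_trace_lie (hU _ (hbU s)) fun y => by
      rw [trace_lie_conMetric (hU _ (hbU s)), hz, hw₁, dotProduct_trace_lie]
  rw [hζ, hz]
  have h1 : HasDerivAt (fun t => dotProduct y (w₁ t)) (dotProduct y (deriv w₁ s)) s :=
    HasDerivAt.fun_sum fun i _ =>
      (hasDerivAt_pi.1 (hasDerivAt_of_contDiff hw₁s s) i).const_mul (y i)
  have h2 := hasDerivAt_trace_mul tr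
    (hasDerivAt_lie_const (E y) (hasDerivAt_lax (E := E) (L₀ := L₀) (hasDerivAt_of_contDiff hb' s)))
    (hasDerivAt_lie_const C (hasDerivAt_potential (E := E) (L₀ := L₀) hb s)).neg
  have h3 := h1.unique (h2.congr_of_eventuallyEq (.of_forall fun t => dotProduct_trace_lie _ _ y))
  rw [h3]
  simp

end HamiltonianSystem

end WDVV

namespace WDVV

/-! ### The Hamiltonian structure of the WDVV systems -/

variable {r : ℕ} {η : Matrix (Fin (r + 1)) (Fin (r + 1)) ℝ}

theorem transpose_inv_mul_eta (hsymm : η.IsSymm) (hdet : η.det ≠ 0)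
    {A : Matrix (Fin (r + 1)) (Fin (r + 1)) ℝ} (hA : A.transpose = A) :
    (η⁻¹ * A).transpose * η = η * (η⁻¹ * A) := by
  rw [Matrix.transpose_mul, inv_symm hsymm, hA, mul_assoc, eta_inv_mul hdet, ← mul_assoc,
    eta_mul_inv hdet, mul_one, one_mul]

theorem transpose_symOp (hsymm : η.IsSymm) (hdet : η.det ≠ 0) (x : Jet r 2) :
    (symOp η x).transpose * η = η * symOp η x :=
  transpose_inv_mul_eta hsymm hdet (transpose_symMat x)

theorem transpose_inv_mul_baseMat (hsymm : η.IsSymm) (hdet : η.det ≠ 0) (l : Fin r) :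
    (η⁻¹ * baseMat η l).transpose * η = η * (η⁻¹ * baseMat η l) :=
  transpose_inv_mul_eta hsymm hdet (transpose_thirdDeriv hsymm 0 l.succ)

theorem transpose_smul_add_symOp (hsymm : η.IsSymm) (hdet : η.det ≠ 0) (l : Fin r) (a : ℝ)
    (x : Jet r 2) :
    (a • (η⁻¹ * baseMat η l) + symOp η x).transpose * η =
      η * (a • (η⁻¹ * baseMat η l) + symOp η x) := by
  rw [Matrix.transpose_add, Matrix.transpose_smul, add_mul, smul_mul_assoc,
    transpose_inv_mul_baseMat hsymm hdet, transpose_symOp hsymm hdet, mul_add, mul_smul_comm]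

theorem transpose_sliceOp (hsymm : η.IsSymm) (hdet : η.det ≠ 0) (l : Fin r) (x : Jet r 2) :
    (sliceOp η l x).transpose * η = η * sliceOp η l x := by
  simpa [sliceOp] using transpose_smul_add_symOp hsymm hdet l 1 x

/-- The commutator of two self-adjoint operators is skew-adjoint. -/
theorem transpose_eta_mul_lie (hsymm : η.IsSymm) {X Y : Matrix (Fin (r + 1)) (Fin (r + 1)) ℝ}
    (hX : X.transpose * η = η * X) (hY : Y.transpose * η = η * Y) :
    (η * ⁅X, Y⁆).transpose = -(η * ⁅X, Y⁆) := by
  rw [Ring.lie_def, Matrix.transpose_mul, hsymm.eq, Matrix.transpose_sub, Matrix.transpose_mul,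
    Matrix.transpose_mul, sub_mul, mul_assoc, mul_assoc, hX, hY, ← mul_assoc, ← mul_assoc, hX, hY,
    mul_sub, mul_assoc, mul_assoc, neg_sub]

/-- Positions above the diagonal are exactly the (i.castSucc, j.succ) with i ≤ j. So skew matrices
of size r + 1 have as many coordinates as there are variables u^I. -/
theorem eq_zero_of_transpose_eq_neg {A : Matrix (Fin (r + 1)) (Fin (r + 1)) ℝ}
    (hA : A.transpose = -A) (h : ∀ i j : Fin r, i ≤ j → A i.castSucc j.succ = 0) : A = 0 := by
  have hs : ∀ α β, A β α = -A α β := fun α β => congrFun₂ hA α β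
  have hlt : ∀ α β, α < β → A α β = 0 := by
    intro α β hαβ
    obtain ⟨j, rfl⟩ := Fin.exists_succ_eq.2 (Fin.ne_zero_of_lt hαβ)
    obtain ⟨i, rfl⟩ := Fin.exists_castSucc_eq.2 (Fin.ne_last_of_lt hαβ)
    exact h i j (Fin.castSucc_lt_succ_iff.1 hαβ)
  ext α β
  rcases lt_trichotomy α β with hαβ | rfl | hαβ
  · exact hlt α β hαβ
  · have := hs α α
    rw [Matrix.zero_apply]
    linarith
  · rw [hs, hlt β α hαβ, neg_zero, Matrix.zero_apply]

/-- On the regular locus, every skew-adjoint operator is a commutator with the `p`-th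
multiplication operator. -/
theorem exists_symOp_lie_eq (hsymm : η.IsSymm) (hdet : η.det ≠ 0) (p : Fin r) {u : Jet r 2}
    (hu : u ∈ regularLocus η p) {T : Matrix (Fin (r + 1)) (Fin (r + 1)) ℝ}
    (hT : (η * T).transpose = -(η * T)) : ∃ z, ⁅symOp η z, sliceOp η p u⁆ = T := by
  obtain ⟨m, hm⟩ := exists_jet_of_symm (fun i j : Fin r => (min i j, max i j))
    fun i j => by rw [min_comm, max_comm]
  have hm' : ∀ i j : Fin r, i ≤ j → m (i ::ₛ j ::ₛ Sym.nil) = (i, j) := fun i j hij => by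
    rw [hm, min_eq_left hij, max_eq_right hij]
  -- Recording the entries above the diagonal turns x ↦ [E x, L] into an endomorphism, for which
  -- injectivity gives surjectivity.
  let φ : Jet r 2 →ₗ[ℝ] Jet r 2 :=
    { toFun := fun x I => (η * ⁅symOp η x, sliceOp η p u⁆) (m I).1.castSucc (m I).2.succ
      map_add' := fun x y => by
        funext I
        simp only [Ring.lie_def, map_add, add_mul, mul_add, mul_sub, Pi.add_apply,
          Matrix.add_apply, Matrix.sub_apply]
        ring
      map_smul' := fun a x => by
        funext I
        simp only [Ring.lie_def, map_smul, smul_mul_assoc, mul_smul_comm, mul_sub, Pi.smul_apply,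
          Matrix.smul_apply, Matrix.sub_apply, smul_eq_mul, RingHom.id_apply] }
  have hskew : ∀ x, (η * ⁅symOp η x, sliceOp η p u⁆).transpose =
      -(η * ⁅symOp η x, sliceOp η p u⁆) := fun x =>
    transpose_eta_mul_lie hsymm (transpose_symOp hsymm hdet x) (transpose_sliceOp hsymm hdet p u)
  have hinj : Function.Injective φ := by
    rw [injective_iff_map_eq_zero]
    intro x hx
    refine symOp_lie_injective hsymm hdet p hu (eta_mul_cancel hdet ?_)
    rw [eq_zero_of_transpose_eq_neg (hskew x), map_zero, Ring.lie_def, zero_mul, mul_zero, sub_zero,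
      mul_zero]
    intro i j hij
    have h := congrFun hx (i ::ₛ j ::ₛ Sym.nil)
    simp only [φ, LinearMap.coe_mk, AddHom.coe_mk, hm' i j hij] at h
    exact h
  obtain ⟨z, hz⟩ := LinearMap.injective_iff_surjective.1 hinj
    fun I => (η * T) (m I).1.castSucc (m I).2.succ
  refine ⟨z, eta_mul_cancel hdet (sub_eq_zero.1 (eq_zero_of_transpose_eq_neg ?_ ?_))⟩
  · rw [Matrix.transpose_sub, hskew, hT]
    abel
  · intro i j hij
    have h := congrFun hz (i ::ₛ j ::ₛ Sym.nil)
    simp only [φ, LinearMap.coe_mk, AddHom.coe_mk, hm' i j hij] at h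
    rw [Matrix.sub_apply, h, sub_self]

/-- The trace form is nondegenerate on skew-adjoint operators. -/
theorem eq_zero_of_trace_mul_eq_zero (hsymm : η.IsSymm) (hdet : η.det ≠ 0)
    {T : Matrix (Fin (r + 1)) (Fin (r + 1)) ℝ} (hT : (η * T).transpose = -(η * T))
    (h : ∀ R : Matrix (Fin (r + 1)) (Fin (r + 1)) ℝ, (η * R).transpose = -(η * R) →
      (R * T).trace = 0) : T = 0 := by
  have hA : (T * η⁻¹).transpose = -(T * η⁻¹) := by
    have h1 : T * η⁻¹ = η⁻¹ * (η * T) * η⁻¹ := by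
      rw [← mul_assoc, eta_inv_mul hdet, one_mul]
    rw [h1, Matrix.transpose_mul, Matrix.transpose_mul, hT, inv_symm hsymm]
    noncomm_ring
  -- For A = Tη⁻¹, which is skew, this test operator gives tr(A²) = −tr(AᵀA), whose vanishing forces
  -- A = 0.
  have h2 := h (η⁻¹ * (T * η⁻¹)) (by rwa [← mul_assoc, eta_mul_inv hdet, one_mul])
  rw [mul_assoc, Matrix.trace_mul_comm, mul_assoc] at h2
  have h3 : ((T * η⁻¹).conjTranspose * (T * η⁻¹)).trace = 0 := by
    rw [Matrix.conjTranspose_eq_transpose_of_trivial, hA, neg_mul, Matrix.trace_neg, h2,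
      neg_zero]
  rw [Matrix.trace_conjTranspose_mul_self_eq_zero_iff] at h3
  rw [← mul_one T, ← eta_inv_mul hdet, ← mul_assoc, h3, zero_mul]

section

attribute [local instance] Matrix.linftyOpNormedRing Matrix.linftyOpNormedAlgebra

/-- The trace as a continuous linear functional. -/
def traceCLM (r : ℕ) : Matrix (Fin (r + 1)) (Fin (r + 1)) ℝ →L[ℝ] ℝ :=
  LinearMap.toContinuousLinearMap (Matrix.traceLinearMap (Fin (r + 1)) ℝ ℝ)

/-- The continuous linear map underlying `symOp`. -/
def symCLM (η : Matrix (Fin (r + 1)) (Fin (r + 1)) ℝ) :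
    (Sym (Fin r) 2 → ℝ) →L[ℝ] Matrix (Fin (r + 1)) (Fin (r + 1)) ℝ :=
  LinearMap.toContinuousLinearMap (symOp η)

theorem traceCLM_comm (A B : Matrix (Fin (r + 1)) (Fin (r + 1)) ℝ) :
    traceCLM r (A * B) = traceCLM r (B * A) :=
  Matrix.trace_mul_comm A B

/-- The metric is the trace form on skew-adjoint operators pulled back by the isomorphism x ↦ [E x,
L]. -/
theorem det_covMetric_ne_zero (hsymm : η.IsSymm) (hdet : η.det ≠ 0) (p : Fin r) {u : Jet r 2}
    (hu : u ∈ regularLocus η p) :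
    (covMetric (traceCLM r) (symCLM η) (η⁻¹ * baseMat η p) u).det ≠ 0 := by
  intro h
  obtain ⟨v, hv, hv0⟩ := Matrix.exists_mulVec_eq_zero_iff.2 h
  refine hv (symOp_lie_injective hsymm hdet p hu ?_)
  rw [map_zero, Ring.lie_def 0, zero_mul, mul_zero, sub_zero]
  refine eq_zero_of_trace_mul_eq_zero hsymm hdet (transpose_eta_mul_lie hsymm
    (transpose_symOp hsymm hdet v) (transpose_sliceOp hsymm hdet p u)) fun R hR => ?_
  obtain ⟨y, rfl⟩ := exists_symOp_lie_eq hsymm hdet p hu hR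
  have h1 := dotProduct_lieMatrix (traceCLM r) (symCLM η) (sliceOp η p u) (sliceOp η p u) y v
  refine h1.symm.trans ?_
  change dotProduct y ((covMetric (traceCLM r) (symCLM η) (η⁻¹ * baseMat η p) u).mulVec v) = 0
  rw [hv0, dotProduct_zero]

/-- This is [C_l, L] = 0 with C_l split into the part prescribed by η and the part given by the
flux. -/
theorem lie_symOp_flux (hsymm : η.IsSymm) (hdet : η.det ≠ 0) (p l : Fin r) {u : Jet r 2}
    (hu : u ∈ regularLocus η p) :
    ⁅symOp η (fun I => flux p (rhs η p) l I u), sliceOp η p u⁆ =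
      -⁅η⁻¹ * baseMat η l, sliceOp η p u⁆ := by
  have h := (isWDVV_iff hsymm hdet _).1 (isWDVV_fullJet hsymm hdet p hu) l.succ p.succ
  rw [mulOp_fullJet_self, mulOp_succ, param_fullJet, sliceOp, Ring.lie_def, add_mul, mul_add] at h
  rw [Ring.lie_def, Ring.lie_def, eq_neg_iff_add_eq_zero, ← h]
  abel

theorem exists_hamiltonian_structure (hsymm : η.IsSymm) (hdet : η.det ≠ 0) (p : Fin r) :
    ∃ (g : Jet r 2 → Matrix (Sym (Fin r) 2) (Sym (Fin r) 2) ℝ)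
      (c : Jet r 2 → Sym (Fin r) 2 → Sym (Fin r) 2 → Sym (Fin r) 2 → ℝ),
      (∀ i j, ContDiffOn ℝ ∞ (fun u => g u i j) (regularLocus η p)) ∧
      (∀ i j k, ContDiffOn ℝ ∞ (fun u => c u i j k) (regularLocus η p)) ∧
      (∀ u ∈ regularLocus η p, (g u).IsSymm ∧ (g u).det ≠ 0) ∧
      IsHamiltonianOp (regularLocus η p) g c ∧
      ∀ l : Fin r, IsHamiltonianSystem (regularLocus η p) g c (flux p (rhs η p) l) := by
  have hU := fun u (hu : u ∈ regularLocus η p) => det_covMetric_ne_zero hsymm hdet p hu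
  refine ⟨conMetric (traceCLM r) (symCLM η) (η⁻¹ * baseMat η p),
    conCoeff (traceCLM r) (symCLM η) (η⁻¹ * baseMat η p),
    fun i j u hu => (contDiffAt_conMetric _ _ _ (hU u hu) i j).contDiffWithinAt,
    fun i j k u hu => (contDiffAt_conCoeff _ _ _ (hU u hu) i j k).contDiffWithinAt,
    fun u hu => ⟨conMetric_symm _ _ _ traceCLM_comm u, det_conMetric_ne_zero (hU u hu)⟩,
    isHamiltonianOp_conMetric traceCLM_comm hU fun u hu x y => ?_,
    fun l => isHamiltonianSystem_conMetric traceCLM_comm hU (C := η⁻¹ * baseMat η l)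
      (fun u hu => lie_symOp_flux hsymm hdet p l hu) fun u hu x β => ?_⟩
  · exact exists_symOp_lie_eq hsymm hdet p hu (transpose_eta_mul_lie hsymm
      (transpose_symOp hsymm hdet x) (transpose_symOp hsymm hdet y))
  · refine exists_symOp_lie_eq hsymm hdet p hu (T := -⁅η⁻¹ * baseMat η l,
      x • (η⁻¹ * baseMat η p) + symOp η β⁆) ?_
    rw [mul_neg, Matrix.transpose_neg, transpose_eta_mul_lie hsymm
      (transpose_inv_mul_baseMat hsymm hdet l) (transpose_smul_add_symOp hsymm hdet p x β)]

end

end WDVV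

end

/-! ### The main theorem -/

theorem theorem6 (r : ℕ) (hN : r + 1 = 4 ∨ r + 1 = 5)
    (η : Matrix (Fin (r + 1)) (Fin (r + 1)) ℝ) (hsymm : η.IsSymm) (hdet : η.det ≠ 0)
    (p : Fin r) :
    ∃ (Q : MvPolynomial (Sym (Fin r) 2) ℝ)
      (P : WDVV.principal p → MvPolynomial (Sym (Fin r) 2) ℝ)
      (G : WDVV.principal p → WDVV.Jet r 2 → ℝ),
      -- the right-hand sides are rational, with a common denominator that vanishes exactly
      -- where the linear subsystem is not uniquely solvable
      Q ≠ 0 ∧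
      (∀ u, u ∈ WDVV.regularLocus η p ↔ MvPolynomial.eval u Q ≠ 0) ∧
      (∀ τ u, G τ u = MvPolynomial.eval u (P τ) / MvPolynomial.eval u Q) ∧
      Nat.card (WDVV.principal p) = (r + 1).choose 3 ∧
      -- the reduced system is the solved form of the linear subsystem,
      -- and the full WDVV system is equivalent to it
      (∀ f : WDVV.Jet r 3, WDVV.param p f ∈ WDVV.regularLocus η p →
        (WDVV.IsLinearWDVV η p f ↔ WDVV.IsReduced p G f) ∧
        (WDVV.IsWDVV η f ↔ WDVV.IsReduced p G f)) ∧
      -- orthonomic form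
      (∃ lt : Multiset (Fin r) → Multiset (Fin r) → Prop, WDVV.IsRanking lt ∧
        (∀ σ τ : Sym (Fin r) 3, p ∈ σ → p ∉ τ →
          lt (σ : Multiset (Fin r)) (τ : Multiset (Fin r))) ∧
        WDVV.IsOrthonomic lt (WDVV.principal p) (fun τ f => G τ (WDVV.param p f))) ∧
      -- passivity
      WDVV.IsPassive p G (WDVV.regularLocus η p) ∧
      -- on the prolonged WDVV equations, the holonomicity equations are equivalent to
      -- the `N - 2` first-order systems
      (∀ (f : WDVV.Jet r 3) (h : Fin r → WDVV.Jet r 3),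
        WDVV.param p f ∈ WDVV.regularLocus η p → WDVV.IsProlonged η f h →
        (WDVV.IsHolonomic h ↔ WDVV.SatisfiesSystems p G f h)) ∧
      -- the further conditions hold identically
      (∀ l m : Fin r, l ≠ p → m ≠ p → ∀ (I : Sym (Fin r) 2)
        (z : WDVV.InfJet (Sym (Fin r) 2)), z 0 ∈ WDVV.regularLocus η p →
        WDVV.restrictedD p G m (fun y => WDVV.flux p G l I (y 0)) z =
          WDVV.restrictedD p G l (fun y => WDVV.flux p G m I (y 0)) z) ∧
      -- the systems commute
      (∀ l m : Fin r, l ≠ p → m ≠ p →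
        WDVV.FlowsCommute (WDVV.regularLocus η p) (WDVV.flux p G l) (WDVV.flux p G m)) ∧
      -- the systems are Hamiltonian with respect to one nondegenerate third-order operator
      (∃ (g : WDVV.Jet r 2 → Matrix (Sym (Fin r) 2) (Sym (Fin r) 2) ℝ)
        (c : WDVV.Jet r 2 → Sym (Fin r) 2 → Sym (Fin r) 2 → Sym (Fin r) 2 → ℝ),
        (∀ i j, ContDiffOn ℝ ∞ (fun u => g u i j) (WDVV.regularLocus η p)) ∧
        (∀ i j k, ContDiffOn ℝ ∞ (fun u => c u i j k) (WDVV.regularLocus η p)) ∧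
        (∀ u ∈ WDVV.regularLocus η p, (g u).IsSymm ∧ (g u).det ≠ 0) ∧
        WDVV.IsHamiltonianOp (WDVV.regularLocus η p) g c ∧
        ∀ l : Fin r, l ≠ p →
          WDVV.IsHamiltonianSystem (WDVV.regularLocus η p) g c (WDVV.flux p G l)) ∧
      -- the corresponding statements for functions
      (∀ (M : Set (Fin r → ℝ)) (f : (Fin r → ℝ) → ℝ), IsOpen M → ContDiffOn ℝ 4 f M →
        (∀ t ∈ M, WDVV.param p (WDVV.jet3 f t) ∈ WDVV.regularLocus η p) →
        ((∀ t ∈ M, WDVV.IsWDVV η (WDVV.jet3 f t)) ↔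
          ∀ t ∈ M, WDVV.IsReduced p G (WDVV.jet3 f t)) ∧
        ((∀ t ∈ M, WDVV.IsWDVV η (WDVV.jet3 f t)) →
          ∀ l : Fin r, l ≠ p → ∀ I : Sym (Fin r) 2, ∀ t ∈ M,
            WDVV.pd l (fun s => WDVV.param p (WDVV.jet3 f s) I) t =
              WDVV.pd p (fun s => WDVV.flux p G l I (WDVV.param p (WDVV.jet3 f s))) t)) := by
  -- Needed for Q ≠ 0: the space must hold four independent vectors when e₀ and e_p span an
  -- isotropic plane.
  have hr : 3 ≤ r := by omega
  obtain ⟨g, c, hg, hc, hgs, hop, hsys⟩ := WDVV.exists_hamiltonian_structure hsymm hdet p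
  refine ⟨WDVV.denom η p, fun τ => WDVV.numer η p τ, WDVV.rhs η p,
    WDVV.denom_ne_zero hsymm hdet hr p, WDVV.mem_regularLocus_iff_denom hsymm hdet p,
    WDVV.rhs_eq_div p, WDVV.card_principal p,
    fun f hf => ⟨WDVV.isLinearWDVV_iff_isReduced hsymm hdet p f hf,
      WDVV.isWDVV_iff_isReduced hsymm hdet p f hf⟩,
    ⟨_, WDVV.isRanking_rankKey p, fun σ τ => WDVV.rankKey_lt_of_mem p,
      WDVV.isOrthonomic_param p _⟩,
    WDVV.isPassive_rhs hsymm hdet p, WDVV.isHolonomic_iff_satisfiesSystems hsymm hdet p,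
    fun l m _ _ => WDVV.restrictedD_flux_comm hsymm hdet p l m,
    fun l m _ _ => WDVV.flowsCommute_flux hsymm hdet p l m,
    ⟨g, c, hg, hc, hgs, hop, fun l _ => hsys l⟩,
    fun M f hM hf hreg => ⟨forall₂_congr fun t ht =>
      WDVV.isWDVV_iff_isReduced hsymm hdet p _ (hreg t ht),
      fun hW l _ I t ht => WDVV.pd_param_eq_pd_flux hsymm hdet p hM hf hreg hW l I ht⟩⟩
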